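/- Let $n,k$ be integers with $0\le k\le n-2$ and let $0<a<\pi/10$. For small $\varepsilon>0$ consider functions $\varphi_\varepsilon:[\varepsilon,\frac{\pi}{2}]\to\mathbb{R}$ that are smooth on $(\varepsilon,\frac{\pi}{2}]$, strictly concave on $(\varepsilon,2a+\varepsilon]$, constant on $[2a+\varepsilon,\frac{\pi}{2}]$, and satisfy $$\varphi_\varepsilon(r)=\varepsilon\int_1^{r/\varepsilon}\frac{dt}{\sqrt{t^{2(n-k-1)}-1}}\qquad\text{for }\varepsilon\le r\le a+\varepsilon,$$ and are such that $\varphi_\varepsilon''\to0$ as $\varepsilon\to0$, uniformly on every compact subset of $(0,\frac{\pi}{2}]$. For such a family set $$\Phi_{\pm\varphi_\varepsilon}:\mathbb{S}^{n-k-1}\times\mathbb{S}^k\times[\varepsilon,\tfrac{\pi}{2}]\to\mathbb{R}^{n+1}=\mathbb{R}^{n-k}\oplus\mathbb{R}^{k+1},\qquad (y,z,r)\mapsto(1\pm\varphi_\varepsilon(r))(y\sin r+z\cos r),$$ and let $M_\varepsilon^k$ be the union of the images of $\Phi_{\varphi_\varepsilon}$ and $\Phi_{-\varphi_\varepsilon}$.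 For a compact hypersurface $M\subset\mathbb{R}^{n+1}$ and a function $f$ on $M$ write $\|f\|_p=\bigl(\frac{1}{\mathrm{Vol}\,M}\int_M|f|^p\,dv\bigr)^{1/p}$ for $p<\infty$, and $\|f\|_\infty$ for the essential supremum of $|f|$. Let $X$ be the position vector. Let $\mathrm{B}_\varepsilon$ be the second fundamental form $\mathrm{B}(u,w)=\langle\nabla_u\nu,w\rangle$ of $M_\varepsilon^k$, let $|\mathrm{B}_\varepsilon|$ be its operator norm (the largest absolute value of a principal curvature), and let $H_\varepsilon=\frac1n\mathrm{tr}\,\mathrm{B}_\varepsilon$ be the mean curvature. Here $\nu$ is, at each point, the unit normal with $\langle\nu,X\rangle\ge0$ (this determines $\nu$ off a set of measure zero, and where $\langle\nu,X\rangle=0$ either unit normal may be used), so that the unit sphere has $H=1$. Then such families $(\varphi_\varepsilon)$ exist, and for each of them the set $M_\varepsilon^k$ is, for all sufficiently small $\varepsilon>0$, a compact smooth embedded hypersurface of $\mathbb{R}^{n+1}$; moreover, as $\varepsilon\to0$, $\|H_\varepsilon\|_\infty$ and $\|\mathrm{B}_\varepsilon\|_{n-k}$ remain bounded, while $$\|H_\varepsilon-1\|_1\to0\qquad\text{and}\qquad\bigl\||X|-1\bigr\|_\infty\to0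 .$$ -/

import Mathlib

open Real Set Filter Topology MeasureTheory
open scoped ENNReal NNReal ContDiff RealInnerProductSpace Gradient

noncomputable section

/-! ### Hypersurfaces of a Euclidean space and their curvature -/

section Hypersurface

variable {E : Type*} [NormedAddCommGroup E] [InnerProductSpace ℝ E] [CompleteSpace E]

/-- `F` is a smooth regular local equation of `M` at the point `q`. -/
def IsLocalEquation (M : Set E) (q : E) (F : E → ℝ) : Prop :=
  ∃ U : Set E, IsOpen U ∧ q ∈ U ∧ ContDiffOn ℝ ∞ F U ∧ ∇ F q ≠ 0 ∧
    ∀ x ∈ U, (x ∈ M ↔ F x = 0)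

/-- `M` is a smooth embedded hypersurface (without boundary) of `E`. -/
def IsSmoothHypersurface (M : Set E) : Prop :=
  ∀ q ∈ M, ∃ F : E → ℝ, IsLocalEquation M q F

/-- The unit normal field `∇F / |∇F|` of the level sets of `F`. -/
def unitNormal (F : E → ℝ) (x : E) : E := ‖∇ F x‖⁻¹ • ∇ F x

/-- The tangent space at `q` of the level set of `F` through `q`. -/
abbrev tangentHyperplane (F : E → ℝ) (q : E) : Submodule ℝ E := (ℝ ∙ ∇ F q)ᗮ

/-- The shape operator `w ↦ D_w ν` of the level set of `F` at `q`, where `ν = ∇F / |∇F|`.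
The second fundamental form is `B(u, w) = ⟪D_u ν, w⟫`; it equals the metric on the unit sphere
with outward normal. -/
def shapeOperator (F : E → ℝ) (q : E) : tangentHyperplane F q →L[ℝ] tangentHyperplane F q :=
  (tangentHyperplane F q).orthogonalProjectionOnto ∘L fderiv ℝ (unitNormal F) q ∘L
    (tangentHyperplane F q).subtypeL

/-- A local equation of `M` at `q` whose gradient does not point towards the origin, i.e.
`⟪ν, q⟫ ≥ 0`. One exists as soon as `M` has a local equation `F` at `q` (take `F` or `-F`), and the
shape operator at `q` does not depend on which one is chosen, except for its sign when
`⟪ν, q⟫ = 0`. -/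
def outwardEquation (M : Set E) (q : E) : E → ℝ :=
  Classical.epsilon fun F : E → ℝ => IsLocalEquation M q F ∧ 0 ≤ ⟪∇ F q, q⟫

/-- The mean curvature of `M` at `q` (the mean of the principal curvatures), with respect to the
unit normal pointing away from the origin. -/
def meanCurvature (M : Set E) (q : E) : ℝ :=
  (Module.finrank ℝ (tangentHyperplane (outwardEquation M q) q) : ℝ)⁻¹ *
    LinearMap.trace ℝ (tangentHyperplane (outwardEquation M q) q)
      (shapeOperator (outwardEquation M q) q).toLinearMap

/-- The norm `|B|` of the second fundamental form of `M` at `q`: the operator norm, that is, the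
maximum of the absolute values of the principal curvatures. -/
def secondFundamentalNorm (M : Set E) (q : E) : ℝ := ‖shapeOperator (outwardEquation M q) q‖

/-- The normalized norm `‖f‖_p = (1/Vol M ∫_M |f|^p)^(1/p)` (the essential supremum for `p = ∞`) on
an `n`-dimensional submanifold `M`. The volume of `M` is the `n`-dimensional Hausdorff measure,
whose normalization cancels out. -/
def hypersurfaceNorm [MeasurableSpace E] [BorelSpace E]
    (n : ℕ) (M : Set E) (p : ℝ≥0∞) (f : E → ℝ) : ℝ≥0∞ :=
  eLpNorm f p ((μH[(n : ℝ)] M)⁻¹ • (μH[(n : ℝ)]).restrict M)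

end Hypersurface

/-! ### The glued spheres -/

/-- `ℝ^p ⊕ ℝ^q` with its Euclidean structure. -/
abbrev EuclideanSum (p q : ℕ) : Type :=
  WithLp 2 (EuclideanSpace ℝ (Fin p) × EuclideanSpace ℝ (Fin q))

/-- The map `(y, z, r) ↦ (1 + φ(r)) (y sin r + z cos r)`. -/
def warpedMap {p q : ℕ} (φ : ℝ → ℝ)
    (x : EuclideanSpace ℝ (Fin p) × EuclideanSpace ℝ (Fin q) × ℝ) : EuclideanSum p q :=
  (1 + φ x.2.2) • WithLp.toLp 2 (Real.sin x.2.2 • x.1, Real.cos x.2.2 • x.2.1)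

/-- The warped graph: the image of `S^(p-1) × S^(q-1) × [ε, π/2]` under `warpedMap φ`. -/
def warpedGraph (p q : ℕ) (ε : ℝ) (φ : ℝ → ℝ) : Set (EuclideanSum p q) :=
  warpedMap φ '' (Metric.sphere 0 1 ×ˢ Metric.sphere 0 1 ×ˢ Icc ε (π / 2))

/-- The union of the warped graphs of `φ` and `-φ`, in `ℝ^(n+1) = ℝ^(n-k) ⊕ ℝ^(k+1)`. -/
def gluedSpheres (n k : ℕ) (ε : ℝ) (φ : ℝ → ℝ) : Set (EuclideanSum (n - k) (k + 1)) :=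
  warpedGraph (n - k) (k + 1) ε φ ∪ warpedGraph (n - k) (k + 1) ε (-φ)

/-- The neck function `r ↦ ε ∫_1^(r/ε) dt / √(t^(2m) - 1)`. -/
def neckFunction (m : ℕ) (ε r : ℝ) : ℝ :=
  ε * ∫ t in (1 : ℝ)..(r / ε), 1 / √(t ^ (2 * m) - 1)

/-- The profiles on `[ε, π/2]`: the neck function on `[ε, a + ε]`, a constant on
`[2a + ε, π/2]`, smooth on `(ε, π/2]` and strictly concave on `(ε, 2a + ε]`. -/
structure IsProfile (m : ℕ) (a ε : ℝ) (φ : ℝ → ℝ) : Prop where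
  eq_neck : ∀ r ∈ Icc ε (a + ε), φ r = neckFunction m ε r
  eq_const : ∃ b : ℝ, ∀ r ∈ Icc (2 * a + ε) (π / 2), φ r = b
  smooth : ContDiffOn ℝ ∞ φ (Ioc ε (π / 2))
  concave : StrictConcaveOn ℝ (Ioc ε (2 * a + ε)) φ

/-- A family of profiles, for all small `ε > 0`, whose second derivatives tend to `0` as `ε → 0`,
uniformly on the compact subsets of `(0, π/2]`. -/
structure IsProfileFamily (m : ℕ) (a : ℝ) (φ : ℝ → ℝ → ℝ) : Prop where
  profile : ∀ᶠ ε in 𝓝[>] (0 : ℝ), IsProfile m a ε (φ ε)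
  deriv2 : ∀ K ⊆ Ioc (0 : ℝ) (π / 2), IsCompact K →
    TendstoUniformlyOn (fun ε r => iteratedDerivWithin 2 (φ ε) (Ioc ε (π / 2)) r) 0 (𝓝[>] 0) K

end

/-!
The hypersurface is `{x | |‖x‖ - 1| = φ_ε(r), r ≥ ε}`, where `r` is the angle between `x` and
`0 ⊕ ℝ^(k+1)`, and it is invariant under rotations of both factors. With `m = n - k - 1`, its neck
`r ≤ a + ε` is a catenoid of dimension `m + 1`, scaled by `ε`, bent around the sphere `S^k`.

*Curvature.* A unit normal of a rotational hypersurface along its profile curve is explicit, and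
differentiating it along curves through a point gives all the principal curvatures at once, for an
arbitrary local equation (`IsLocalEquation.shapeOperator_rotational`, `curvature_polar`). On the
neck, parametrized by `‖x‖ = 1 + ε s` and `r = ε c(s)` with `c` the catenoid profile
(`exists_catenoid_profile`), which is smooth even across the waist `r = ε` where `φ_ε'` blows up,
the principal curvatures are of size `ε^m / r^(m+1)`, up to a bounded error. These terms cancel in
the trace because the catenoid is minimal, so that `H` stays bounded (`neck_estimate`). On
`r ≥ δ`, concavity bounds the slope of `φ_ε` by its height, which tends to `0`, and `φ_ε''` tends to
`0` by assumption; the hypersurface is therefore `C²`-close to the unit sphere and all principal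
curvatures are close to `1` (`exists_outer_estimate`).

*Volume.* Since `φ_ε` is monotone, the arc length of the profile is controlled by `r + φ_ε(r) ≤ 2r`,
and the part `r ≤ R` is a union of Lipschitz images of boxes of volume at most a multiple of
`R^(m+1)`, for all `R ≥ ε` (`exists_volume_bound`). The total volume is bounded below by projecting
to a hyperplane (`exists_volume_lower_bound`).

*Norms.* The integral of `(ε^m / r^(m+1))^(m+1)` is bounded by summing over dyadic shells
(`lintegral_neck_le`), which gives the bound of `‖B‖_(n-k)`. As `H` is bounded near the neck, which
has little volume, and close to `1` elsewhere, `‖H - 1‖_1` tends to `0`.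

*Existence.* The slope of the neck function, cut off smoothly between `a + ε` and `2a + ε`, is the
slope of a profile (`isProfile_standardProfile`); away from `r = 0` it tends to `0` with its
derivative.
-/

/-! ### Shape operators along curves -/

namespace IsLocalEquation

variable {E : Type*} [NormedAddCommGroup E] [InnerProductSpace ℝ E] [CompleteSpace E]
variable {M : Set E} {q : E} {F : E → ℝ}

theorem gradient_ne_zero (h : IsLocalEquation M q F) : ∇ F q ≠ 0 := by
  obtain ⟨U, -, -, -, h4, -⟩ := h
  exact h4

theorem contDiffAt (h : IsLocalEquation M q F) : ContDiffAt ℝ ∞ F q := by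
  obtain ⟨U, hU, hq, hF, -, -⟩ := h
  exact hF.contDiffAt (hU.mem_nhds hq)

theorem contDiffAt_gradient (h : IsLocalEquation M q F) : ContDiffAt ℝ ∞ (∇ F) q := by
  have h1 : ContDiffAt ℝ ∞ (fderiv ℝ F) q := h.contDiffAt.fderiv_right (by simp)
  exact (InnerProductSpace.toDual ℝ E).symm.toContinuousLinearEquiv.contDiff.contDiffAt.comp q h1

/-- A local equation at `q` is a local equation at all nearby points of `M`. -/
theorem eventually (h : IsLocalEquation M q F) : ∀ᶠ x in 𝓝 q, x ∈ M → IsLocalEquation M x F := by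
  have hg := h.contDiffAt_gradient.continuousAt.eventually_ne h.gradient_ne_zero
  obtain ⟨U, hU, hq, hF, h4, h5⟩ := h
  filter_upwards [hg, hU.mem_nhds hq] with x hx hxU _
  exact ⟨U, hU, hxU, hF, hx, h5⟩

theorem eq_zero (h : IsLocalEquation M q F) : ∀ᶠ x in 𝓝 q, x ∈ M → F x = 0 := by
  obtain ⟨U, hU, hq, hF, h4, h5⟩ := h
  filter_upwards [hU.mem_nhds hq] with x hx hM
  exact (h5 x hx).1 hM

theorem neg (h : IsLocalEquation M q F) : IsLocalEquation M q (-F) := by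
  have hg : ∇ (-F) q = -∇ F q := by
    simp [gradient, fderiv_neg]
  obtain ⟨U, hU, hq, hF, h4, h5⟩ := h
  refine ⟨U, hU, hq, hF.neg, ?_, fun x hx => ?_⟩
  · rw [hg]; simpa using h4
  · rw [h5 x hx]; simp

/-- The gradient of a local equation is orthogonal to the velocities of the curves in `M`. -/
theorem inner_gradient_eq_zero (h : IsLocalEquation M q F) {γ : ℝ → E} {w : E} {s : ℝ}
    (hγ : HasDerivAt γ w s) (hq : γ s = q) (hM : ∀ᶠ t in 𝓝 s, γ t ∈ M) : ⟪∇ F q, w⟫ = 0 := by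
  have hF : HasFDerivAt F (fderiv ℝ F q) (γ s) := by
    rw [hq]
    exact (h.contDiffAt.differentiableAt (by simp)).hasFDerivAt
  have h1 : HasDerivAt (F ∘ γ) (fderiv ℝ F q w) s := hF.comp_hasDerivAt s hγ
  have h2 : HasDerivAt (F ∘ γ) 0 s := by
    refine (hasDerivAt_const s (0 : ℝ)).congr_of_eventuallyEq ?_
    have := hγ.continuousAt.eventually (p := fun x => x ∈ M → F x = 0) (by rw [hq]; exact h.eq_zero)
    filter_upwards [this, hM] with t h1 h2 using h1 h2
  rw [← toDual_gradient] at h1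
  simpa using h1.unique h2

/-- If the unit field `n` along a curve in `M` is normal to `M`, then the unit normal of the local
equation is `n` up to a sign which is constant along the curve. -/
theorem unitNormal_comp_eventuallyEq (h : IsLocalEquation M q F) {γ n : ℝ → E} {s σ : ℝ}
    (hγ : ContinuousAt γ s) (hq : γ s = q) (hn : ContinuousAt n s)
    (hn1 : ∀ᶠ t in 𝓝 s, ‖n t‖ = 1) (hpar : ∀ᶠ t in 𝓝 s, ∃ c : ℝ, ∇ F (γ t) = c • n t)
    (hσ : σ = 1 ∨ σ = -1) (hs : unitNormal F q = σ • n s) :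
    unitNormal F ∘ γ =ᶠ[𝓝 s] fun t => σ • n t := by
  have hσ2 : σ * σ = 1 := by rcases hσ with rfl | rfl <;> norm_num
  have hc : ContinuousAt (fun t => ⟪∇ F (γ t), σ • n t⟫) s := by
    have : ContinuousAt (fun t => ∇ F (γ t)) s :=
      ContinuousAt.comp (g := ∇ F) (by rw [hq]; exact h.contDiffAt_gradient.continuousAt) hγ
    fun_prop
  have hpos : 0 < ⟪∇ F (γ s), σ • n s⟫ := by
    rw [← hs, hq, unitNormal, inner_smul_right, real_inner_self_eq_norm_sq]
    have := norm_pos_iff.2 h.gradient_ne_zero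
    positivity
  filter_upwards [hc.eventually (lt_mem_nhds hpos), hn1, hpar] with t ht hnt ⟨c, hct⟩
  have hcpos : 0 < c * σ := by
    rw [hct, inner_smul_left, inner_smul_right, real_inner_self_eq_norm_sq, hnt] at ht
    simpa [mul_assoc] using ht
  have habs : |c| = c * σ := by
    have : |c * σ| = |c| := by rcases hσ with rfl | rfl <;> simp
    rw [← this, abs_of_pos hcpos]
  simp only [Function.comp, unitNormal, hct, norm_smul, hnt, Real.norm_eq_abs, habs, mul_one]
  rw [smul_smul]
  congr 1
  have hc0 : c ≠ 0 := by rintro rfl; simp at hcpos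
  have hσ0 : σ ≠ 0 := by rintro rfl; simp at hσ2
  field_simp
  linarith

/-- The shape operator is computed by differentiating a unit normal field along a curve. -/
theorem shapeOperator_apply (h : IsLocalEquation M q F) {γ n : ℝ → E} {s σ κ : ℝ} {w : E}
    (hγ : HasDerivAt γ w s) (hq : γ s = q) (hM : ∀ᶠ t in 𝓝 s, γ t ∈ M)
    (hn : HasDerivAt n (κ • w) s)
    (hn1 : ∀ᶠ t in 𝓝 s, ‖n t‖ = 1) (hpar : ∀ᶠ t in 𝓝 s, ∃ c : ℝ, ∇ F (γ t) = c • n t)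
    (hσ : σ = 1 ∨ σ = -1) (hs : unitNormal F q = σ • n s) :
    ∃ hw : w ∈ tangentHyperplane F q,
      shapeOperator F q ⟨w, hw⟩ = (σ * κ) • (⟨w, hw⟩ : tangentHyperplane F q) := by
  have hw : w ∈ tangentHyperplane F q := by
    rw [tangentHyperplane, Submodule.mem_orthogonal_singleton_iff_inner_right]
    exact h.inner_gradient_eq_zero hγ hq hM
  refine ⟨hw, ?_⟩
  have hd : DifferentiableAt ℝ (unitNormal F) q := by
    have h1 : DifferentiableAt ℝ (∇ F) q := h.contDiffAt_gradient.differentiableAt (by simp)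
    exact ((h1.norm ℝ h.gradient_ne_zero).inv (norm_ne_zero_iff.2 h.gradient_ne_zero)).smul h1
  have h1 : HasDerivAt (unitNormal F ∘ γ) (fderiv ℝ (unitNormal F) q w) s := by
    refine HasFDerivAt.comp_hasDerivAt s ?_ hγ
    rw [hq]
    exact hd.hasFDerivAt
  have h2 : HasDerivAt (unitNormal F ∘ γ) (σ • κ • w) s :=
    (hn.const_smul σ).congr_of_eventuallyEq
      (h.unitNormal_comp_eventuallyEq hγ.continuousAt hq hn.continuousAt hn1 hpar hσ hs)
  have h3 := h1.unique h2
  have h4 : shapeOperator F q ⟨w, hw⟩ =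
      (tangentHyperplane F q).orthogonalProjectionOnto (fderiv ℝ (unitNormal F) q w) := rfl
  rw [h4, h3, smul_smul]
  exact Submodule.orthogonalProjectionOnto_mem_subspace_eq_self ((σ * κ) • ⟨w, hw⟩)

end IsLocalEquation

section

variable {E : Type*} [NormedAddCommGroup E] [InnerProductSpace ℝ E] [CompleteSpace E]

theorem outwardEquation_spec {M : Set E} (hM : IsSmoothHypersurface M) {q : E} (hq : q ∈ M) :
    IsLocalEquation M q (outwardEquation M q) ∧ 0 ≤ ⟪∇ (outwardEquation M q) q, q⟫ := by
  obtain ⟨F, hF⟩ := hM q hq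
  refine Classical.epsilon_spec (p := fun F : E → ℝ => IsLocalEquation M q F ∧ 0 ≤ ⟪∇ F q, q⟫) ?_
  rcases le_total 0 ⟪∇ F q, q⟫ with h | h
  · exact ⟨F, hF, h⟩
  · refine ⟨-F, hF.neg, ?_⟩
    have hg : ∇ (-F) q = -∇ F q := by
      simp [gradient, fderiv_neg]
    rw [hg, inner_neg_left]
    linarith

omit [CompleteSpace E] in
/-- A curve on the unit sphere through `y` with prescribed velocity `u ⟂ y`. -/
theorem exists_curve_sphere {y u : E} (hy : ‖y‖ = 1) (hu : ⟪y, u⟫ = 0) :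
    ∃ c : ℝ → E, c 0 = y ∧ (∀ t, ‖c t‖ = 1) ∧ HasDerivAt c u 0 := by
  rcases eq_or_ne u 0 with rfl | hu0
  · exact ⟨fun _ => y, rfl, fun _ => hy, hasDerivAt_const _ _⟩
  have hu1 : ‖u‖ ≠ 0 := norm_ne_zero_iff.2 hu0
  refine ⟨fun t => Real.cos (t * ‖u‖) • y + (Real.sin (t * ‖u‖) / ‖u‖) • u, by simp,
    fun t => ?_, ?_⟩
  · have : ‖Real.cos (t * ‖u‖) • y + (Real.sin (t * ‖u‖) / ‖u‖) • u‖ ^ 2 = 1 := by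
      rw [norm_add_sq_real, inner_smul_left, inner_smul_right, hu, norm_smul, norm_smul, hy,
        Real.norm_eq_abs, Real.norm_eq_abs, mul_pow, mul_pow, sq_abs, sq_abs, div_pow]
      field_simp
      simp only [mul_zero, add_zero, conj_trivial]
      linear_combination ‖u‖ * Real.cos_sq_add_sin_sq (t * ‖u‖)
    nlinarith [norm_nonneg (Real.cos (t * ‖u‖) • y + (Real.sin (t * ‖u‖) / ‖u‖) • u)]
  · have h1 : HasDerivAt (fun t : ℝ => t * ‖u‖) ‖u‖ 0 := by
      simpa using (hasDerivAt_id (0 : ℝ)).mul_const ‖u‖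
    have h2 := (h1.cos.smul_const y).add ((h1.sin.div_const ‖u‖).smul_const u)
    refine h2.congr_deriv ?_
    simp [hu1]

/-- A local equation of a round sphere has shape operator `± 1 / ρ`, with the sign of
`⟪ν, q⟫`. -/
theorem shapeOperator_sphere {M : Set E} {q : E} {F : E → ℝ} (h : IsLocalEquation M q F) {ρ : ℝ}
    (hρ : 0 < ρ) (hq : ‖q‖ = ρ) (hM : ∀ᶠ x in 𝓝 q, ‖x‖ = ρ → x ∈ M) (hout : 0 ≤ ⟪∇ F q, q⟫) :
    shapeOperator F q = ρ⁻¹ • ContinuousLinearMap.id ℝ (tangentHyperplane F q) := by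
  have hcurve : ∀ x : E, ‖x‖ = ρ → ∀ u : E, ⟪x, u⟫ = 0 →
      ∃ c : ℝ → E, c 0 = x ∧ (∀ t, ‖c t‖ = ρ) ∧ HasDerivAt c u 0 := by
    intro x hx u hu
    obtain ⟨c, hc0, hc1, hc2⟩ := exists_curve_sphere (y := ρ⁻¹ • x) (u := ρ⁻¹ • u)
      (by rw [norm_smul, hx, norm_inv, Real.norm_of_nonneg hρ.le, inv_mul_cancel₀ hρ.ne'])
      (by rw [inner_smul_left, inner_smul_right, hu]; simp)
    refine ⟨fun t => ρ • c t, by simp [hc0, smul_smul, hρ.ne'], fun t => ?_, ?_⟩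
    · rw [norm_smul, hc1, mul_one, Real.norm_of_nonneg hρ.le]
    · exact (hc2.const_smul ρ).congr_deriv (by simp [smul_smul, hρ.ne'])
  have hMM : ∀ᶠ x in 𝓝 q, ∀ᶠ z in 𝓝 x, ‖z‖ = ρ → z ∈ M := eventually_eventually_nhds.2 hM
  have hpar : ∀ᶠ x in 𝓝 q, ‖x‖ = ρ → ∃ c : ℝ, ∇ F x = c • (ρ⁻¹ • x) := by
    filter_upwards [h.eventually, hMM] with x hx hxM hxρ
    have hxl := hx (hxM.self_of_nhds hxρ)
    have horth : ∀ u ∈ (ℝ ∙ x)ᗮ, ⟪∇ F x, u⟫ = 0 := by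
      intro u hu
      rw [Submodule.mem_orthogonal_singleton_iff_inner_right] at hu
      obtain ⟨c, hc0, hc1, hc2⟩ := hcurve x hxρ u hu
      refine hxl.inner_gradient_eq_zero hc2 hc0 ?_
      have := hc2.continuousAt.eventually (p := fun z => ‖z‖ = ρ → z ∈ M) (by rw [hc0]; exact hxM)
      filter_upwards [this] with t ht using ht (hc1 t)
    have hmem : ∇ F x ∈ (ℝ ∙ x)ᗮᗮ := by
      rw [Submodule.mem_orthogonal]
      intro u hu
      rw [real_inner_comm]
      exact horth u hu
    rw [Submodule.orthogonal_orthogonal, Submodule.mem_span_singleton] at hmem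
    obtain ⟨c, hc⟩ := hmem
    exact ⟨c * ρ, by rw [smul_smul, mul_assoc, mul_inv_cancel₀ hρ.ne', mul_one, hc]⟩
  have hs : unitNormal F q = (1 : ℝ) • (ρ⁻¹ • q) := by
    obtain ⟨c, hc⟩ := hpar.self_of_nhds hq
    have hg := h.gradient_ne_zero
    have hc0 : c ≠ 0 := by rintro rfl; simp [hc] at hg
    have hcpos : 0 < c := by
      refine lt_of_le_of_ne ?_ hc0.symm
      rw [hc, smul_smul, inner_smul_left, real_inner_self_eq_norm_sq, hq] at hout
      simp only [conj_trivial] at hout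
      have : c * ρ⁻¹ * ρ ^ 2 = c * ρ := by field_simp
      rw [this] at hout
      exact nonneg_of_mul_nonneg_left hout hρ
    rw [unitNormal, hc, norm_smul, norm_smul, hq, norm_inv, Real.norm_of_nonneg hρ.le,
      Real.norm_of_nonneg hcpos.le, inv_mul_cancel₀ hρ.ne', smul_smul, mul_one,
      inv_mul_cancel₀ hc0]
  ext1 w
  obtain ⟨w, hw⟩ := w
  have hqw : ⟪q, w⟫ = 0 := by
    have h1 := hw
    rw [tangentHyperplane, Submodule.mem_orthogonal_singleton_iff_inner_right] at h1
    obtain ⟨c, hc⟩ := hpar.self_of_nhds hq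
    have hg := h.gradient_ne_zero
    rw [hc] at h1 hg
    rw [smul_smul, inner_smul_left] at h1
    rw [smul_smul] at hg
    rcases mul_eq_zero.1 h1 with h2 | h2
    · simp only [conj_trivial] at h2
      rw [h2] at hg; simp at hg
    · exact h2
  obtain ⟨c, hc0, hc1, hc2⟩ := hcurve q hq w hqw
  have hev : ∀ {P : E → Prop}, (∀ᶠ x in 𝓝 q, ‖x‖ = ρ → P x) → ∀ᶠ t in 𝓝 (0 : ℝ), P (c t) := by
    intro P hP
    have := hc2.continuousAt.eventually (p := fun z => ‖z‖ = ρ → P z) (by rw [hc0]; exact hP)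
    filter_upwards [this] with t ht using ht (hc1 t)
  obtain ⟨hw', heq⟩ := h.shapeOperator_apply (n := fun t => ρ⁻¹ • c t) (κ := ρ⁻¹) hc2 hc0
    (hev hM) (hc2.const_smul ρ⁻¹)
    (.of_forall fun t => by
      rw [norm_smul, hc1, norm_inv, Real.norm_of_nonneg hρ.le, inv_mul_cancel₀ hρ.ne'])
    (hev hpar) (Or.inl rfl) (by rw [hc0]; exact hs)
  rw [heq]
  simp

end

/-! ### Curvature of rotational hypersurfaces -/

section Rotational

variable {V W : Type*} [NormedAddCommGroup V] [InnerProductSpace ℝ V] [NormedAddCommGroup W]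
  [InnerProductSpace ℝ W]

theorem hasDerivAt_toLp {f : ℝ → V} {g : ℝ → W} {f' : V} {g' : W} {s : ℝ}
    (hf : HasDerivAt f f' s) (hg : HasDerivAt g g' s) :
    HasDerivAt (fun t => (WithLp.toLp 2 (f t, g t) : WithLp 2 (V × W)))
      (WithLp.toLp 2 (f', g')) s := by
  have h := (WithLp.prodContinuousLinearEquiv 2 ℝ V W).symm.toContinuousLinearMap.hasFDerivAt
    (x := (f s, g s))
  exact h.comp_hasDerivAt s (hf.prodMk hg)

theorem inner_toLp (x : WithLp 2 (V × W)) (u : V)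
    (v : W) :
    ⟪x, (WithLp.toLp 2 (u, v) : WithLp 2 (V × W))⟫ = ⟪x.fst, u⟫ + ⟪x.snd, v⟫ := by
  rw [WithLp.prod_inner_apply]; rfl

theorem eq_inner_smul_of_orthogonal {E : Type*} [NormedAddCommGroup E] [InnerProductSpace ℝ E]
    {g y : E} (hy : ‖y‖ = 1) (h : ∀ u, ⟪y, u⟫ = 0 → ⟪g, u⟫ = 0) : g = ⟪y, g⟫ • y := by
  have h1 : ⟪y, g - ⟪y, g⟫ • y⟫ = 0 := by
    rw [inner_sub_right, inner_smul_right, real_inner_self_eq_norm_sq, hy]; ring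
  have h2 := h _ h1
  have h3 : ⟪g - ⟪y, g⟫ • y, g - ⟪y, g⟫ • y⟫ = 0 := by
    rw [inner_sub_left, h2, inner_smul_left, h1]; simp
  exact sub_eq_zero.1 (inner_self_eq_zero.1 h3)

/-- Along a rotational hypersurface with profile curve `(α, β)`, the gradient of a local equation
is a multiple of the rotated normal of the profile curve. -/
theorem IsLocalEquation.gradient_rotational [CompleteSpace V] [CompleteSpace W]
    {M : Set (WithLp 2 (V × W))} {F : WithLp 2 (V × W) → ℝ}
    {α β : ℝ → ℝ} {α1 β1 s D : ℝ} {y : V} {z : W}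
    (hF : IsLocalEquation M (WithLp.toLp 2 (α s • y, β s • z)) F) (hy : ‖y‖ = 1) (hz : ‖z‖ = 1)
    (hα : HasDerivAt α α1 s) (hβ : HasDerivAt β β1 s) (hα0 : α s ≠ 0) (hβ0 : β s ≠ 0)
    (hD : D ≠ 0) (hD2 : D ^ 2 = α1 ^ 2 + β1 ^ 2)
    (hM : ∀ᶠ t in 𝓝 s, ∀ y z, ‖y‖ = 1 → ‖z‖ = 1 →
      (WithLp.toLp 2 (α t • y, β t • z) : WithLp 2 (V × W)) ∈ M) :
    ∃ c : ℝ, ∇ F (WithLp.toLp 2 (α s • y, β s • z)) =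
      c • (WithLp.toLp 2 ((-β1 / D) • y, (α1 / D) • z) : WithLp 2 (V × W)) := by
  set g := ∇ F (WithLp.toLp 2 (α s • y, β s • z)) with hg
  have hy' : g.fst = ⟪y, g.fst⟫ • y := by
    refine eq_inner_smul_of_orthogonal hy fun u hu => ?_
    obtain ⟨c, hc0, hc1, hc2⟩ := exists_curve_sphere hy hu
    have h1 := hF.inner_gradient_eq_zero (s := 0)
      (hasDerivAt_toLp (hc2.const_smul (α s)) (hasDerivAt_const 0 (β s • z)))
      (by simp only [Pi.smul_apply, hc0]) (.of_forall fun t => hM.self_of_nhds _ _ (hc1 t) hz)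
    rw [← hg, inner_toLp, inner_smul_right, inner_zero_right, add_zero] at h1
    exact (mul_eq_zero.1 h1).resolve_left hα0
  have hz' : g.snd = ⟪z, g.snd⟫ • z := by
    refine eq_inner_smul_of_orthogonal hz fun u hu => ?_
    obtain ⟨c, hc0, hc1, hc2⟩ := exists_curve_sphere hz hu
    have h1 := hF.inner_gradient_eq_zero (s := 0)
      (hasDerivAt_toLp (hasDerivAt_const 0 (α s • y)) (hc2.const_smul (β s)))
      (by simp only [Pi.smul_apply, hc0]) (.of_forall fun t => hM.self_of_nhds _ _ hy (hc1 t))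
    rw [← hg, inner_toLp, inner_smul_right, inner_zero_right, zero_add] at h1
    exact (mul_eq_zero.1 h1).resolve_left hβ0
  have h3 : α1 * ⟪y, g.fst⟫ + β1 * ⟪z, g.snd⟫ = 0 := by
    have h1 := hF.inner_gradient_eq_zero
      (hasDerivAt_toLp (hα.smul_const y) (hβ.smul_const z)) rfl
      (hM.mono fun t ht => ht _ _ hy hz)
    rw [← hg, inner_toLp, inner_smul_right, inner_smul_right] at h1
    rwa [real_inner_comm, real_inner_comm z] at h1
  set a := ⟪y, g.fst⟫
  set b := ⟪z, g.snd⟫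
  refine ⟨(-β1 * a + α1 * b) / D, ?_⟩
  have e1 : (-β1 * a + α1 * b) / D * (-β1 / D) = a := by
    field_simp
    linear_combination (-a) * hD2 - α1 * h3
  have e2 : (-β1 * a + α1 * b) / D * (α1 / D) = b := by
    field_simp
    linear_combination (-b) * hD2 - β1 * h3
  have e3 : g = WithLp.toLp 2 (g.fst, g.snd) := rfl
  rw [e3, ← WithLp.toLp_smul, Prod.smul_mk, smul_smul, smul_smul, e1, e2, ← hy', ← hz']

/-- The curvature operator of a rotational hypersurface, as an operator of the ambient space: the
principal curvatures are `κy` on `y^⟂`, `κz` on `z^⟂` and `κ` on the direction `τ` of the profile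
curve. -/
noncomputable def rotationalOperator (y : V) (z : W)
    (τ : WithLp 2 (V × W)) (κ κy κz : ℝ) : WithLp 2 (V × W) →L[ℝ] WithLp 2 (V × W) :=
  let ι := (WithLp.prodContinuousLinearEquiv 2 ℝ V
    W).symm.toContinuousLinearMap
  κy • (ι ∘L ContinuousLinearMap.inl ℝ _ _ ∘L
      (ContinuousLinearMap.id ℝ _ - InnerProductSpace.rankOne ℝ y y) ∘L WithLp.fstL 2 ℝ _ _) +
    κz • (ι ∘L ContinuousLinearMap.inr ℝ _ _ ∘L
      (ContinuousLinearMap.id ℝ _ - InnerProductSpace.rankOne ℝ z z) ∘L WithLp.sndL 2 ℝ _ _) +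
    κ • InnerProductSpace.rankOne ℝ τ τ

theorem rotationalOperator_apply (y : V) (z : W)
    (τ : WithLp 2 (V × W)) (κ κy κz : ℝ) (w : WithLp 2 (V × W)) :
    rotationalOperator y z τ κ κy κz w =
      κy • WithLp.toLp 2 (w.fst - ⟪y, w.fst⟫ • y, 0) +
      κz • WithLp.toLp 2 (0, w.snd - ⟪z, w.snd⟫ • z) + κ • ⟪τ, w⟫ • τ := rfl

theorem trace_id_sub_rankOne [FiniteDimensional ℝ V] {x : V} (hx : ‖x‖ = 1) :
    LinearMap.trace ℝ _ (ContinuousLinearMap.id ℝ V - InnerProductSpace.rankOne ℝ x x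
      : V →L[ℝ] V).toLinearMap = Module.finrank ℝ V - 1 := by
  have : ((InnerProductSpace.rankOne ℝ x x : V →L[ℝ] V).toLinearMap).trace ℝ _ = 1 := by
    rw [InnerProductSpace.trace_rankOne, real_inner_self_eq_norm_sq, hx]; norm_num
  rw [ContinuousLinearMap.toLinearMap_sub, map_sub, this]
  simp

theorem norm_sub_inner_smul_le {x : V} (u : V) (hx : ‖x‖ = 1) : ‖u - ⟪x, u⟫ • x‖ ≤ ‖u‖ := by
  refine (abs_le_of_sq_le_sq' ?_ (norm_nonneg u)).2
  rw [norm_sub_sq_real, inner_smul_right, norm_smul, hx, real_inner_comm, mul_one,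
    Real.norm_eq_abs, sq_abs]
  nlinarith [sq_nonneg ⟪x, u⟫]

theorem trace_rotationalOperator [FiniteDimensional ℝ V] [FiniteDimensional ℝ W] {y : V} {z : W}
    {τ : WithLp 2 (V × W)} (hy : ‖y‖ = 1) (hz : ‖z‖ = 1) (hτ : ‖τ‖ = 1) (κ κy κz : ℝ) :
    LinearMap.trace ℝ _ (rotationalOperator y z τ κ κy κz).toLinearMap =
      κ + (Module.finrank ℝ V - 1) * κy + (Module.finrank ℝ W - 1) * κz := by
  have h2 := trace_id_sub_rankOne hy
  have h3 := trace_id_sub_rankOne hz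
  have hτ' : ((InnerProductSpace.rankOne ℝ τ τ :
      WithLp 2 (V × W) →L[ℝ] WithLp 2 (V × W)).toLinearMap).trace ℝ _ = 1 := by
    rw [InnerProductSpace.trace_rankOne, real_inner_self_eq_norm_sq, hτ]; norm_num
  have e1 : LinearMap.trace ℝ _
      ((WithLp.prodContinuousLinearEquiv 2 ℝ V W).symm.toContinuousLinearMap
      ∘L ContinuousLinearMap.inl ℝ V W ∘L
      (ContinuousLinearMap.id ℝ _ - InnerProductSpace.rankOne ℝ y y) ∘L
        WithLp.fstL 2 ℝ V W).toLinearMap = Module.finrank ℝ V - 1 := by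
    rw [← h2]
    exact LinearMap.trace_comp_comm' ((ContinuousLinearMap.id ℝ V - InnerProductSpace.rankOne ℝ y y)
      ∘L WithLp.fstL 2 ℝ V W).toLinearMap
      ((WithLp.prodContinuousLinearEquiv 2 ℝ V W).symm.toContinuousLinearMap
      ∘L ContinuousLinearMap.inl ℝ V W).toLinearMap
  have e2 : LinearMap.trace ℝ _
      ((WithLp.prodContinuousLinearEquiv 2 ℝ V W).symm.toContinuousLinearMap
      ∘L ContinuousLinearMap.inr ℝ V W ∘L
      (ContinuousLinearMap.id ℝ _ - InnerProductSpace.rankOne ℝ z z) ∘L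
        WithLp.sndL 2 ℝ V W).toLinearMap = Module.finrank ℝ W - 1 := by
    rw [← h3]
    exact LinearMap.trace_comp_comm' ((ContinuousLinearMap.id ℝ W - InnerProductSpace.rankOne ℝ z z)
      ∘L WithLp.sndL 2 ℝ V W).toLinearMap
      ((WithLp.prodContinuousLinearEquiv 2 ℝ V W).symm.toContinuousLinearMap
      ∘L ContinuousLinearMap.inr ℝ V W).toLinearMap
  rw [rotationalOperator]
  simp only [ContinuousLinearMap.toLinearMap_add, ContinuousLinearMap.toLinearMap_smul,
    map_add, map_smul, hτ', e1, e2, smul_eq_mul]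
  ring

theorem norm_rotationalOperator_le {y : V} {z : W}
    {τ : WithLp 2 (V × W)} (hy : ‖y‖ = 1) (hz : ‖z‖ = 1) (hτ : ‖τ‖ = 1) (κ κy κz : ℝ)
    (w : WithLp 2 (V × W)) :
    ‖rotationalOperator y z τ κ κy κz w‖ ≤ (|κ| + |κy| + |κz|) * ‖w‖ := by
  rw [rotationalOperator_apply]
  have e1 : ‖κy • (WithLp.toLp 2 (w.fst - ⟪y, w.fst⟫ • y, 0) : WithLp 2 (V × W))‖
      ≤ |κy| * ‖w‖ := by
    rw [norm_smul, WithLp.norm_toLp_fst 2]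
    exact mul_le_mul_of_nonneg_left
      ((norm_sub_inner_smul_le _ hy).trans (WithLp.norm_fst_le (x := w))) (abs_nonneg _)
  have e2 : ‖κz • (WithLp.toLp 2 (0, w.snd - ⟪z, w.snd⟫ • z) : WithLp 2 (V × W))‖
      ≤ |κz| * ‖w‖ := by
    rw [norm_smul, WithLp.norm_toLp_snd 2]
    exact mul_le_mul_of_nonneg_left
      ((norm_sub_inner_smul_le _ hz).trans (WithLp.norm_snd_le (x := w))) (abs_nonneg _)
  have e3 : ‖κ • ⟪τ, w⟫ • τ‖ ≤ |κ| * ‖w‖ := by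
    rw [norm_smul, norm_smul, hτ, mul_one]
    refine mul_le_mul_of_nonneg_left ?_ (abs_nonneg _)
    have := abs_real_inner_le_norm τ w
    rwa [hτ, one_mul] at this
  calc _ ≤ _ + _ := norm_add_le _ _
    _ ≤ (_ + _) + _ := by gcongr; exact norm_add_le _ _
    _ ≤ (|κy| * ‖w‖ + |κz| * ‖w‖) + |κ| * ‖w‖ := by gcongr
    _ = _ := by ring

theorem norm_toLp_smul_sq {y : V} {z : W} (hy : ‖y‖ = 1) (hz : ‖z‖ = 1) (a b : ℝ) :
    ‖(WithLp.toLp 2 (a • y, b • z) : WithLp 2 (V × W))‖ ^ 2 = a ^ 2 + b ^ 2 := by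
  rw [WithLp.prod_norm_sq_eq_of_L2]
  simp [norm_smul, hy, hz]

variable [FiniteDimensional ℝ V] [FiniteDimensional ℝ W]

/-- The principal curvatures of a rotational hypersurface with profile curve `(α, β)`, with respect
to the unit normal given by an arbitrary local equation. The sign `σ` compares that normal with the
normal `(-β', α') / D` of the profile curve. -/
theorem IsLocalEquation.shapeOperator_rotational [CompleteSpace V] [CompleteSpace W]
    {M : Set (WithLp 2 (V × W))} {F : WithLp 2 (V × W) → ℝ}
    {α β α1 β1 : ℝ → ℝ} {α2 β2 s D κ κy κz : ℝ} {y : V} {z : W}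
    (hF : IsLocalEquation M (WithLp.toLp 2 (α s • y, β s • z)) F) (hy : ‖y‖ = 1) (hz : ‖z‖ = 1)
    (hα : ∀ᶠ t in 𝓝 s, HasDerivAt α (α1 t) t) (hβ : ∀ᶠ t in 𝓝 s, HasDerivAt β (β1 t) t)
    (hα1 : HasDerivAt α1 α2 s) (hβ1 : HasDerivAt β1 β2 s) (hα0 : α s ≠ 0) (hβ0 : β s ≠ 0)
    (hD : 0 < D) (hD2 : D ^ 2 = α1 s ^ 2 + β1 s ^ 2)
    (hM : ∀ᶠ t in 𝓝 s, ∀ y z, ‖y‖ = 1 → ‖z‖ = 1 →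
      (WithLp.toLp 2 (α t • y, β t • z) : WithLp 2 (V × W)) ∈ M)
    (hκ : κ = (β1 s * α2 - α1 s * β2) / D ^ 3) (hκy : κy = -β1 s / (D * α s))
    (hκz : κz = α1 s / (D * β s)) :
    ∃ σ : ℝ, (σ = 1 ∨ σ = -1) ∧
      ⟪∇ F (WithLp.toLp 2 (α s • y, β s • z)),
        (WithLp.toLp 2 (α s • y, β s • z) : WithLp 2 (V × W))⟫ =
        σ * (‖∇ F (WithLp.toLp 2 (α s • y, β s • z))‖ * ((α1 s * β s - β1 s * α s) / D)) ∧
      LinearMap.trace ℝ _ (shapeOperator F (WithLp.toLp 2 (α s • y, β s • z))).toLinearMap =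
        σ * (κ + (Module.finrank ℝ V - 1) * κy + (Module.finrank ℝ W - 1) * κz) ∧
      ‖shapeOperator F (WithLp.toLp 2 (α s • y, β s • z))‖ ≤ |κ| + |κy| + |κz| := by
  set q : WithLp 2 (V × W) := WithLp.toLp 2 (α s • y, β s • z) with hq
  set Dl : ℝ → ℝ := fun t => √(α1 t ^ 2 + β1 t ^ 2) with hDl
  have hDs : Dl s = D := by rw [hDl]; simp only; rw [← hD2, Real.sqrt_sq hD.le]
  have hDd : HasDerivAt Dl ((α1 s * α2 + β1 s * β2) / D) s := by
    have h1 := ((hα1.pow 2).add (hβ1.pow 2)).sqrt (by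
      simp only [Pi.add_apply, Pi.pow_apply]; rw [← hD2]; positivity)
    refine h1.congr_deriv ?_
    have : √((α1 ^ 2 + β1 ^ 2) s) = D := hDs
    rw [this]
    field_simp
    ring
  have hDpos : ∀ᶠ t in 𝓝 s, 0 < Dl t :=
    hDd.continuousAt.eventually (lt_mem_nhds (by rw [hDs]; exact hD))
  have hDsq : ∀ t, Dl t ^ 2 = α1 t ^ 2 + β1 t ^ 2 := fun t => Real.sq_sqrt (by positivity)
  -- `N t` is the unit normal along the orbit of the point `(α t, β t)` of the profile curve.
  set N : ℝ → V → W → WithLp 2 (V × W) :=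
    fun t y z => WithLp.toLp 2 ((-β1 t / Dl t) • y, (α1 t / Dl t) • z) with hN
  have hN1 : ∀ t, 0 < Dl t → ∀ y z, ‖y‖ = 1 → ‖z‖ = 1 → ‖N t y z‖ = 1 := by
    intro t ht y z hy hz
    have : ‖N t y z‖ ^ 2 = 1 := by
      rw [hN]; simp only
      rw [norm_toLp_smul_sq hy hz, div_pow, div_pow, ← add_div, hDsq, neg_sq,
        div_eq_one_iff_eq (by rw [← hDsq]; positivity)]
      ring
    nlinarith [norm_nonneg (N t y z)]
  have hαc := hα.self_of_nhds.continuousAt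
  have hβc := hβ.self_of_nhds.continuousAt
  have hpar : ∀ (a : ℝ) (τ : ℝ → ℝ) (c : ℝ → V) (d : ℝ → W), ContinuousAt τ a → ContinuousAt c a →
      ContinuousAt d a → τ a = s → c a = y → d a = z → (∀ t, ‖c t‖ = 1) → (∀ t, ‖d t‖ = 1) →
      ∀ᶠ t in 𝓝 a, ∃ e : ℝ, ∇ F (WithLp.toLp 2 (α (τ t) • c t, β (τ t) • d t)) =
        e • N (τ t) (c t) (d t) := by
    intro a τ c d hτ hc hd hτa hca hda hc1 hd1
    subst hτa
    have hγ : ContinuousAt (fun t =>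
        (WithLp.toLp 2 (α (τ t) • c t, β (τ t) • d t) : WithLp 2 (V × W))) a := by
      refine (WithLp.prod_continuous_toLp 2 V W).continuousAt.comp (ContinuousAt.prodMk ?_ ?_)
      · exact (ContinuousAt.comp (g := α) hαc hτ).smul hc
      · exact (ContinuousAt.comp (g := β) hβc hτ).smul hd
    have h1 := hγ.eventually (p := fun x => x ∈ M → IsLocalEquation M x F)
      (by simp only [hca, hda]; exact hF.eventually)
    have h2 := hτ.eventually (eventually_eventually_nhds.2 hM)
    have h3 := hτ.eventually (hαc.eventually_ne hα0)
    have h4 := hτ.eventually (hβc.eventually_ne hβ0)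
    filter_upwards [h1, h2, h3, h4, hτ.eventually hα, hτ.eventually hβ, hτ.eventually hDpos]
      with t h1 h2 h3 h4 h5 h6 h7
    exact (h1 (h2.self_of_nhds _ _ (hc1 t) (hd1 t))).gradient_rotational (hc1 t) (hd1 t) h5 h6 h3 h4
      h7.ne' (hDsq _) h2
  -- Since `∇ F q` is a nonzero multiple `e` of the unit vector `N s y z`, `σ` is the sign of `e`.
  obtain ⟨e, he⟩ := (hpar s id (fun _ => y) (fun _ => z) continuousAt_id continuousAt_const
    continuousAt_const rfl rfl rfl (fun _ => hy) (fun _ => hz)).self_of_nhds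
  simp only [id] at he
  rw [← hq] at he
  have hNs : ‖N s y z‖ = 1 := hN1 s (by rw [hDs]; exact hD) y z hy hz
  have he0 : e ≠ 0 := by rintro rfl; exact hF.gradient_ne_zero (by rw [he, zero_smul])
  have hnorm : ‖∇ F q‖ = |e| := by rw [he, norm_smul, hNs, mul_one, Real.norm_eq_abs]
  obtain ⟨σ, hσ, hσe⟩ : ∃ σ : ℝ, (σ = 1 ∨ σ = -1) ∧ e = σ * |e| := by
    rcases lt_or_gt_of_ne he0 with h | h
    · exact ⟨-1, Or.inr rfl, by rw [abs_of_neg h]; ring⟩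
    · exact ⟨1, Or.inl rfl, by rw [abs_of_pos h]; ring⟩
  have hunit : unitNormal F q = σ • N s y z := by
    rw [unitNormal, hnorm, he, smul_smul]
    congr 1
    have := abs_pos.2 he0
    field_simp
    linarith
  refine ⟨σ, hσ, ?_, ?_⟩
  · rw [he, norm_smul, hNs, inner_smul_left, hq, inner_toLp]
    simp only [hN, WithLp.toLp_fst, WithLp.toLp_snd, inner_smul_left, inner_smul_right,
      real_inner_self_eq_norm_sq, hy, hz, hDs, conj_trivial, Real.norm_eq_abs]
    rw [mul_one]
    nth_rewrite 1 [hσe]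
    ring
  -- The principal directions are found by moving `q` along the orbits of the rotations of either
  -- factor and along the profile curve.
  have hyshape : ∀ u, ⟪y, u⟫ = 0 → ∃ hw : (WithLp.toLp 2 (u, 0) : WithLp 2 (V × W)) ∈
      tangentHyperplane F q, shapeOperator F q ⟨_, hw⟩ = (σ * κy) •
        (⟨_, hw⟩ : tangentHyperplane F q) := by
    intro u hu
    obtain ⟨c, hc0, hc1, hc2⟩ := exists_curve_sphere (u := (α s)⁻¹ • u) hy
      (by rw [inner_smul_right, hu, mul_zero])
    have hγ := hasDerivAt_toLp (hc2.const_smul (α s)) (hasDerivAt_const 0 (β s • z))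
    have hn := hasDerivAt_toLp (hc2.const_smul (-β1 s / Dl s))
      (hasDerivAt_const 0 ((α1 s / Dl s) • z))
    rw [smul_inv_smul₀ hα0] at hγ
    refine hF.shapeOperator_apply (n := fun t => N s (c t) z) hγ
      (by simp only [Pi.smul_apply, hc0, hq])
      (.of_forall fun t => hM.self_of_nhds _ _ (hc1 t) hz) (hn.congr_deriv ?_)
      (.of_forall fun t => hN1 s (by rw [hDs]; exact hD) _ _ (hc1 t) hz)
      (hpar 0 (fun _ => s) c (fun _ => z) continuousAt_const hc2.continuousAt continuousAt_const
        rfl hc0 rfl hc1 (fun _ => hz)) hσ (by rw [hunit, hc0])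
    rw [← WithLp.toLp_smul, Prod.smul_mk, smul_zero, smul_smul, hκy, hDs]
    congr 3
    field_simp
  have hzshape : ∀ v, ⟪z, v⟫ = 0 → ∃ hw : (WithLp.toLp 2 (0, v) : WithLp 2 (V × W)) ∈
      tangentHyperplane F q, shapeOperator F q ⟨_, hw⟩ = (σ * κz) •
        (⟨_, hw⟩ : tangentHyperplane F q) := by
    intro u hu
    obtain ⟨c, hc0, hc1, hc2⟩ := exists_curve_sphere (u := (β s)⁻¹ • u) hz
      (by rw [inner_smul_right, hu, mul_zero])
    have hγ := hasDerivAt_toLp (hasDerivAt_const 0 (α s • y)) (hc2.const_smul (β s))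
    have hn := hasDerivAt_toLp (hasDerivAt_const 0 ((-β1 s / Dl s) • y))
      (hc2.const_smul (α1 s / Dl s))
    rw [smul_inv_smul₀ hβ0] at hγ
    refine hF.shapeOperator_apply (n := fun t => N s y (c t)) hγ
      (by simp only [Pi.smul_apply, hc0, hq])
      (.of_forall fun t => hM.self_of_nhds _ _ hy (hc1 t)) (hn.congr_deriv ?_)
      (.of_forall fun t => hN1 s (by rw [hDs]; exact hD) _ _ hy (hc1 t))
      (hpar 0 (fun _ => s) (fun _ => y) c continuousAt_const continuousAt_const hc2.continuousAt
        rfl rfl hc0 (fun _ => hy) hc1) hσ (by rw [hunit, hc0])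
    rw [← WithLp.toLp_smul, Prod.smul_mk, smul_zero, smul_smul, hκz, hDs]
    congr 3
    field_simp
  set τ : WithLp 2 (V × W) := WithLp.toLp 2 ((α1 s / D) • y, (β1 s / D) • z) with hτ
  have hτ1 : ‖τ‖ = 1 := by
    have : ‖τ‖ ^ 2 = 1 := by
      rw [hτ, norm_toLp_smul_sq hy hz, div_pow, div_pow, ← add_div, ← hD2, div_self (by positivity)]
    nlinarith [norm_nonneg τ]
  have hτshape : ∃ hw : τ ∈ tangentHyperplane F q, shapeOperator F q ⟨_, hw⟩ = (σ * κ) •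
        (⟨_, hw⟩ : tangentHyperplane F q) := by
    have hγ := hasDerivAt_toLp (hα.self_of_nhds.smul_const y) (hβ.self_of_nhds.smul_const z)
    have hn := hasDerivAt_toLp ((hβ1.neg.div hDd (by rw [hDs]; exact hD.ne')).smul_const y)
      ((hα1.div hDd (by rw [hDs]; exact hD.ne')).smul_const z)
    have hn' : HasDerivAt (fun t => N t y z)
        (κ • (WithLp.toLp 2 (α1 s • y, β1 s • z) : WithLp 2 (V × W))) s := by
      refine hn.congr_deriv ?_
      rw [← WithLp.toLp_smul, Prod.smul_mk, smul_smul, smul_smul, hκ, hDs]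
      congr 3
      · simp only [Pi.neg_apply]
        field_simp
        linear_combination (-β2) * hD2
      · field_simp
        linear_combination α2 * hD2
    obtain ⟨hw, heq⟩ := hF.shapeOperator_apply hγ rfl
      (hM.mono fun t ht => ht _ _ hy hz) hn'
      (hDpos.mono fun t ht => hN1 t ht _ _ hy hz)
      (hpar s id (fun _ => y) (fun _ => z) continuousAt_id continuousAt_const continuousAt_const
        rfl rfl rfl (fun _ => hy) (fun _ => hz)) hσ hunit
    have e1 : τ = D⁻¹ • (WithLp.toLp 2 (α1 s • y, β1 s • z) : WithLp 2 (V × W)) := by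
      rw [hτ, ← WithLp.toLp_smul, Prod.smul_mk, smul_smul, smul_smul, inv_mul_eq_div,
        inv_mul_eq_div]
    have hw' : τ ∈ tangentHyperplane F q := by rw [e1]; exact Submodule.smul_mem _ _ hw
    refine ⟨hw', ?_⟩
    have e2 : (⟨τ, hw'⟩ : tangentHyperplane F q) = D⁻¹ • ⟨_, hw⟩ := Subtype.ext e1
    rw [e2, map_smul, heq, smul_comm]
  -- The shape operator is the restriction of an operator of the ambient space whose range lies in
  -- the tangent space, so that both have the same trace.
  set A := σ • rotationalOperator y z τ κ κy κz with hA
  have hyu : ∀ w : WithLp 2 (V × W), ⟪y, w.fst - ⟪y, w.fst⟫ • y⟫ = 0 := fun w => by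
    rw [inner_sub_right, inner_smul_right, real_inner_self_eq_norm_sq, hy]; ring
  have hzu : ∀ w : WithLp 2 (V × W), ⟪z, w.snd - ⟪z, w.snd⟫ • z⟫ = 0 := fun w => by
    rw [inner_sub_right, inner_smul_right, real_inner_self_eq_norm_sq, hz]; ring
  have hAmem : ∀ w, A w ∈ tangentHyperplane F q := by
    intro w
    rw [hA, _root_.smul_apply, rotationalOperator_apply]
    refine Submodule.smul_mem _ _ (Submodule.add_mem _ (Submodule.add_mem _ ?_ ?_) ?_)
    · exact Submodule.smul_mem _ _ (hyshape _ (hyu w)).1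
    · exact Submodule.smul_mem _ _ (hzshape _ (hzu w)).1
    · exact Submodule.smul_mem _ _ (Submodule.smul_mem _ _ hτshape.1)
  have hAeq : ∀ w : tangentHyperplane F q, (shapeOperator F q w : WithLp 2 (V × W)) = A w := by
    rintro ⟨w, hw⟩
    have h1 : ⟪N s y z, w⟫ = 0 := by
      have := hw
      rw [tangentHyperplane, Submodule.mem_orthogonal_singleton_iff_inner_right, he,
        inner_smul_left] at this
      simpa [he0] using this
    have h2 : -β1 s * ⟪y, w.fst⟫ + α1 s * ⟪z, w.snd⟫ = 0 := by
      rw [real_inner_comm, hN] at h1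
      simp only at h1
      rw [inner_toLp, inner_smul_right, inner_smul_right, hDs, real_inner_comm,
        real_inner_comm z] at h1
      field_simp at h1
      linarith
    have h3 : ⟪τ, w⟫ = (α1 s * ⟪y, w.fst⟫ + β1 s * ⟪z, w.snd⟫) / D := by
      rw [real_inner_comm, hτ, inner_toLp, inner_smul_right, inner_smul_right, real_inner_comm,
        real_inner_comm z]
      ring
    obtain ⟨a1, b1⟩ := hyshape _ (hyu w)
    obtain ⟨a2, b2⟩ := hzshape _ (hzu w)
    obtain ⟨a3, b3⟩ := hτshape
    have hdec : (⟨w, hw⟩ : tangentHyperplane F q) = ⟨_, a1⟩ + ⟨_, a2⟩ + ⟪τ, w⟫ • ⟨_, a3⟩ := by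
      refine Subtype.ext ?_
      have e1 : ⟪τ, w⟫ * (α1 s / D) = ⟪y, w.fst⟫ := by
        rw [h3]; field_simp; linear_combination (-⟪y, w.fst⟫) * hD2 + β1 s * h2
      have e2 : ⟪τ, w⟫ * (β1 s / D) = ⟪z, w.snd⟫ := by
        rw [h3]; field_simp; linear_combination (-⟪z, w.snd⟫) * hD2 - α1 s * h2
      have e3 : ⟪τ, w⟫ • τ = WithLp.toLp 2 (⟪y, w.fst⟫ • y, ⟪z, w.snd⟫ • z) := by
        rw [← e1, ← e2, hτ, ← WithLp.toLp_smul, Prod.smul_mk, smul_smul, smul_smul]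
      simp only [Submodule.coe_add, Submodule.coe_smul]
      rw [e3, ← WithLp.toLp_add, ← WithLp.toLp_add, Prod.mk_add_mk, Prod.mk_add_mk]
      simp only [add_zero, zero_add, sub_add_cancel]
      rfl
    rw [hdec, map_add, map_add, map_smul, b1, b2, b3, ← hdec]
    simp only [Submodule.coe_add, Submodule.coe_smul]
    rw [hA, _root_.smul_apply, rotationalOperator_apply]
    module
  have hσ1 : |σ| = 1 := by rcases hσ with rfl | rfl <;> simp
  refine ⟨?_, ?_⟩
  · have h1 : (shapeOperator F q).toLinearMap =
        A.toLinearMap.restrict (p := tangentHyperplane F q) (q := tangentHyperplane F q)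
          (fun x _ => hAmem x) := by
      exact LinearMap.ext fun w => Subtype.ext (hAeq w)
    rw [h1]
    have h2 := LinearMap.trace_restrict_eq_of_forall_mem (tangentHyperplane F q) A.toLinearMap hAmem
    refine h2.trans ?_
    rw [hA, ContinuousLinearMap.toLinearMap_smul, map_smul, trace_rotationalOperator hy hz hτ1,
      smul_eq_mul]
  · refine ContinuousLinearMap.opNorm_le_bound _ (by positivity) fun w => ?_
    rw [← Submodule.norm_coe, hAeq, hA, _root_.smul_apply, norm_smul, Real.norm_eq_abs,
      hσ1, one_mul]
    exact norm_rotationalOperator_le hy hz hτ1 κ κy κz _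

end Rotational

/-! ### Rotational hypersurfaces in polar coordinates -/

section Polar

variable {p q : ℕ}

theorem finrank_tangentHyperplane {n : ℕ} (hn : p + q = n + 1) {F : EuclideanSum p q → ℝ}
    {x : EuclideanSum p q} (h : ∇ F x ≠ 0) :
    Module.finrank ℝ (tangentHyperplane F x) = n := by
  have : Fact (Module.finrank ℝ (EuclideanSum p q) = n + 1) := ⟨by
    rw [(WithLp.linearEquiv 2 ℝ (EuclideanSpace ℝ (Fin p) × EuclideanSpace ℝ (Fin q))).finrank_eq,
      Module.finrank_prod, finrank_euclideanSpace_fin, finrank_euclideanSpace_fin, hn]⟩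
  exact Submodule.finrank_orthogonal_span_singleton h

/-- The curvature of a rotational hypersurface whose profile curve is given in polar coordinates
`(ρ, θ)`. The sign `σ` is the one for which the normal points away from the origin. -/
theorem curvature_polar {n : ℕ} (hn : p + q = n + 1) {M : Set (EuclideanSum p q)}
    (hMs : IsSmoothHypersurface M) {ρ θ ρ1 θ1 : ℝ → ℝ} {ρ2 θ2 s D : ℝ}
    {y : EuclideanSpace ℝ (Fin p)} {z : EuclideanSpace ℝ (Fin q)} (hy : ‖y‖ = 1) (hz : ‖z‖ = 1)
    (hρ : ∀ᶠ t in 𝓝 s, HasDerivAt ρ (ρ1 t) t) (hθ : ∀ᶠ t in 𝓝 s, HasDerivAt θ (θ1 t) t)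
    (hρ1 : HasDerivAt ρ1 ρ2 s) (hθ1 : HasDerivAt θ1 θ2 s) (hρ0 : 0 < ρ s)
    (hsin : 0 < sin (θ s)) (hcos : 0 < cos (θ s)) (hD : 0 < D)
    (hD2 : D ^ 2 = ρ1 s ^ 2 + ρ s ^ 2 * θ1 s ^ 2)
    (hM : ∀ᶠ t in 𝓝 s, ∀ y z, ‖y‖ = 1 → ‖z‖ = 1 →
      (WithLp.toLp 2 ((ρ t * sin (θ t)) • y, (ρ t * cos (θ t)) • z) : EuclideanSum p q) ∈ M) :
    let κ := (ρ s ^ 2 * θ1 s ^ 3 + 2 * ρ1 s ^ 2 * θ1 s + ρ s * (ρ1 s * θ2 - ρ2 * θ1 s)) / D ^ 3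
    let κy := (θ1 s - ρ1 s * cos (θ s) / (ρ s * sin (θ s))) / D
    let κz := (θ1 s + ρ1 s * sin (θ s) / (ρ s * cos (θ s))) / D
    let x : EuclideanSum p q := WithLp.toLp 2 ((ρ s * sin (θ s)) • y, (ρ s * cos (θ s)) • z)
    ∃ σ : ℝ, (σ = 1 ∨ σ = -1) ∧ 0 ≤ σ * θ1 s ∧
      meanCurvature M x = σ * (κ + (p - 1) * κy + (q - 1) * κz) / n ∧
      secondFundamentalNorm M x ≤ |κ| + |κy| + |κz| := by
  intro κ κy κz x
  have hx : x ∈ M := hM.self_of_nhds y z hy hz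
  obtain ⟨hF, hout⟩ := outwardEquation_spec hMs hx
  have hsc : sin (θ s) ^ 2 + cos (θ s) ^ 2 = 1 := sin_sq_add_cos_sq _
  have hθs := hθ.self_of_nhds
  have hρs := hρ.self_of_nhds
  have hα : ∀ᶠ t in 𝓝 s, HasDerivAt (fun t => ρ t * sin (θ t))
      (ρ1 t * sin (θ t) + ρ t * (cos (θ t) * θ1 t)) t := by
    filter_upwards [hρ, hθ] with t h1 h2 using h1.mul h2.sin
  have hβ : ∀ᶠ t in 𝓝 s, HasDerivAt (fun t => ρ t * cos (θ t))
      (ρ1 t * cos (θ t) + ρ t * (-sin (θ t) * θ1 t)) t := by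
    filter_upwards [hρ, hθ] with t h1 h2 using h1.mul h2.cos
  have hα1 := (hρ1.mul hθs.sin).add (hρs.mul (hθs.cos.mul hθ1))
  have hβ1 := (hρ1.mul hθs.cos).add (hρs.mul (hθs.sin.neg.mul hθ1))
  have hmain := IsLocalEquation.shapeOperator_rotational (D := D) (κ := κ)
    (κy := κy) (κz := κz) hF hy hz hα hβ hα1 hβ1 (by positivity) (by positivity) hD
    (by linear_combination hD2 + (-ρ1 s ^ 2 - ρ s ^ 2 * θ1 s ^ 2) * hsc) hM
    (by
      simp only [κ, Pi.neg_apply, Pi.mul_apply]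
      congr 1
      linear_combination (-(ρ s ^ 2 * θ1 s ^ 3 + 2 * ρ1 s ^ 2 * θ1 s +
        ρ s * (ρ1 s * θ2 - ρ2 * θ1 s))) * hsc)
    (by simp only [κy]; field_simp; ring)
    (by simp only [κz]; field_simp; ring)
  obtain ⟨σ, hσ, hinn, htr, hnorm⟩ := hmain
  refine ⟨σ, hσ, ?_, ?_, hnorm⟩
  · have hg := norm_pos_iff.2 hF.gradient_ne_zero
    rw [show (outwardEquation M x) = outwardEquation M (WithLp.toLp 2 ((ρ s * sin (θ s)) • y,
      (ρ s * cos (θ s)) • z)) from rfl] at hout hg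
    rw [hinn] at hout
    have e : (ρ1 s * sin (θ s) + ρ s * (cos (θ s) * θ1 s)) * (ρ s * cos (θ s)) -
      (ρ1 s * cos (θ s) + ρ s * (-sin (θ s) * θ1 s)) * (ρ s * sin (θ s)) =
        ρ s ^ 2 * θ1 s := by
      linear_combination ρ s ^ 2 * θ1 s * hsc
    rw [e] at hout
    have h2 : 0 < ‖∇ (outwardEquation M x) x‖ * (ρ s ^ 2 / D) := by positivity
    refine nonneg_of_mul_nonneg_left ?_ h2
    calc (0 : ℝ) ≤ _ := hout
      _ = _ := by ring
  · rw [meanCurvature, finrank_tangentHyperplane hn hF.gradient_ne_zero, htr,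
      finrank_euclideanSpace_fin, finrank_euclideanSpace_fin]
    ring

/-- The curvature at a point near which the hypersurface contains a round sphere centred at the
origin. It covers the circle `r = π / 2`, where polar coordinates are singular. -/
theorem curvature_of_sphere {n : ℕ} (hn : p + q = n + 1) (hn0 : n ≠ 0) {M : Set (EuclideanSum p q)}
    (hMs : IsSmoothHypersurface M) {x : EuclideanSum p q} {ρ : ℝ} (hρ : 0 < ρ) (hx : ‖x‖ = ρ)
    (hM : ∀ᶠ z in 𝓝 x, ‖z‖ = ρ → z ∈ M) :
    meanCurvature M x = ρ⁻¹ ∧ secondFundamentalNorm M x ≤ ρ⁻¹ := by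
  obtain ⟨hF, hout⟩ := outwardEquation_spec hMs (hM.self_of_nhds hx)
  have h := shapeOperator_sphere hF hρ hx hM hout
  have hf := finrank_tangentHyperplane hn hF.gradient_ne_zero
  constructor
  · rw [meanCurvature, h, ContinuousLinearMap.toLinearMap_smul, map_smul,
      ContinuousLinearMap.coe_id, LinearMap.trace_id, hf, smul_eq_mul]
    field_simp
  · rw [secondFundamentalNorm, h]
    refine ContinuousLinearMap.opNorm_le_bound _ (by positivity) fun w => ?_
    rw [_root_.smul_apply, ContinuousLinearMap.id_apply, norm_smul, norm_inv,
      Real.norm_of_nonneg hρ.le]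

end Polar

/-! ### The profile of the catenoid -/

section Neck

/-- The height `∫_1^t dτ / √(τ^(2m) - 1)` of the rescaled neck. -/
noncomputable def neckHeight (m : ℕ) (t : ℝ) : ℝ := ∫ τ in (1 : ℝ)..t, 1 / √(τ ^ (2 * m) - 1)

theorem neckFunction_eq (m : ℕ) (ε r : ℝ) : neckFunction m ε r = ε * neckHeight m (r / ε) := rfl

variable {m : ℕ}

theorem two_mul_sub_one_le_pow (hm : m ≠ 0) {t : ℝ} (ht : 1 ≤ t) :
    2 * (t - 1) ≤ t ^ (2 * m) - 1 := by
  have : t ^ 2 ≤ t ^ (2 * m) := pow_le_pow_right₀ ht (by omega)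
  nlinarith [sq_nonneg (t - 1)]

theorem pow_sub_one_pos (hm : m ≠ 0) {t : ℝ} (ht : 1 < t) : 0 < t ^ (2 * m) - 1 := by
  have := two_mul_sub_one_le_pow hm ht.le
  linarith

theorem hasDerivAt_sqrt_two_mul {t : ℝ} (ht : 1 < t) :
    HasDerivAt (fun t => √(2 * (t - 1))) (1 / √(2 * (t - 1))) t := by
  have h1 : HasDerivAt (fun t : ℝ => 2 * (t - 1)) 2 t := by
    simpa using ((hasDerivAt_id t).sub_const 1).const_mul 2
  refine (h1.sqrt (by linarith)).congr_deriv ?_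
  have : 0 < √(2 * (t - 1)) := Real.sqrt_pos.2 (by linarith)
  field_simp

theorem intervalIntegrable_inv_sqrt {t : ℝ} (ht : 1 ≤ t) :
    IntervalIntegrable (fun t : ℝ => 1 / √(2 * (t - 1))) volume 1 t := by
  refine (intervalIntegrable_iff_integrableOn_Ioc_of_le ht).2 ?_
  refine intervalIntegral.integrableOn_deriv_of_nonneg (g := fun t => √(2 * (t - 1)))
    (by fun_prop) (fun x hx => hasDerivAt_sqrt_two_mul hx.1) fun x _ => by positivity

theorem one_div_sqrt_pow_le (hm : m ≠ 0) {t : ℝ} (ht : 1 < t) :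
    1 / √(t ^ (2 * m) - 1) ≤ 1 / √(2 * (t - 1)) :=
  one_div_le_one_div_of_le (Real.sqrt_pos.2 (by linarith))
    (Real.sqrt_le_sqrt (two_mul_sub_one_le_pow hm ht.le))

theorem intervalIntegrable_neck (hm : m ≠ 0) {t : ℝ} (ht : 1 ≤ t) :
    IntervalIntegrable (fun t : ℝ => 1 / √(t ^ (2 * m) - 1)) volume 1 t := by
  refine (intervalIntegrable_inv_sqrt ht).mono_fun ?_ ?_
  · exact (by fun_prop : Measurable fun t : ℝ => 1 / √(t ^ (2 * m) - 1)).aestronglyMeasurable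
  · refine (ae_restrict_iff' measurableSet_uIoc).2 (.of_forall fun x hx => ?_)
    rw [uIoc_of_le ht] at hx
    show ‖_‖ ≤ ‖_‖
    rw [Real.norm_of_nonneg (by positivity), Real.norm_of_nonneg (by positivity)]
    exact one_div_sqrt_pow_le hm hx.1

@[simp] theorem neckHeight_one : neckHeight m 1 = 0 := by simp [neckHeight]

theorem neckHeight_le (hm : m ≠ 0) {t : ℝ} (ht : 1 ≤ t) : neckHeight m t ≤ √(2 * (t - 1)) := by
  have h : ∫ τ in (1 : ℝ)..t, 1 / √(2 * (τ - 1)) = √(2 * (t - 1)) := by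
    rw [intervalIntegral.integral_eq_sub_of_hasDerivAt_of_le (f := fun t => √(2 * (t - 1))) ht
      (by fun_prop) (fun x hx => hasDerivAt_sqrt_two_mul hx.1) (intervalIntegrable_inv_sqrt ht)]
    simp
  rw [← h]
  exact intervalIntegral.integral_mono_on_of_le_Ioo ht (intervalIntegrable_neck hm ht)
    (intervalIntegrable_inv_sqrt ht) fun x hx => one_div_sqrt_pow_le hm hx.1

theorem neckHeight_nonneg {t : ℝ} (ht : 1 ≤ t) : 0 ≤ neckHeight m t :=
  intervalIntegral.integral_nonneg ht fun x _ => by positivity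

theorem neckHeight_le_self (hm : m ≠ 0) {t : ℝ} (ht : 1 ≤ t) : neckHeight m t ≤ t := by
  refine (neckHeight_le hm ht).trans (Real.sqrt_le_iff.2 ⟨by linarith, ?_⟩)
  nlinarith [sq_nonneg (t - 1)]

theorem continuousOn_neckHeight (hm : m ≠ 0) : ContinuousOn (neckHeight m) (Ici 1) := by
  intro t ht
  have h := intervalIntegral.continuousOn_primitive_interval'
    (intervalIntegrable_neck hm (t := t + 1) (by linarith [mem_Ici.1 ht])) (left_mem_uIcc)
  have ht' : t ∈ uIcc 1 (t + 1) := by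
    rw [uIcc_of_le (by linarith [mem_Ici.1 ht])]; exact ⟨ht, by linarith⟩
  refine (h t ht').mono_of_mem_nhdsWithin ?_
  rw [uIcc_of_le (by linarith [mem_Ici.1 ht])]
  exact mem_nhdsWithin.2 ⟨Iio (t + 1), isOpen_Iio, by simp, fun x hx => ⟨hx.2, hx.1.le⟩⟩

theorem hasDerivAt_neckHeight (hm : m ≠ 0) {t : ℝ} (ht : 1 < t) :
    HasDerivAt (neckHeight m) (1 / √(t ^ (2 * m) - 1)) t := by
  refine intervalIntegral.integral_hasDerivAt_right (intervalIntegrable_neck hm ht.le) ?_ ?_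
  · exact (by fun_prop : Measurable fun t : ℝ => 1 / √(t ^ (2 * m) - 1)).stronglyMeasurable
      |>.stronglyMeasurableAtFilter
  · have := Real.sqrt_pos.2 (pow_sub_one_pos hm ht)
    exact ContinuousAt.div (by fun_prop) (by fun_prop) this.ne'

theorem strictMonoOn_neckHeight (hm : m ≠ 0) : StrictMonoOn (neckHeight m) (Ici 1) := by
  refine strictMonoOn_of_deriv_pos (convex_Ici 1) (continuousOn_neckHeight hm) fun t ht => ?_
  rw [interior_Ici] at ht
  rw [(hasDerivAt_neckHeight hm ht).deriv]
  exact one_div_pos.2 (Real.sqrt_pos.2 (pow_sub_one_pos hm ht))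

/-- The sum `1 + t + ⋯ + t^(2m-1)` at `t = 1 + v²`, so that `(1 + v²)^(2m) - 1 = v² * neckSum m v`.
The substitution `t = 1 + v²` removes the singularity of the neck integral. -/
def neckSum (m : ℕ) (v : ℝ) : ℝ := ∑ i ∈ Finset.range (2 * m), (1 + v ^ 2) ^ i

theorem sq_mul_neckSum (m : ℕ) (v : ℝ) : v ^ 2 * neckSum m v = (1 + v ^ 2) ^ (2 * m) - 1 := by
  have := mul_geom_sum (1 + v ^ 2) (2 * m)
  rw [neckSum, ← this]; ring

theorem neckSum_pos (hm : m ≠ 0) (v : ℝ) : 0 < neckSum m v :=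
  Finset.sum_pos (fun i _ => by positivity) (by simpa using hm)

theorem contDiff_neckSum : ContDiff ℝ ∞ (neckSum m) := by
  unfold neckSum
  fun_prop

theorem contDiff_sqrt_neckSum (hm : m ≠ 0) : ContDiff ℝ ∞ fun v => √(neckSum m v) :=
  contDiff_neckSum.sqrt fun v => (neckSum_pos hm v).ne'

/-- The height of the neck as a smooth odd function of the parameter `v` with `t = 1 + v²`. -/
noncomputable def neckLift (m : ℕ) (w : ℝ) : ℝ := ∫ v in (0 : ℝ)..w, 2 / √(neckSum m v)

theorem continuous_neckLift_integrand (hm : m ≠ 0) :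
    Continuous fun v => 2 / √(neckSum m v) :=
  continuous_const.div (contDiff_sqrt_neckSum hm).continuous
    fun v => (Real.sqrt_pos.2 (neckSum_pos hm v)).ne'

theorem hasDerivAt_neckLift (hm : m ≠ 0) (w : ℝ) :
    HasDerivAt (neckLift m) (2 / √(neckSum m w)) w :=
  (continuous_neckLift_integrand hm).integral_hasStrictDerivAt 0 w |>.hasDerivAt

theorem contDiff_neckLift (hm : m ≠ 0) : ContDiff ℝ ∞ (neckLift m) := by
  rw [contDiff_infty_iff_deriv]
  refine ⟨fun w => (hasDerivAt_neckLift hm w).differentiableAt, ?_⟩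
  have : deriv (neckLift m) = fun v => 2 / √(neckSum m v) :=
    funext fun w => (hasDerivAt_neckLift hm w).deriv
  rw [this]
  exact contDiff_const.div (contDiff_sqrt_neckSum hm)
    fun v => (Real.sqrt_pos.2 (neckSum_pos hm v)).ne'

theorem strictMono_neckLift (hm : m ≠ 0) : StrictMono (neckLift m) :=
  strictMono_of_deriv_pos fun w => by
    rw [(hasDerivAt_neckLift hm w).deriv]
    exact div_pos two_pos (Real.sqrt_pos.2 (neckSum_pos hm w))

theorem neckLift_neg (w : ℝ) : neckLift m (-w) = -neckLift m w := by
  have h := intervalIntegral.integral_comp_neg (fun v => 2 / √(neckSum m v)) (a := 0) (b := w)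
  have h2 : ∀ v, neckSum m (-v) = neckSum m v := fun v => by simp [neckSum]
  simp only [h2, neg_zero] at h
  rw [neckLift, neckLift, h, ← intervalIntegral.integral_symm]

@[simp] theorem neckLift_zero : neckLift m 0 = 0 := by simp [neckLift]

/-- The substitution `t = 1 + v²` exhibits the height of the neck as the absolute value of a smooth
function with positive derivative, so that both halves of the neck fit together smoothly. -/
theorem neckHeight_one_add_sq (hm : m ≠ 0) (w : ℝ) : neckHeight m (1 + w ^ 2) = |neckLift m w| := by
  have key : ∀ w, 0 < w → neckHeight m (1 + w ^ 2) = neckLift m w := by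
    intro w hw
    have hc : ContinuousOn (fun v => neckHeight m (1 + v ^ 2) - neckLift m v) (Icc 0 w) := by
      refine ContinuousOn.sub ?_ (contDiff_neckLift hm).continuous.continuousOn
      exact (continuousOn_neckHeight hm).comp (by fun_prop) fun v _ => by
        simp only [mem_Ici]; nlinarith [sq_nonneg v]
    have hd : ∀ v ∈ Ioo 0 w, HasDerivAt (fun v => neckHeight m (1 + v ^ 2) - neckLift m v) 0 v := by
      intro v hv
      have hv0 : 0 < v := hv.1
      have h1 : HasDerivAt (fun v : ℝ => 1 + v ^ 2) (2 * v) v := by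
        simpa using (hasDerivAt_pow 2 v).const_add 1
      have h2 := (hasDerivAt_neckHeight hm (t := 1 + v ^ 2) (by nlinarith)).comp v h1
      refine (h2.sub (hasDerivAt_neckLift hm v)).congr_deriv ?_
      rw [← sq_mul_neckSum, Real.sqrt_mul (sq_nonneg v), Real.sqrt_sq hv0.le]
      have := Real.sqrt_pos.2 (neckSum_pos hm v)
      field_simp
      ring
    obtain ⟨ξ, -, hξ⟩ := exists_hasDerivAt_eq_slope _ _ hw hc hd
    have h0 := (div_eq_zero_iff.1 hξ.symm).resolve_right (by linarith)
    simp at h0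
    linarith
  rcases lt_trichotomy w 0 with hw | rfl | hw
  · have h1 := key (-w) (by linarith)
    have h2 := neckHeight_nonneg (m := m) (t := 1 + w ^ 2) (by nlinarith [sq_nonneg w])
    rw [neg_sq, neckLift_neg] at h1
    rw [h1] at h2 ⊢
    rw [← abs_neg, abs_of_nonneg h2]
  · simp
  · have h1 := key w hw
    have h2 := neckHeight_nonneg (m := m) (t := 1 + w ^ 2) (by nlinarith [sq_nonneg w])
    rw [h1] at h2 ⊢
    rw [abs_of_nonneg h2]

/-- The derivative of `v √(neckSum m v)`, a smooth square root of `(1 + v²)^(2m) - 1`. -/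
theorem hasDerivAt_mul_sqrt_neckSum (hm : m ≠ 0) (v : ℝ) :
    HasDerivAt (fun v => v * √(neckSum m v))
      (2 * m * (1 + v ^ 2) ^ (2 * m - 1) / √(neckSum m v)) v := by
  have hQ := (contDiff_neckSum (m := m)).differentiable (by simp) v |>.hasDerivAt
  set Q' := deriv (neckSum m) v
  have hpos := neckSum_pos hm v
  have h1 := (hasDerivAt_id v).mul (hQ.sqrt hpos.ne')
  have h2 : 2 * v * neckSum m v + v ^ 2 * Q' = v * (4 * m * (1 + v ^ 2) ^ (2 * m - 1)) := by
    have e1 := (hasDerivAt_pow 2 v).mul hQ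
    have e2 : HasDerivAt (fun v : ℝ => (1 + v ^ 2) ^ (2 * m) - 1) _ v :=
      (((hasDerivAt_pow 2 v).const_add 1).pow (2 * m)).sub_const 1
    have e3 : ((fun x : ℝ => x ^ 2) * neckSum m) = fun v : ℝ => (1 + v ^ 2) ^ (2 * m) - 1 :=
      funext fun v => sq_mul_neckSum m v
    rw [e3] at e1
    have e4 := e1.unique e2
    push_cast at e4
    simp only [pow_one] at e4
    linear_combination e4
  have h3 : 2 * neckSum m v + v * Q' = 4 * m * (1 + v ^ 2) ^ (2 * m - 1) := by
    rcases eq_or_ne v 0 with rfl | hv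
    · simp [neckSum]; ring
    · refine mul_left_cancel₀ hv ?_
      linear_combination h2
  refine h1.congr_deriv ?_
  have hs := Real.sqrt_pos.2 hpos
  have hs2 := Real.sq_sqrt hpos.le
  simp only [id]
  field_simp
  rw [hs2]
  linear_combination h3

/-- The profile `c` of the catenoid: the even solution of `c'' = m c^(2m-1)`, which satisfies
`c'² = c^(2m) - 1` and inverts `neckHeight` up to the sign. It is defined on an open set `I`
containing all heights of the neck. -/
theorem exists_catenoid_profile (hm : m ≠ 0) :
    ∃ (I : Set ℝ) (c c1 : ℝ → ℝ), IsOpen I ∧ (∀ s t, 1 ≤ t → |s| = neckHeight m t → s ∈ I) ∧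
      ∀ s ∈ I, ContDiffAt ℝ ∞ c s ∧ 1 ≤ c s ∧ neckHeight m (c s) = |s| ∧
        c1 s ^ 2 = c s ^ (2 * m) - 1 ∧ HasDerivAt c (c1 s) s ∧
        HasDerivAt c1 (m * c s ^ (2 * m - 1)) s := by
  have hpos : ∀ w, 0 < √(neckSum m w) := fun w => Real.sqrt_pos.2 (neckSum_pos hm w)
  have hopen : IsOpenMap (neckLift m) :=
    isOpenMap_of_hasStrictDerivAt
      (fun w => (continuous_neckLift_integrand hm).integral_hasStrictDerivAt 0 w)
      fun w => (div_pos two_pos (hpos w)).ne'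
  have hemb : IsOpenEmbedding (neckLift m) :=
    .of_continuous_injective_isOpenMap (contDiff_neckLift hm).continuous
      (strictMono_neckLift hm).injective hopen
  set e := hemb.toOpenPartialHomeomorph (neckLift m) with he
  have hleft : ∀ w, e.symm (neckLift m w) = w := fun w => e.left_inv (by simp [he])
  have hder : ∀ w, HasDerivAt e.symm (√(neckSum m w) / 2) (neckLift m w) := by
    intro w
    have := e.hasDerivAt_symm (a := neckLift m w) (f' := 2 / √(neckSum m w))
      (by simp [he]) (div_pos two_pos (hpos w)).ne'
      (by rw [hleft]; exact hasDerivAt_neckLift hm w)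
    rwa [inv_div] at this
  refine ⟨range (neckLift m), fun s => 1 + e.symm s ^ 2,
    fun s => e.symm s * √(neckSum m (e.symm s)), hopen.isOpen_range, ?_, ?_⟩
  · intro s t ht hst
    have h1 := neckHeight_one_add_sq hm √(t - 1)
    rw [Real.sq_sqrt (by linarith), add_sub_cancel] at h1
    rw [← hst] at h1
    rcases abs_eq_abs.1 h1 with h | h
    · exact ⟨_, h.symm⟩
    · exact ⟨-√(t - 1), by rw [neckLift_neg, h]⟩
  · rintro _ ⟨w, rfl⟩
    have hc1 : HasDerivAt (fun s => 1 + e.symm s ^ 2) (w * √(neckSum m w)) (neckLift m w) := by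
      refine (((hder w).pow 2).const_add 1).congr_deriv ?_
      rw [hleft]
      ring
    refine ⟨?_, ?_, ?_, ?_, ?_, ?_⟩
    · have h1 : ContDiffAt ℝ ∞ e.symm (neckLift m w) :=
        e.contDiffAt_symm_deriv (f₀' := 2 / √(neckSum m w)) (div_pos two_pos (hpos w)).ne'
          (by simp [he]) (by rw [hleft]; exact hasDerivAt_neckLift hm w)
          (contDiff_neckLift hm).contDiffAt
      exact contDiffAt_const.add (h1.pow 2)
    · nlinarith [sq_nonneg (e.symm (neckLift m w))]
    · simp only [hleft]
      exact neckHeight_one_add_sq hm w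
    · simp only [hleft]
      rw [mul_pow, Real.sq_sqrt (neckSum_pos hm w).le, sq_mul_neckSum]
    · simpa only [hleft] using hc1
    · have h1 := (hasDerivAt_mul_sqrt_neckSum hm (e.symm (neckLift m w))).comp (neckLift m w)
        (hder w)
      refine h1.congr_deriv ?_
      simp only [hleft]
      have := hpos w
      field_simp

end Neck

/-! ### Properties of the profiles -/

namespace IsProfile

variable {m : ℕ} {a ε : ℝ} {φ : ℝ → ℝ}

theorem continuousOn (h : IsProfile m a ε φ) (hm : m ≠ 0) (ha : 0 < a) (hε : 0 < ε) :
    ContinuousOn φ (Icc ε (π / 2)) := by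
  intro r hr
  rcases lt_or_ge r (a + ε) with hra | hra
  · have h1 : ContinuousOn (neckFunction m ε) (Icc ε (a + ε)) := by
      refine continuousOn_const.mul ((continuousOn_neckHeight hm).comp (by fun_prop) fun x hx => ?_)
      rw [mem_Ici, le_div_iff₀ hε, one_mul]
      exact hx.1
    have h2 := (h1.congr h.eq_neck) r ⟨hr.1, hra.le⟩
    refine h2.mono_of_mem_nhdsWithin ?_
    exact mem_nhdsWithin.2 ⟨Iio (a + ε), isOpen_Iio, hra, fun x hx => ⟨hx.2.1, hx.1.le⟩⟩
  · have hr' : r ∈ Ioc ε (π / 2) := ⟨by linarith, hr.2⟩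
    refine (h.smooth.continuousOn r hr').mono_of_mem_nhdsWithin ?_
    exact mem_nhdsWithin.2 ⟨Ioi ε, isOpen_Ioi, hr'.1, fun x hx => ⟨hx.1, hx.2.2⟩⟩

theorem contDiffAt (h : IsProfile m a ε φ) {r : ℝ} (hr : r ∈ Ioo ε (π / 2)) :
    ContDiffAt ℝ ∞ φ r :=
  h.smooth.contDiffAt (Ioc_mem_nhds hr.1 hr.2)

theorem differentiableAt (h : IsProfile m a ε φ) {r : ℝ} (hr : r ∈ Ioo ε (π / 2)) :
    DifferentiableAt ℝ φ r :=
  (h.contDiffAt hr).differentiableAt (by simp)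

theorem deriv_eq_zero (h : IsProfile m a ε φ) (ha : 0 < a) {r : ℝ}
    (hr : r ∈ Ico (2 * a + ε) (π / 2)) : deriv φ r = 0 := by
  obtain ⟨b, hb⟩ := h.eq_const
  have h1 := (h.differentiableAt (r := r) ⟨by linarith [hr.1], hr.2⟩).hasDerivAt
  have h2 : HasDerivWithinAt φ 0 (Ici r) r := by
    refine (hasDerivWithinAt_const r (Ici r) b).congr_of_eventuallyEq ?_ (hb r ⟨hr.1, hr.2.le⟩)
    filter_upwards [mem_nhdsWithin.2 ⟨Iio (π / 2), isOpen_Iio, hr.2, fun x hx => hx⟩] with x hx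
    exact hb x ⟨hr.1.trans hx.2, hx.1.le⟩
  exact (uniqueDiffWithinAt_Ici r).eq_deriv _ h1.hasDerivWithinAt h2

/-- A profile is nondecreasing: its slope decreases up to `2a + ε`, where it vanishes. -/
theorem deriv_nonneg (h : IsProfile m a ε φ) (ha : 0 < a) (hπ : 2 * a + ε < π / 2) {r : ℝ}
    (hr : r ∈ Ioo ε (π / 2)) : 0 ≤ deriv φ r := by
  rcases lt_or_ge r (2 * a + ε) with hra | hra
  · have h1 : r ∈ Ioc ε (2 * a + ε) := ⟨hr.1, hra.le⟩
    have h2 : 2 * a + ε ∈ Ioc ε (2 * a + ε) := ⟨by linarith, le_rfl⟩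
    have h3 := h.concave.concaveOn.deriv_le_slope h1 h2 hra
      (h.differentiableAt ⟨by linarith, hπ⟩)
    rw [h.deriv_eq_zero ha ⟨le_rfl, hπ⟩] at h3
    exact h3.trans (h.concave.concaveOn.slope_le_deriv h1 h2 hra (h.differentiableAt hr))
  · exact (h.deriv_eq_zero ha ⟨hra, hr.2⟩).ge

theorem monotoneOn (h : IsProfile m a ε φ) (hm : m ≠ 0) (ha : 0 < a) (hε : 0 < ε)
    (hπ : 2 * a + ε < π / 2) : MonotoneOn φ (Icc ε (π / 2)) := by
  refine monotoneOn_of_deriv_nonneg (convex_Icc _ _) (h.continuousOn hm ha hε) ?_ ?_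
  · rw [interior_Icc]
    exact fun r hr => (h.differentiableAt hr).differentiableWithinAt
  · rw [interior_Icc]
    exact fun r hr => h.deriv_nonneg ha hπ hr

theorem eq_zero (h : IsProfile m a ε φ) (ha : 0 < a) (hε : 0 < ε) : φ ε = 0 := by
  rw [h.eq_neck ε ⟨le_rfl, by linarith⟩, neckFunction_eq, div_self hε.ne', neckHeight_one, mul_zero]

theorem nonneg (h : IsProfile m a ε φ) (hm : m ≠ 0) (ha : 0 < a) (hε : 0 < ε)
    (hπ : 2 * a + ε < π / 2) {r : ℝ} (hr : r ∈ Icc ε (π / 2)) : 0 ≤ φ r := by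
  rw [← h.eq_zero ha hε]
  exact h.monotoneOn hm ha hε hπ ⟨le_rfl, by linarith⟩ hr hr.1

theorem pos (h : IsProfile m a ε φ) (hm : m ≠ 0) (ha : 0 < a) (hε : 0 < ε)
    (hπ : 2 * a + ε < π / 2) {r : ℝ} (hr : r ∈ Ioc ε (π / 2)) : 0 < φ r := by
  have h1 : ε < min r (a + ε) := lt_min hr.1 (by linarith)
  have h2 : 0 < φ (min r (a + ε)) := by
    rw [h.eq_neck _ ⟨h1.le, min_le_right _ _⟩, neckFunction_eq]
    refine mul_pos hε ?_
    rw [← neckHeight_one (m := m)]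
    exact strictMonoOn_neckHeight hm self_mem_Ici
      (by rw [mem_Ici, le_div_iff₀ hε, one_mul]; exact h1.le)
      (by rw [lt_div_iff₀ hε, one_mul]; exact h1)
  exact h2.trans_le (h.monotoneOn hm ha hε hπ ⟨h1.le, (min_le_left _ _).trans hr.2⟩
    ⟨hr.1.le, hr.2⟩ (min_le_left _ _))

theorem neckFunction_le_sqrt (hm : m ≠ 0) (hε : 0 < ε) {r : ℝ} (hr : ε ≤ r) :
    neckFunction m ε r ≤ √(2 * ε * r) := by
  have h1 : 1 ≤ r / ε := by rwa [le_div_iff₀ hε, one_mul]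
  rw [neckFunction_eq]
  refine (mul_le_mul_of_nonneg_left (neckHeight_le hm h1) hε.le).trans ?_
  refine Real.le_sqrt_of_sq_le ?_
  rw [mul_pow, Real.sq_sqrt (by linarith)]
  have : ε ^ 2 * (2 * (r / ε - 1)) = 2 * ε * r - 2 * ε ^ 2 := by field_simp
  rw [this]
  nlinarith

/-- By concavity the profile is controlled by its height at the end of the neck. -/
theorem le_sup (h : IsProfile m a ε φ) (hm : m ≠ 0) (ha : 0 < a) (hε : 0 < ε)
    (hπ : 2 * a + ε < π / 2) {r : ℝ} (hr : r ∈ Icc ε (π / 2)) :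
    φ r ≤ 3 * √(2 * ε * (a + ε)) := by
  have hmono := h.monotoneOn hm ha hε hπ
  have ha1 : a + ε ∈ Icc ε (π / 2) := ⟨by linarith, by linarith⟩
  have ha2 : 2 * a + ε ∈ Icc ε (π / 2) := ⟨by linarith, by linarith⟩
  have h1 : φ (a + ε) ≤ √(2 * ε * (a + ε)) := by
    rw [h.eq_neck _ ⟨by linarith, le_rfl⟩]
    exact neckFunction_le_sqrt hm hε (by linarith)
  have h0 := h.nonneg hm ha hε hπ ha1
  have h2 : φ (2 * a + ε) ≤ 3 * φ (a + ε) := by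
    have h3 := h.concave.concaveOn.slope_anti_adjacent (x := a / 2 + ε) (y := a + ε)
      (z := 2 * a + ε) ⟨by linarith, by linarith⟩ ⟨by linarith, le_rfl⟩ (by linarith) (by linarith)
    have h4 := h.nonneg hm ha hε hπ (r := a / 2 + ε) ⟨by linarith, by linarith⟩
    have e1 : 2 * a + ε - (a + ε) = a := by ring
    have e2 : a + ε - (a / 2 + ε) = a / 2 := by ring
    rw [e1, e2, div_le_div_iff₀ ha (by linarith)] at h3
    have h5 : φ (2 * a + ε) - φ (a + ε) ≤ 2 * (φ (a + ε) - φ (a / 2 + ε)) := by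
      by_contra hcon
      push Not at hcon
      nlinarith
    linarith
  have h3 : φ r ≤ φ (2 * a + ε) := by
    rcases le_total r (2 * a + ε) with hra | hra
    · exact hmono hr ha2 hra
    · obtain ⟨b, hb⟩ := h.eq_const
      rw [hb r ⟨hra, hr.2⟩, hb (2 * a + ε) ⟨le_rfl, hπ.le⟩]
  linarith

/-- By concavity on `[δ / 2, r]` the slope is controlled by the height. -/
theorem deriv_le (h : IsProfile m a ε φ) (hm : m ≠ 0) (ha : 0 < a) (hε : 0 < ε)
    (hπ : 2 * a + ε < π / 2) {δ r : ℝ} (hδ : ε < δ / 2) (hr : r ∈ Ico δ (π / 2)) :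
    deriv φ r ≤ 2 / δ * φ r := by
  have hδ0 : 0 < δ := by linarith
  have h0 := h.nonneg hm ha hε hπ (r := r) ⟨by linarith [hr.1], hr.2.le⟩
  rcases le_total r (2 * a + ε) with hra | hra
  · have h3 := h.concave.concaveOn.deriv_le_slope (x := δ / 2) (y := r)
      ⟨by linarith, by linarith [hr.1]⟩ ⟨by linarith [hr.1], hra⟩ (by linarith [hr.1])
      (h.differentiableAt ⟨by linarith [hr.1], hr.2⟩)
    have h4 := h.nonneg hm ha hε hπ (r := δ / 2) ⟨by linarith, by linarith [hr.1, hr.2]⟩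
    refine h3.trans ?_
    rw [slope_def_field, div_le_iff₀ (by linarith [hr.1])]
    have h5 : 2 / δ * φ r * (r - δ / 2) ≥ 2 / δ * φ r * (δ / 2) :=
      mul_le_mul_of_nonneg_left (by linarith [hr.1]) (by positivity)
    have h6 : 2 / δ * φ r * (δ / 2) = φ r := by field_simp
    linarith
  · rw [h.deriv_eq_zero ha ⟨hra, hr.2⟩]
    positivity

end IsProfile

/-! ### The glued spheres in polar coordinates -/

section Glued

variable {p q : ℕ}

/-- The point with polar coordinates `(ρ, θ)` in the half-plane spanned by `y` and `z`. -/
noncomputable def polarPoint (ρ θ : ℝ) (y : EuclideanSpace ℝ (Fin p))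
    (z : EuclideanSpace ℝ (Fin q)) : EuclideanSum p q :=
  WithLp.toLp 2 ((ρ * sin θ) • y, (ρ * cos θ) • z)

/-- The angle `r` of the point `ρ (y sin r + z cos r)`, that is, the angle with the second factor;
it takes the junk value `π / 2` at the origin. -/
noncomputable def polarAngle (x : EuclideanSum p q) : ℝ := arccos (‖x.snd‖ / ‖x‖)

theorem norm_polarPoint {ρ θ : ℝ} {y : EuclideanSpace ℝ (Fin p)} {z : EuclideanSpace ℝ (Fin q)}
    (hy : ‖y‖ = 1) (hz : ‖z‖ = 1) (hρ : 0 ≤ ρ) : ‖polarPoint ρ θ y z‖ = ρ := by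
  have h : ‖polarPoint ρ θ y z‖ ^ 2 = ρ ^ 2 := by
    rw [polarPoint, norm_toLp_smul_sq hy hz]
    linear_combination ρ ^ 2 * sin_sq_add_cos_sq θ
  exact (pow_left_inj₀ (norm_nonneg _) hρ two_ne_zero).1 h

theorem polarAngle_polarPoint {ρ θ : ℝ} {y : EuclideanSpace ℝ (Fin p)}
    {z : EuclideanSpace ℝ (Fin q)} (hy : ‖y‖ = 1) (hz : ‖z‖ = 1) (hρ : 0 < ρ)
    (hθ : θ ∈ Icc 0 (π / 2)) : polarAngle (polarPoint ρ θ y z) = θ := by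
  have hc : 0 ≤ cos θ := cos_nonneg_of_neg_pi_div_two_le_of_le (by linarith [hθ.1, pi_pos]) hθ.2
  have h1 : ‖(polarPoint ρ θ y z).snd‖ = ρ * cos θ := by
    show ‖(ρ * cos θ) • z‖ = _
    rw [norm_smul, hz, mul_one, Real.norm_of_nonneg (by positivity)]
  rw [polarAngle, h1, norm_polarPoint hy hz hρ.le, mul_div_cancel_left₀ _ hρ.ne',
    arccos_cos hθ.1 (by linarith [hθ.2, pi_pos])]

theorem polarAngle_nonneg (x : EuclideanSum p q) : 0 ≤ polarAngle x := arccos_nonneg _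

theorem polarAngle_le (x : EuclideanSum p q) : polarAngle x ≤ π / 2 :=
  arccos_le_pi_div_two.2 (by positivity)

theorem polarAngle_smul {t : ℝ} (ht : 0 < t) (x : EuclideanSum p q) :
    polarAngle (t • x) = polarAngle x := by
  rw [polarAngle, polarAngle, WithLp.smul_snd, norm_smul, norm_smul,
    mul_div_mul_left _ _ (norm_ne_zero_iff.2 ht.ne')]

theorem exists_unit_smul {r : ℕ} (hr : r ≠ 0) (u : EuclideanSpace ℝ (Fin r)) :
    ∃ y : EuclideanSpace ℝ (Fin r), ‖y‖ = 1 ∧ u = ‖u‖ • y := by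
  rcases eq_or_ne u 0 with rfl | hu
  · exact ⟨EuclideanSpace.single ⟨0, Nat.pos_of_ne_zero hr⟩ 1, by simp, by simp⟩
  · have := norm_ne_zero_iff.2 hu
    exact ⟨‖u‖⁻¹ • u, by rw [norm_smul, norm_inv, norm_norm, inv_mul_cancel₀ this],
      by rw [smul_smul, mul_inv_cancel₀ this, one_smul]⟩

theorem cos_polarAngle (x : EuclideanSum p q) : cos (polarAngle x) = ‖x.snd‖ / ‖x‖ := by
  have h0 : 0 ≤ ‖x.snd‖ / ‖x‖ := by positivity
  exact cos_arccos (by linarith) (div_le_one_of_le₀ (WithLp.norm_snd_le (x := x)) (norm_nonneg x))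

theorem sin_polarAngle {x : EuclideanSum p q} (hx : x ≠ 0) :
    sin (polarAngle x) = ‖x.fst‖ / ‖x‖ := by
  have hx' := norm_pos_iff.2 hx
  have h1 : 0 ≤ sin (polarAngle x) :=
    sin_nonneg_of_nonneg_of_le_pi (polarAngle_nonneg x) (by linarith [polarAngle_le x, pi_pos])
  have h2 : sin (polarAngle x) ^ 2 = (‖x.fst‖ / ‖x‖) ^ 2 := by
    rw [sin_sq, cos_polarAngle, div_pow, div_pow, WithLp.prod_norm_sq_eq_of_L2,
      eq_div_iff, sub_mul, div_mul_cancel₀]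
    · ring
    all_goals
      rw [← WithLp.prod_norm_sq_eq_of_L2]; positivity
  exact (pow_left_inj₀ h1 (by positivity) two_ne_zero).1 h2

theorem exists_eq_polarPoint (hp : p ≠ 0) (hq : q ≠ 0) {x : EuclideanSum p q} (hx : x ≠ 0) :
    ∃ y z, ‖y‖ = 1 ∧ ‖z‖ = 1 ∧ x = polarPoint ‖x‖ (polarAngle x) y z := by
  obtain ⟨y, hy, hxy⟩ := exists_unit_smul hp x.fst
  obtain ⟨z, hz, hxz⟩ := exists_unit_smul hq x.snd
  have hx' := norm_ne_zero_iff.2 hx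
  refine ⟨y, z, hy, hz, ?_⟩
  rw [polarPoint, cos_polarAngle, sin_polarAngle hx, mul_div_cancel₀ _ hx', mul_div_cancel₀ _ hx',
    ← hxy, ← hxz]
  rfl

theorem continuousAt_polarAngle {x : EuclideanSum p q} (hx : x ≠ 0) :
    ContinuousAt polarAngle x := by
  refine continuous_arccos.continuousAt.comp (ContinuousAt.div ?_ continuous_norm.continuousAt
    (norm_ne_zero_iff.2 hx))
  exact (WithLp.continuous_snd 2 _ _).norm.continuousAt

theorem contDiffAt_polarAngle {x : EuclideanSum p q} (hx1 : x.fst ≠ 0) (hx2 : x.snd ≠ 0) :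
    ContDiffAt ℝ ∞ (polarAngle : EuclideanSum p q → ℝ) x := by
  have hx : x ≠ 0 := by rintro rfl; exact hx1 rfl
  have h1 : ContDiffAt ℝ ∞ (fun x : EuclideanSum p q => ‖x.snd‖ / ‖x‖) x := by
    refine ContDiffAt.div ?_ (contDiffAt_id.norm ℝ hx) (norm_ne_zero_iff.2 hx)
    exact (WithLp.sndL 2 ℝ (EuclideanSpace ℝ (Fin p))
      (EuclideanSpace ℝ (Fin q))).contDiff.contDiffAt.norm ℝ hx2
  refine ContDiffAt.comp (g := arccos) x (contDiffAt_arccos ?_ ?_) h1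
  · have : 0 ≤ ‖x.snd‖ / ‖x‖ := by positivity
    linarith
  · rw [← cos_polarAngle]
    intro h
    have h2 := sin_sq_add_cos_sq (polarAngle x)
    rw [h, sin_polarAngle hx] at h2
    have h3 : ‖x.fst‖ / ‖x‖ ≠ 0 := div_ne_zero (norm_ne_zero_iff.2 hx1) (norm_ne_zero_iff.2 hx)
    exact h3 (pow_eq_zero_iff two_ne_zero |>.1 (by linarith))

/-- The union of the warped graphs of `φ` and `-φ` in `ℝ^p ⊕ ℝ^q`. -/
def doubleGraph (p q : ℕ) (ε : ℝ) (φ : ℝ → ℝ) : Set (EuclideanSum p q) :=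
  warpedGraph p q ε φ ∪ warpedGraph p q ε (-φ)

theorem warpedMap_eq (φ : ℝ → ℝ) (y : EuclideanSpace ℝ (Fin p)) (z : EuclideanSpace ℝ (Fin q))
    (r : ℝ) : warpedMap φ (y, z, r) = polarPoint (1 + φ r) r y z := by
  rw [warpedMap, polarPoint, ← WithLp.toLp_smul, Prod.smul_mk, smul_smul, smul_smul]

variable {ε : ℝ} {φ : ℝ → ℝ}

theorem mem_warpedGraph {x : EuclideanSum p q} : x ∈ warpedGraph p q ε φ ↔
    ∃ y z r, ‖y‖ = 1 ∧ ‖z‖ = 1 ∧ r ∈ Icc ε (π / 2) ∧ polarPoint (1 + φ r) r y z = x := by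
  constructor
  · rintro ⟨⟨y, z, r⟩, ⟨hy, hz, hr⟩, h⟩
    rw [warpedMap_eq] at h
    exact ⟨y, z, r, mem_sphere_zero_iff_norm.1 hy, mem_sphere_zero_iff_norm.1 hz, hr, h⟩
  · rintro ⟨y, z, r, hy, hz, hr, h⟩
    exact ⟨(y, z, r), ⟨mem_sphere_zero_iff_norm.2 hy, mem_sphere_zero_iff_norm.2 hz, hr⟩,
      by rw [warpedMap_eq, h]⟩

/-- The glued spheres are given by an equation between the norm and the polar angle. -/
theorem mem_doubleGraph_iff (hp : p ≠ 0) (hq : q ≠ 0) (hε : 0 < ε)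
    (hφ : ∀ r ∈ Icc ε (π / 2), 0 ≤ φ r ∧ φ r < 1) {x : EuclideanSum p q} :
    x ∈ doubleGraph p q ε φ ↔ x ≠ 0 ∧ ε ≤ polarAngle x ∧ |‖x‖ - 1| = φ (polarAngle x) := by
  constructor
  · have key : ∀ ψ : ℝ → ℝ, (∀ r ∈ Icc ε (π / 2), |ψ r| = φ r) → x ∈ warpedGraph p q ε ψ →
        x ≠ 0 ∧ ε ≤ polarAngle x ∧ |‖x‖ - 1| = φ (polarAngle x) := by
      intro ψ hψ hx
      obtain ⟨y, z, r, hy, hz, hr, rfl⟩ := mem_warpedGraph.1 hx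
      have hpos : 0 < 1 + ψ r := by
        have := neg_abs_le (ψ r)
        have := hψ r hr
        have := (hφ r hr).2
        linarith
      have hn := norm_polarPoint (θ := r) hy hz hpos.le
      have ha := polarAngle_polarPoint hy hz hpos ⟨hε.le.trans hr.1, hr.2⟩
      refine ⟨?_, ?_, ?_⟩
      · rw [← norm_pos_iff, hn]; exact hpos
      · rw [ha]; exact hr.1
      · rw [hn, ha, add_sub_cancel_left, hψ r hr]
    rintro (hx | hx)
    · exact key φ (fun r hr => abs_of_nonneg (hφ r hr).1) hx
    · exact key (-φ) (fun r hr => by rw [Pi.neg_apply, abs_neg, abs_of_nonneg (hφ r hr).1]) hx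
  · rintro ⟨hx, hε', habs⟩
    obtain ⟨y, z, hy, hz, hxyz⟩ := exists_eq_polarPoint hp hq hx
    have hr : polarAngle x ∈ Icc ε (π / 2) := ⟨hε', polarAngle_le x⟩
    rcases abs_eq (hφ _ hr).1 |>.1 habs with h | h
    · refine Or.inl (mem_warpedGraph.2 ⟨y, z, _, hy, hz, hr, ?_⟩)
      rw [← h, add_sub_cancel, ← hxyz]
    · refine Or.inr (mem_warpedGraph.2 ⟨y, z, _, hy, hz, hr, ?_⟩)
      rw [Pi.neg_apply, ← h, add_sub_cancel, ← hxyz]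

theorem isCompact_warpedGraph (hφ : ContinuousOn φ (Icc ε (π / 2))) :
    IsCompact (warpedGraph p q ε φ) := by
  refine IsCompact.image_of_continuousOn
    ((isCompact_sphere _ _).prod ((isCompact_sphere _ _).prod isCompact_Icc)) ?_
  have h1 : ContinuousOn (fun x : EuclideanSpace ℝ (Fin p) × EuclideanSpace ℝ (Fin q) × ℝ =>
      φ x.2.2) (Metric.sphere 0 1 ×ˢ Metric.sphere 0 1 ×ˢ Icc ε (π / 2)) :=
    hφ.comp (by fun_prop) fun x hx => hx.2.2
  refine (continuousOn_const.add h1).smul ?_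
  exact ((WithLp.prod_continuous_toLp 2 _ _).comp (by fun_prop)).continuousOn

theorem isCompact_doubleGraph (hφ : ContinuousOn φ (Icc ε (π / 2))) :
    IsCompact (doubleGraph p q ε φ) :=
  (isCompact_warpedGraph hφ).union (isCompact_warpedGraph hφ.neg)

section

variable {E : Type*} [NormedAddCommGroup E] [InnerProductSpace ℝ E] [CompleteSpace E]

theorem hasDerivAt_smul_one {E : Type*} [NormedAddCommGroup E] [NormedSpace ℝ E] (x : E) :
    HasDerivAt (fun t : ℝ => t • x) x 1 := by
  simpa using (hasDerivAt_id (1 : ℝ)).smul_const x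

/-- A smooth equation is regular at `x` if its derivative along a curve through `x` is nonzero. -/
theorem IsLocalEquation.of_eventually {M : Set E} {x : E} {F : E → ℝ} {γ : ℝ → E} {w : E} {s d : ℝ}
    (hF : ∀ᶠ z in 𝓝 x, ContDiffAt ℝ ∞ F z) (hγ : HasDerivAt γ w s) (hx : γ s = x)
    (hd : HasDerivAt (F ∘ γ) d s) (hd0 : d ≠ 0) (hM : ∀ᶠ z in 𝓝 x, z ∈ M ↔ F z = 0) :
    IsLocalEquation M x F := by
  obtain ⟨U, hU, hUo, hxU⟩ := eventually_nhds_iff.1 (hF.and hM)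
  refine ⟨U, hUo, hxU, fun z hz => (hU z hz).1.contDiffWithinAt, fun h0 => ?_,
    fun z hz => (hU z hz).2⟩
  have h1 : HasFDerivAt F (fderiv ℝ F x) (γ s) := by
    rw [hx]
    exact (hF.self_of_nhds.differentiableAt (by simp)).hasFDerivAt
  have h2 := hd.unique (h1.comp_hasDerivAt s hγ)
  rw [← toDual_gradient, h0] at h2
  exact hd0 (by simpa using h2)

end

variable {m : ℕ} {a : ℝ}

theorem hasDerivAt_polarPoint {V W : Type*} [NormedAddCommGroup V] [InnerProductSpace ℝ V]
    [NormedAddCommGroup W] [InnerProductSpace ℝ W] (ρ θ : ℝ) (y : V) (z : W) :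
    HasDerivAt (fun t => (WithLp.toLp 2 ((ρ * sin t) • y, (ρ * cos t) • z) : WithLp 2 (V × W)))
      (WithLp.toLp 2 ((ρ * cos θ) • y, (ρ * -sin θ) • z)) θ := by
  have h1 : HasDerivAt (fun t => (ρ * sin t) • y) ((ρ * cos θ) • y) θ :=
    HasDerivAt.smul_const (c := fun t => ρ * sin t) ((hasDerivAt_sin θ).const_mul ρ) y
  have h2 : HasDerivAt (fun t => (ρ * cos t) • z) ((ρ * -sin θ) • z) θ :=
    HasDerivAt.smul_const (c := fun t => ρ * cos t) ((hasDerivAt_cos θ).const_mul ρ) z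
  exact hasDerivAt_toLp h1 h2

/-- The union of the two graphs is a smooth hypersurface. Near the neck, the inverse of the profile
is a smooth equation across the waist; elsewhere the two sheets are separated, and each is a graph
over the sphere, a round sphere near `r = π / 2`. -/
theorem isSmoothHypersurface_doubleGraph (hp : p ≠ 0) (hq : q ≠ 0) (h : IsProfile m a ε φ)
    (hm : m ≠ 0) (ha : 0 < a) (hε : 0 < ε) (hπ : 2 * a + ε < π / 2)
    (hφ1 : ∀ r ∈ Icc ε (π / 2), φ r < 1) : IsSmoothHypersurface (doubleGraph p q ε φ) := by
  have hφ : ∀ r ∈ Icc ε (π / 2), 0 ≤ φ r ∧ φ r < 1 :=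
    fun r hr => ⟨h.nonneg hm ha hε hπ hr, hφ1 r hr⟩
  intro x hxM
  obtain ⟨hx, hr, habs⟩ := (mem_doubleGraph_iff hp hq hε hφ).1 hxM
  have hrπ := polarAngle_le x
  have hxn : 0 < ‖x‖ := norm_pos_iff.2 hx
  have hx0 : ∀ᶠ z in 𝓝 x, z ≠ 0 := continuousAt_id.eventually_ne hx
  have hsin : 0 < sin (polarAngle x) :=
    sin_pos_of_pos_of_lt_pi (by linarith) (by linarith [pi_pos])
  have hfst : x.fst ≠ 0 := by
    intro h0
    rw [sin_polarAngle hx, h0] at hsin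
    simp at hsin
  have hsmooth : polarAngle x < π / 2 →
      ∀ᶠ z in 𝓝 x, ContDiffAt ℝ ∞ (polarAngle : EuclideanSum p q → ℝ) z := by
    intro hlt
    have hsnd : x.snd ≠ 0 := by
      intro h0
      have hcos : 0 < cos (polarAngle x) := cos_pos_of_mem_Ioo ⟨by linarith [pi_pos], hlt⟩
      rw [cos_polarAngle, h0] at hcos
      simp at hcos
    filter_upwards [(WithLp.continuous_fst 2 (EuclideanSpace ℝ (Fin p))
        (EuclideanSpace ℝ (Fin q))).continuousAt.eventually_ne hfst,
      (WithLp.continuous_snd 2 (EuclideanSpace ℝ (Fin p))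
        (EuclideanSpace ℝ (Fin q))).continuousAt.eventually_ne hsnd] with z h1 h2
    exact contDiffAt_polarAngle h1 h2
  rcases lt_or_ge (polarAngle x) (a + ε) with hra | hra
  -- Inverting the profile, the neck is the set `polarAngle = ε c((‖x‖ - 1) / ε)`.
  · obtain ⟨I, c, c1, hI, hImem, hc⟩ := exists_catenoid_profile hm
    have hneck : ∀ z : EuclideanSum p q, ε ≤ polarAngle z → polarAngle z < a + ε →
        φ (polarAngle z) = ε * neckHeight m (polarAngle z / ε) := by
      intro z hz1 hz2
      rw [h.eq_neck _ ⟨hz1, hz2.le⟩, neckFunction_eq]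
    have hge : ∀ z : EuclideanSum p q, ε ≤ polarAngle z → 1 ≤ polarAngle z / ε := by
      intro z hz
      rwa [le_div_iff₀ hε, one_mul]
    have hscale : ∀ z : EuclideanSum p q, ε ≤ polarAngle z → polarAngle z < a + ε →
        |‖z‖ - 1| = φ (polarAngle z) → |(‖z‖ - 1) / ε| = neckHeight m (polarAngle z / ε) := by
      intro z hz1 hz2 hz3
      rw [abs_div, hz3, hneck z hz1 hz2, abs_of_pos hε, mul_div_cancel_left₀ _ hε.ne']
    have hxI : (‖x‖ - 1) / ε ∈ I := hImem _ _ (hge x hr) (hscale x hr hra habs)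
    have hcont : ContinuousAt (fun z : EuclideanSum p q => (‖z‖ - 1) / ε) x := by fun_prop
    obtain ⟨y, z, hy, hz, hxyz⟩ := exists_eq_polarPoint hp hq hx
    refine ⟨fun z => polarAngle z - ε * c ((‖z‖ - 1) / ε), ?_⟩
    refine IsLocalEquation.of_eventually (d := 1) ?_ (hasDerivAt_polarPoint ‖x‖ (polarAngle x) y z)
      hxyz.symm ?_ one_ne_zero ?_
    · filter_upwards [hsmooth (by linarith), hx0, hcont.eventually (hI.mem_nhds hxI)]
        with z h1 h2 h3
      refine h1.sub (contDiffAt_const.mul ?_)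
      have h4 : ContDiffAt ℝ ∞ (fun z : EuclideanSum p q => (‖z‖ - 1) / ε) z :=
        ((contDiffAt_id.norm ℝ h2).sub contDiffAt_const).div_const ε
      exact ContDiffAt.comp (g := c) z (hc _ h3).1 h4
    · refine ((hasDerivAt_id (polarAngle x)).sub_const
        (ε * c ((‖x‖ - 1) / ε))).congr_of_eventuallyEq ?_
      filter_upwards [Ioo_mem_nhds (a := 0) (b := π / 2) (x := polarAngle x) (by linarith)
        (by linarith)] with t ht
      show polarAngle (polarPoint ‖x‖ t y z) - ε * c ((‖polarPoint ‖x‖ t y z‖ - 1) / ε) = _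
      rw [polarAngle_polarPoint hy hz hxn ⟨ht.1.le, ht.2.le⟩, norm_polarPoint hy hz hxn.le, id]
    · filter_upwards [hx0, hcont.eventually (hI.mem_nhds hxI),
        (continuousAt_polarAngle hx).eventually (gt_mem_nhds hra)] with z h1 h2 h3
      rw [mem_doubleGraph_iff hp hq hε hφ]
      obtain ⟨-, hc1, hc2, -⟩ := hc _ h2
      constructor
      · rintro ⟨-, h4, h5⟩
        have h6 := hscale z h4 h3 h5
        rw [← hc2] at h6
        have h7 := (strictMonoOn_neckHeight hm).injOn hc1 (hge z h4) h6
        rw [h7, mul_div_cancel₀ _ hε.ne', sub_self]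
      · intro h4
        have h5 : polarAngle z = ε * c ((‖z‖ - 1) / ε) := by linarith
        have h6 : ε ≤ polarAngle z := by rw [h5]; nlinarith
        refine ⟨h1, h6, ?_⟩
        rw [hneck z h6 h3, h5, mul_div_cancel_left₀ _ hε.ne', hc2, abs_div, abs_of_pos hε,
          mul_div_cancel₀ _ hε.ne']
  -- Away from the neck the two sheets are separated, and each of them is a graph over the sphere.
  have hφx : 0 < φ (polarAngle x) := h.pos hm ha hε hπ ⟨by linarith, hrπ⟩
  obtain ⟨τ, hτ, hτx⟩ : ∃ τ : ℝ, (τ = 1 ∨ τ = -1) ∧ ‖x‖ - 1 = τ * φ (polarAngle x) := by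
    rcases (abs_eq hφx.le).1 habs with h | h
    · exact ⟨1, Or.inl rfl, by linarith⟩
    · exact ⟨-1, Or.inr rfl, by linarith⟩
  have hsheet : ∀ᶠ z in 𝓝 x, z ∈ doubleGraph p q ε φ ↔
      ‖z‖ - 1 = τ * φ (polarAngle z) := by
    have h1 : 0 < τ * (‖x‖ - 1) := by
      rw [hτx]
      rcases hτ with rfl | rfl <;> simpa using hφx
    have h2 : ContinuousAt (fun z : EuclideanSum p q => τ * (‖z‖ - 1)) x := by fun_prop
    filter_upwards [hx0, h2.eventually (lt_mem_nhds h1),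
      (continuousAt_polarAngle hx).eventually (lt_mem_nhds (show ε < polarAngle x by linarith))]
      with z h3 h4 h5
    rw [mem_doubleGraph_iff hp hq hε hφ]
    have h6 : |‖z‖ - 1| = τ * (‖z‖ - 1) := by
      rcases hτ with rfl | rfl
      · rw [one_mul] at h4 ⊢; exact abs_of_pos h4
      · rw [abs_of_neg (by linarith)]; ring
    have hτ2 : τ * τ = 1 := by rcases hτ with rfl | rfl <;> norm_num
    rw [h6]
    constructor
    · rintro ⟨-, -, h7⟩
      rw [← h7, ← mul_assoc, hτ2, one_mul]
    · intro h7
      refine ⟨h3, h5.le, ?_⟩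
      rw [h7, ← mul_assoc, hτ2, one_mul]
  rcases lt_or_eq_of_le hrπ with hlt | heq
  · refine ⟨fun z => ‖z‖ - 1 - τ * φ (polarAngle z), ?_⟩
    refine IsLocalEquation.of_eventually (d := ‖x‖) ?_ (hasDerivAt_smul_one x) (one_smul ℝ x) ?_
      hxn.ne' ?_
    · have hcont := continuousAt_polarAngle hx
      filter_upwards [hsmooth hlt, hx0, hcont.eventually (Ioo_mem_nhds
        (show ε < polarAngle x by linarith) hlt)] with z h1 h2 h3
      refine ((contDiffAt_id.norm ℝ h2).sub contDiffAt_const).sub (contDiffAt_const.mul ?_)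
      exact ContDiffAt.comp (g := φ) z (h.contDiffAt h3) h1
    · refine ((hasDerivAt_mul_const (x := (1 : ℝ)) ‖x‖).sub_const
        (1 + τ * φ (polarAngle x))).congr_of_eventuallyEq ?_
      filter_upwards [lt_mem_nhds (zero_lt_one (α := ℝ))] with t ht
      simp only [Function.comp]
      rw [polarAngle_smul ht, norm_smul, Real.norm_of_nonneg ht.le]
      ring
    · filter_upwards [hsheet] with z hz
      rw [hz, sub_eq_zero]
  · obtain ⟨b, hb⟩ := h.eq_const
    refine ⟨fun z => ‖z‖ ^ 2 - (1 + τ * b) ^ 2, ?_⟩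
    refine IsLocalEquation.of_eventually (d := 2 * ‖x‖ ^ 2) ?_ (hasDerivAt_smul_one x)
      (one_smul ℝ x) ?_ (by positivity) ?_
    · exact .of_forall fun z => (contDiffAt_id.norm_sq ℝ).sub contDiffAt_const
    · refine (((hasDerivAt_pow 2 (1 : ℝ)).mul_const (‖x‖ ^ 2)).sub_const
        ((1 + τ * b) ^ 2)).congr_of_eventuallyEq ?_ |>.congr_deriv (by simp)
      filter_upwards [lt_mem_nhds (zero_lt_one (α := ℝ))] with t ht
      simp only [Function.comp]
      rw [norm_smul, Real.norm_of_nonneg ht.le]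
      ring
    · filter_upwards [hsheet, (continuousAt_polarAngle hx).eventually (lt_mem_nhds
        (show 2 * a + ε < polarAngle x by linarith))] with z hz h2
      have hbz : φ (polarAngle z) = b := hb _ ⟨h2.le, polarAngle_le z⟩
      have hb01 : 0 ≤ b ∧ b < 1 := by
        rw [← hbz]; exact hφ _ ⟨by linarith, polarAngle_le z⟩
      have hpos : 0 ≤ 1 + τ * b := by rcases hτ with rfl | rfl <;> linarith [hb01.1, hb01.2]
      rw [hz, hbz, sub_eq_zero, pow_left_inj₀ (norm_nonneg z) hpos two_ne_zero]
      constructor <;> intro h <;> linarith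

end Glued

/-! ### Curvature estimates -/

section Estimates

/-- Bounds for the principal curvatures of the neck, in the parametrization `ρ = 1 + ε s`,
`θ = ε c(s)`, where `T = c(s)` and `S² = 1 + ρ² c'(s)²`. The principal curvatures of order
`1 / (ε T^(m+1))` cancel in the mean curvature because the catenoid is minimal. -/
theorem neck_curvature_bounds {m : ℕ} (hm : m ≠ 0) {ε s T c1 ρ S θ : ℝ} (hε : 0 < ε) (hT : 1 ≤ T)
    (hs : |s| ≤ T) (hc1 : c1 ^ 2 = T ^ (2 * m) - 1) (hρ : ρ = 1 + ε * s) (hρ2 : |ε * s| ≤ 1 / 2)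
    (hθ : θ = ε * T) (hθ4 : θ ≤ π / 4) (hS : 0 < S) (hS2 : S ^ 2 = 1 + ρ ^ 2 * c1 ^ 2) :
    |c1 * (ρ ^ 2 * c1 ^ 2 + 2) / S ^ 3| ≤ 4 ∧ |c1 / S| ≤ 2 ∧
      |sin θ / (ρ * cos θ * S)| ≤ 2 ∧
      |ρ * T ^ (2 * m - 1) / (ε * S ^ 3)| ≤ 12 * (1 / (ε * T ^ (m + 1))) ∧
      |cos θ / (ρ * sin θ * S)| ≤ 4 * (1 / (ε * T ^ (m + 1))) ∧
      |ρ * T ^ (2 * m - 1) / (ε * S ^ 3) - cos θ / (ρ * sin θ * S)| ≤ 7 := by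
  have hT0 : 0 < T := by linarith
  have hρl : 1 / 2 ≤ ρ := by rw [hρ]; linarith [neg_abs_le (ε * s)]
  have hρu : ρ ≤ 3 / 2 := by rw [hρ]; linarith [le_abs_self (ε * s)]
  have hρ0 : 0 < ρ := by linarith
  have hθ0 : 0 < θ := by rw [hθ]; positivity
  set X := T ^ m with hX
  have hX1 : 1 ≤ X := one_le_pow₀ hT
  have hX2 : T ^ (2 * m) = X ^ 2 := by rw [hX, ← pow_mul, mul_comm]
  rw [hX2] at hc1
  have hS1 : 1 ≤ S := by
    refine (pow_le_pow_iff_left₀ zero_le_one hS.le two_ne_zero).1 ?_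
    rw [hS2, one_pow]
    exact le_add_of_nonneg_right (by positivity)
  have hρS1 : 1 ≤ 2 * (ρ * S) := by
    have := mul_le_mul hρl hS1 zero_le_one hρ0.le
    linarith
  have hρ4 : 0 ≤ c1 ^ 2 * (ρ ^ 2 - 1 / 4) := by
    refine mul_nonneg (sq_nonneg c1) ?_
    have := mul_self_le_mul_self (by norm_num) hρl
    linarith
  have hSX : X ≤ 2 * S := by
    refine (pow_le_pow_iff_left₀ (by linarith) (by positivity) two_ne_zero).1 ?_
    rw [mul_pow, hS2]
    linarith
  have hcS : |c1| ≤ 2 * S := by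
    refine (pow_le_pow_iff_left₀ (abs_nonneg _) (by positivity) two_ne_zero).1 ?_
    rw [mul_pow, hS2, sq_abs]
    linarith
  have hsin : 0 < sin θ := sin_pos_of_pos_of_lt_pi hθ0 (by linarith [pi_pos])
  have hcos : 0 < cos θ := cos_pos_of_mem_Ioo ⟨by linarith, by linarith [pi_pos]⟩
  have hsc : sin θ ≤ cos θ := by
    rw [← cos_pi_div_two_sub]
    exact cos_le_cos_of_nonneg_of_le_pi hθ0.le (by linarith [pi_pos]) (by linarith)
  have hpi : θ ≤ 1 := by linarith [pi_lt_four]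
  have hcotu : cos θ / sin θ ≤ 1 / θ := by
    rw [div_le_div_iff₀ hsin hθ0, one_mul, mul_comm]
    have := le_tan hθ0.le (show θ < π / 2 by linarith [pi_pos])
    rw [tan_eq_sin_div_cos, le_div_iff₀ hcos] at this
    exact this
  have hcotl : 1 / θ - 1 ≤ cos θ / sin θ := by
    have h1 := one_sub_sq_div_two_le_cos (x := θ)
    have h2 := sin_le hθ0.le
    have h3 : (1 / θ - 1) * sin θ ≤ cos θ := by
      have h4 : 0 ≤ 1 / θ - 1 := by rw [sub_nonneg, le_div_iff₀ hθ0]; linarith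
      have h5 : (1 / θ - 1) * sin θ ≤ (1 / θ - 1) * θ := mul_le_mul_of_nonneg_left h2 h4
      have h6 : (1 / θ - 1) * θ = 1 - θ := by field_simp
      have h7 : θ ^ 2 ≤ θ := by rw [sq]; exact mul_le_of_le_one_left hθ0.le hpi
      linarith
    rwa [le_div_iff₀ hsin]
  have hρS : 1 / (ρ * S) ≤ 2 := by
    rw [div_le_iff₀ (by positivity)]
    exact hρS1
  have hTX : T ^ (2 * m - 1) * T = X ^ 2 := by
    rw [← pow_succ, show 2 * m - 1 + 1 = 2 * m by omega, hX2]
  have hTm : T ^ (m + 1) = X * T := by rw [pow_succ]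
  have hX0 : 0 < X := by linarith
  refine ⟨?_, ?_, ?_, ?_, ?_, ?_⟩
  · rw [abs_div, abs_mul, abs_of_pos (by positivity : 0 < S ^ 3),
      abs_of_pos (by positivity : 0 < ρ ^ 2 * c1 ^ 2 + 2), div_le_iff₀ (by positivity)]
    calc |c1| * (ρ ^ 2 * c1 ^ 2 + 2) ≤ 2 * S * (2 * S ^ 2) :=
          mul_le_mul hcS (by linarith [show 0 ≤ ρ ^ 2 * c1 ^ 2 by positivity]) (by positivity)
            (by positivity)
      _ = 4 * S ^ 3 := by ring
  · rw [abs_div, abs_of_pos hS, div_le_iff₀ hS]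
    exact hcS
  · rw [abs_of_pos (by positivity), div_le_iff₀ (by positivity)]
    calc sin θ ≤ cos θ * 1 := by rwa [mul_one]
      _ ≤ cos θ * (2 * (ρ * S)) := by gcongr
      _ = 2 * (ρ * cos θ * S) := by ring
  · rw [abs_of_pos (by positivity), hTm, mul_one_div,
      div_le_div_iff₀ (by positivity) (by positivity)]
    have e : ρ * T ^ (2 * m - 1) * (ε * (X * T)) = ρ * ε * X ^ 3 := by
      linear_combination ρ * ε * X * hTX
    rw [e]
    have h3 : X ^ 3 ≤ (2 * S) ^ 3 := pow_le_pow_left₀ hX0.le hSX 3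
    calc ρ * ε * X ^ 3 ≤ 3 / 2 * ε * (2 * S) ^ 3 := by gcongr
      _ = 12 * (ε * S ^ 3) := by ring
  · rw [abs_of_pos (by positivity), hTm]
    have e : cos θ / (ρ * sin θ * S) = cos θ / sin θ * (1 / (ρ * S)) := by field_simp
    rw [e]
    have h1 : 1 / (ρ * S) ≤ 4 / X := by
      rw [div_le_div_iff₀ (by positivity) hX0]
      have := mul_le_mul_of_nonneg_right hρl hS.le
      linarith
    calc cos θ / sin θ * (1 / (ρ * S)) ≤ 1 / θ * (4 / X) :=
          mul_le_mul hcotu h1 (by positivity) (by positivity)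
      _ = 4 * (1 / (ε * (X * T))) := by rw [hθ]; field_simp
  · have e1 : cos θ / (ρ * sin θ * S) = 1 / θ * (1 / (ρ * S)) -
        (1 / θ - cos θ / sin θ) * (1 / (ρ * S)) := by field_simp; ring
    have e2 : ρ * T ^ (2 * m - 1) / (ε * S ^ 3) - 1 / θ * (1 / (ρ * S)) =
        s * (2 + ε * s) / T * (1 / (ρ * S ^ 3)) := by
      have h1 : ρ ^ 2 * X ^ 2 - S ^ 2 = ε * s * (2 + ε * s) := by
        rw [hS2, hc1, hρ]; ring
      have h2 : T ^ (2 * m - 1) = X ^ 2 / T := by rw [← hTX]; field_simp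
      rw [h2, hθ]
      field_simp
      linear_combination h1
    have h1 : |s * (2 + ε * s) / T * (1 / (ρ * S ^ 3))| ≤ 5 / 2 * 2 := by
      rw [abs_mul, abs_div, abs_mul, abs_of_pos hT0]
      have h3 : 1 ≤ S ^ 3 := one_le_pow₀ hS1
      have h4 : |1 / (ρ * S ^ 3)| ≤ 2 := by
        rw [abs_of_pos (by positivity), div_le_iff₀ (by positivity)]
        have := mul_le_mul hρl h3 zero_le_one hρ0.le
        linarith
      have h5 : |2 + ε * s| ≤ 5 / 2 := by
        rw [abs_le]; constructor <;> linarith [neg_abs_le (ε * s), le_abs_self (ε * s)]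
      have h6 : |s| * |2 + ε * s| / T ≤ 5 / 2 := by
        rw [div_le_iff₀ hT0, mul_comm]
        exact mul_le_mul h5 hs (abs_nonneg _) (by norm_num)
      exact mul_le_mul h6 h4 (abs_nonneg _) (by norm_num)
    have h2 : |(1 / θ - cos θ / sin θ) * (1 / (ρ * S))| ≤ 1 * 2 := by
      rw [abs_mul]
      refine mul_le_mul ?_ ?_ (abs_nonneg _) (by norm_num)
      · rw [abs_le]; constructor <;> linarith
      · rw [abs_of_pos (by positivity)]; exact hρS
    rw [e1, show ρ * T ^ (2 * m - 1) / (ε * S ^ 3) - (1 / θ * (1 / (ρ * S)) -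
        (1 / θ - cos θ / sin θ) * (1 / (ρ * S))) = (ρ * T ^ (2 * m - 1) / (ε * S ^ 3) -
        1 / θ * (1 / (ρ * S))) + (1 / θ - cos θ / sin θ) * (1 / (ρ * S)) by ring, e2]
    refine (abs_add_le _ _).trans ?_
    linarith

variable {m k : ℕ} {a ε : ℝ} {φ : ℝ → ℝ}

/-- On the neck the mean curvature is bounded, and the second fundamental form is bounded by the
principal curvatures of the catenoid. -/
theorem neck_estimate (hm : m ≠ 0) (h : IsProfile m a ε φ) (ha : 0 < a) (hε : 0 < ε)
    (hπ : 2 * a + ε < π / 4) (hφ : ∀ r ∈ Icc ε (π / 2), φ r ≤ 1 / 2)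
    {x : EuclideanSum (m + 1) (k + 1)} (hxM : x ∈ doubleGraph (m + 1) (k + 1) ε φ)
    (hxa : polarAngle x < a + ε) :
    |meanCurvature (doubleGraph (m + 1) (k + 1) ε φ) x| ≤ 9 ∧
      secondFundamentalNorm (doubleGraph (m + 1) (k + 1) ε φ) x ≤
        10 + (12 * m + 4) * (ε ^ m / polarAngle x ^ (m + 1)) := by
  have hπ2 : 2 * a + ε < π / 2 := by linarith [pi_pos]
  have hφ1 : ∀ r ∈ Icc ε (π / 2), 0 ≤ φ r ∧ φ r < 1 :=
    fun r hr => ⟨h.nonneg hm ha hε hπ2 hr, by linarith [hφ r hr]⟩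
  have hMs := isSmoothHypersurface_doubleGraph (Nat.succ_ne_zero m) (Nat.succ_ne_zero k) h hm ha hε
    hπ2 fun r hr => (hφ1 r hr).2
  obtain ⟨hx, hr, habs⟩ :=
    (mem_doubleGraph_iff (Nat.succ_ne_zero m) (Nat.succ_ne_zero k) hε hφ1).1 hxM
  obtain ⟨I, c, c1, hI, hImem, hc⟩ := exists_catenoid_profile hm
  have hT1 : 1 ≤ polarAngle x / ε := by rwa [le_div_iff₀ hε, one_mul]
  have hφx : φ (polarAngle x) = ε * neckHeight m (polarAngle x / ε) := by
    rw [h.eq_neck _ ⟨hr, hxa.le⟩, neckFunction_eq]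
  obtain ⟨s, hs⟩ : ∃ s, s = (‖x‖ - 1) / ε := ⟨_, rfl⟩
  have hxs : ‖x‖ = 1 + ε * s := by rw [hs]; field_simp; ring
  have hsabs : |s| = neckHeight m (polarAngle x / ε) := by
    rw [hs, abs_div, habs, hφx, abs_of_pos hε, mul_div_cancel_left₀ _ hε.ne']
  have hsI : s ∈ I := hImem _ _ hT1 hsabs
  obtain ⟨-, hcs1, hcs2, hcs3, hcs4, hcs5⟩ := hc s hsI
  have hcs : c s = polarAngle x / ε :=
    (strictMonoOn_neckHeight hm).injOn hcs1 hT1 (hcs2.trans hsabs)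
  have hθ : ε * c s = polarAngle x := by rw [hcs]; field_simp
  have hθ0 : 0 < ε * c s := by rw [hθ]; linarith
  have hθ4 : ε * c s ≤ π / 4 := by rw [hθ]; linarith
  have hεs : |ε * s| ≤ 1 / 2 := by
    rw [abs_mul, abs_of_pos hε, hsabs, ← hφx]
    exact hφ _ ⟨hr, polarAngle_le x⟩
  have hsT : |s| ≤ c s := by rw [hsabs, hcs]; exact neckHeight_le_self hm hT1
  have hρ0 : 0 < 1 + ε * s := by linarith [neg_abs_le (ε * s)]
  have hsin : 0 < sin (ε * c s) := sin_pos_of_pos_of_lt_pi hθ0 (by linarith [pi_pos])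
  have hcos : 0 < cos (ε * c s) := cos_pos_of_mem_Ioo ⟨by linarith, by linarith [pi_pos]⟩
  obtain ⟨y, z, hy, hz, hxyz⟩ :=
    exists_eq_polarPoint (Nat.succ_ne_zero m) (Nat.succ_ne_zero k) hx
  set S := √(1 + (1 + ε * s) ^ 2 * c1 s ^ 2) with hSdef
  have hS0 : 0 < S := Real.sqrt_pos.2 (by positivity)
  have hS2 : S ^ 2 = 1 + (1 + ε * s) ^ 2 * c1 s ^ 2 := Real.sq_sqrt (by positivity)
  have hIev : ∀ᶠ t in 𝓝 s, t ∈ I := hI.mem_nhds hsI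
  have hlin : ∀ t : ℝ, HasDerivAt (fun t => 1 + ε * t) ε t := fun t => by
    simpa using ((hasDerivAt_id t).const_mul ε).const_add 1
  have hcurv := curvature_polar (p := m + 1) (q := k + 1) (n := m + k + 1) (by ring) hMs
    (ρ := fun t => 1 + ε * t) (θ := fun t => ε * c t) (ρ1 := fun _ => ε)
    (θ1 := fun t => ε * c1 t) (ρ2 := 0) (θ2 := ε * (m * c s ^ (2 * m - 1))) (s := s) (D := ε * S)
    hy hz (.of_forall hlin) (hIev.mono fun t ht => (hc t ht).2.2.2.2.1.const_mul ε)
    (hasDerivAt_const s ε) (hcs5.const_mul ε) hρ0 hsin hcos (by positivity)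
    (by rw [mul_pow, hS2]; ring) ?_
  swap
  · filter_upwards [hIev, (hcs4.const_mul ε).continuousAt.eventually
      (gt_mem_nhds (show ε * c s < a + ε by rw [hθ]; exact hxa))] with t htI hta y z hy hz
    obtain ⟨-, h1, h2, -⟩ := hc t htI
    have h3 : ε ≤ ε * c t := by nlinarith
    have h4 : φ (ε * c t) = ε * |t| := by
      rw [h.eq_neck _ ⟨h3, hta.le⟩, neckFunction_eq, mul_div_cancel_left₀ _ hε.ne', h2]
    have h5 : ε * c t ∈ Icc ε (π / 2) := ⟨h3, by linarith⟩
    rcases le_total 0 t with h0 | h0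
    · refine Or.inl (mem_warpedGraph.2 ⟨y, z, _, hy, hz, h5, ?_⟩)
      rw [h4, abs_of_nonneg h0]; rfl
    · refine Or.inr (mem_warpedGraph.2 ⟨y, z, _, hy, hz, h5, ?_⟩)
      rw [Pi.neg_apply, h4, abs_of_nonpos h0, mul_neg, neg_neg]; rfl
  obtain ⟨σ, hσ, -, hH, hB⟩ := hcurv
  have hpt : x = WithLp.toLp 2 (((1 + ε * s) * sin (ε * c s)) • y,
      ((1 + ε * s) * cos (ε * c s)) • z) := by
    rw [hθ, ← hxs]; exact hxyz
  rw [← hpt] at hH hB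
  obtain ⟨b1, b2, b3, b4, b5, b6⟩ :=
    neck_curvature_bounds (θ := ε * c s) hm hε hcs1 hsT hcs3 rfl hεs rfl hθ4
    hS0 hS2
  have hY : 1 / (ε * c s ^ (m + 1)) = ε ^ m / polarAngle x ^ (m + 1) := by
    rw [← hθ, mul_pow]
    have : 0 < c s := by linarith
    field_simp
    ring
  rw [hY] at b4 b5
  have eκ : ((1 + ε * s) ^ 2 * (ε * c1 s) ^ 3 + 2 * ε ^ 2 * (ε * c1 s) + (1 + ε * s) *
      (ε * (ε * (m * c s ^ (2 * m - 1))) - 0 * (ε * c1 s))) / (ε * S) ^ 3 =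
      c1 s * ((1 + ε * s) ^ 2 * c1 s ^ 2 + 2) / S ^ 3 +
      m * ((1 + ε * s) * c s ^ (2 * m - 1) / (ε * S ^ 3)) := by
    field_simp
    ring
  have eκy : (ε * c1 s - ε * cos (ε * c s) / ((1 + ε * s) * sin (ε * c s))) / (ε * S) =
      c1 s / S - cos (ε * c s) / ((1 + ε * s) * sin (ε * c s) * S) := by
    field_simp
  have eκz : (ε * c1 s + ε * sin (ε * c s) / ((1 + ε * s) * cos (ε * c s))) / (ε * S) =
      c1 s / S + sin (ε * c s) / ((1 + ε * s) * cos (ε * c s) * S) := by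
    field_simp
  rw [eκ, eκy, eκz] at hH hB
  -- `A2` and `A4` are the unbounded terms; the trace involves them only through `m (A2 - A4)`.
  generalize c1 s * ((1 + ε * s) ^ 2 * c1 s ^ 2 + 2) / S ^ 3 = A1 at *
  generalize (1 + ε * s) * c s ^ (2 * m - 1) / (ε * S ^ 3) = A2 at *
  generalize c1 s / S = A3 at *
  generalize cos (ε * c s) / ((1 + ε * s) * sin (ε * c s) * S) = A4 at *
  generalize sin (ε * c s) / ((1 + ε * s) * cos (ε * c s) * S) = A5 at *
  generalize ε ^ m / polarAngle x ^ (m + 1) = Y at *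
  have hm0 : (0 : ℝ) ≤ m := Nat.cast_nonneg m
  have hk0 : (0 : ℝ) ≤ k := Nat.cast_nonneg k
  constructor
  · have hσ1 : |σ| = 1 := by rcases hσ with rfl | rfl <;> simp
    rw [hH, abs_div, abs_mul, hσ1, one_mul, div_le_iff₀ (by positivity)]
    push_cast
    have e : A1 + m * A2 + ((m : ℝ) + 1 - 1) * (A3 - A4) + ((k : ℝ) + 1 - 1) * (A3 + A5) =
        A1 + m * (A2 - A4) + m * A3 + k * A3 + k * A5 := by ring
    rw [e, abs_of_nonneg (by positivity : (0 : ℝ) ≤ (m : ℝ) + k + 1)]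
    calc _ ≤ |A1| + |(m : ℝ) * (A2 - A4)| + |(m : ℝ) * A3| + |(k : ℝ) * A3| + |(k : ℝ) * A5| := by
          refine (abs_add_le _ _).trans (add_le_add_left ?_ _)
          refine (abs_add_le _ _).trans (add_le_add_left ?_ _)
          refine (abs_add_le _ _).trans (add_le_add_left ?_ _)
          exact abs_add_le _ _
      _ = |A1| + m * |A2 - A4| + m * |A3| + k * |A3| + k * |A5| := by
          simp only [abs_mul, Nat.abs_cast]
      _ ≤ 4 + m * 7 + m * 2 + k * 2 + k * 2 := by gcongr
      _ ≤ 9 * ((m : ℝ) + k + 1) := by linarith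
  · refine hB.trans ?_
    calc _ ≤ (|A1| + |(m : ℝ) * A2|) + (|A3| + |A4|) + (|A3| + |A5|) := by
          gcongr
          · exact abs_add_le _ _
          · exact abs_sub _ _
          · exact abs_add_le _ _
      _ = (|A1| + m * |A2|) + (|A3| + |A4|) + (|A3| + |A5|) := by
          simp only [abs_mul, Nat.abs_cast]
      _ ≤ (4 + m * (12 * Y)) + (2 + 4 * Y) + (2 + 2) := by gcongr
      _ = 10 + (12 * m + 4) * Y := by ring

/-- The principal curvatures of a graph over the unit sphere are close to `1` when the graph is
`C²`-close to the sphere. -/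
theorem exists_graph_curvature_near_one {η : ℝ} (hη : 0 < η) : ∃ η' > 0, η' ≤ 1 / 2 ∧
    ∀ ρ p1 p2 u v : ℝ, |ρ - 1| ≤ η' → |p1| ≤ η' → |p2| ≤ η' → |u| ≤ η' → |v| ≤ η' →
      |(ρ ^ 2 + 2 * p1 ^ 2 - ρ * p2) / √(p1 ^ 2 + ρ ^ 2) ^ 3 - 1| ≤ η ∧
      |(1 - u / ρ) / √(p1 ^ 2 + ρ ^ 2) - 1| ≤ η ∧ |(1 + v / ρ) / √(p1 ^ 2 + ρ ^ 2) - 1| ≤ η ∧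
      |ρ⁻¹ - 1| ≤ η := by
  set f : ℝ × ℝ × ℝ × ℝ × ℝ → ℝ × ℝ × ℝ × ℝ := fun w =>
    ((w.1 ^ 2 + 2 * w.2.1 ^ 2 - w.1 * w.2.2.1) / √(w.2.1 ^ 2 + w.1 ^ 2) ^ 3,
      (1 - w.2.2.2.1 / w.1) / √(w.2.1 ^ 2 + w.1 ^ 2),
      (1 + w.2.2.2.2 / w.1) / √(w.2.1 ^ 2 + w.1 ^ 2), w.1⁻¹) with hf
  have hcont : ContinuousAt f (1, 0, 0, 0, 0) := by
    refine ContinuousAt.prodMk ?_ (ContinuousAt.prodMk ?_ (ContinuousAt.prodMk ?_ ?_))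
    · exact ContinuousAt.div (by fun_prop) (by fun_prop) (by simp)
    · exact ContinuousAt.div (continuousAt_const.sub (ContinuousAt.div (by fun_prop) (by fun_prop)
        (by simp))) (by fun_prop) (by simp)
    · exact ContinuousAt.div (continuousAt_const.add (ContinuousAt.div (by fun_prop) (by fun_prop)
        (by simp))) (by fun_prop) (by simp)
    · exact ContinuousAt.inv₀ (by fun_prop) (by simp)
  have hf1 : f (1, 0, 0, 0, 0) = (1, 1, 1, 1) := by simp [hf]
  obtain ⟨d, hd, hd2⟩ := Metric.continuousAt_iff.1 hcont η hη
  refine ⟨min (d / 2) (1 / 2), by positivity, min_le_right _ _,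
    fun ρ p1 p2 u v h1 h2 h3 h4 h5 => ?_⟩
  have hlt : min (d / 2) (1 / 2) < d := (min_le_left _ _).trans_lt (by linarith)
  have h := @hd2 (ρ, p1, p2, u, v) (by
    simp only [Prod.dist_eq, max_lt_iff, Real.dist_eq, sub_zero]
    exact ⟨h1.trans_lt hlt, h2.trans_lt hlt, h3.trans_lt hlt, h4.trans_lt hlt, h5.trans_lt hlt⟩)
  rw [hf1] at h
  simp only [Prod.dist_eq, max_lt_iff, Real.dist_eq, hf] at h
  exact ⟨h.1.le, h.2.1.le, h.2.2.1.le, h.2.2.2.le⟩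

/-- Where the profile is `C²`-small, the glued spheres have principal curvatures close to `1`. -/
theorem exists_outer_estimate (hm : m ≠ 0) {η : ℝ} (hη : 0 < η) : ∃ η' > 0, η' ≤ 1 / 2 ∧
    ∀ (k : ℕ) (a ε δ : ℝ) (φ : ℝ → ℝ), IsProfile m a ε φ → 0 < a → 0 < ε → 2 * a + ε < π / 4 →
      ε < δ → δ ≤ 1 → (∀ r ∈ Icc ε (π / 2), φ r ≤ η') →
      (∀ r ∈ Ico δ (π / 2), |deriv φ r| ≤ η' * δ) →
      (∀ r ∈ Ico δ (π / 2), |deriv (deriv φ) r| ≤ η') →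
      ∀ x ∈ doubleGraph (m + 1) (k + 1) ε φ, δ ≤ polarAngle x →
        |meanCurvature (doubleGraph (m + 1) (k + 1) ε φ) x - 1| ≤ η ∧
        secondFundamentalNorm (doubleGraph (m + 1) (k + 1) ε φ) x ≤ 3 * (1 + η) := by
  obtain ⟨η', hη', hη2, hest⟩ := exists_graph_curvature_near_one hη
  refine ⟨η', hη', hη2, fun k a ε δ φ h ha hε hπ hεδ hδ1 hφ hφ' hφ'' x hxM hxδ => ?_⟩
  have hδ : 0 < δ := hε.trans hεδ
  have hπ2 : 2 * a + ε < π / 2 := by linarith [pi_pos]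
  have hφ1 : ∀ r ∈ Icc ε (π / 2), 0 ≤ φ r ∧ φ r < 1 :=
    fun r hr => ⟨h.nonneg hm ha hε hπ2 hr, by linarith [hφ r hr]⟩
  have hMs := isSmoothHypersurface_doubleGraph (Nat.succ_ne_zero m) (Nat.succ_ne_zero k) h hm ha hε
    hπ2 fun r hr => (hφ1 r hr).2
  obtain ⟨hx, hr, habs⟩ :=
    (mem_doubleGraph_iff (Nat.succ_ne_zero m) (Nat.succ_ne_zero k) hε hφ1).1 hxM
  have hxn := norm_pos_iff.2 hx
  have hρ : |‖x‖ - 1| ≤ η' := by rw [habs]; exact hφ _ ⟨hr, polarAngle_le x⟩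
  rcases le_or_gt (polarAngle x) (2 * a + ε) with hra | hra
  -- Up to the angle `2a + ε`, which is less than `π / 2`, polar coordinates are regular.
  · obtain ⟨r, hrdef⟩ : ∃ r, r = polarAngle x := ⟨_, rfl⟩
    rw [← hrdef] at hr habs hra hxδ
    obtain ⟨y, z, hy, hz, hxyz⟩ :=
      exists_eq_polarPoint (Nat.succ_ne_zero m) (Nat.succ_ne_zero k) hx
    rw [← hrdef] at hxyz
    obtain ⟨τ, hτ, hτx⟩ : ∃ τ : ℝ, (τ = 1 ∨ τ = -1) ∧ ‖x‖ = 1 + τ * φ r := by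
      rcases (abs_eq (hφ1 r ⟨hr, by linarith⟩).1).1 habs with h | h
      · exact ⟨1, Or.inl rfl, by linarith⟩
      · exact ⟨-1, Or.inr rfl, by linarith⟩
    have hτ1 : |τ| = 1 := by rcases hτ with rfl | rfl <;> simp
    have hr0 : 0 < r := by linarith
    have hrI : r ∈ Ioo ε (π / 2) := ⟨by linarith, by linarith⟩
    have hrI' : r ∈ Ico δ (π / 2) := ⟨hxδ, by linarith⟩
    have hsin : 0 < sin r := sin_pos_of_pos_of_lt_pi hr0 (by linarith)
    have hcos : 0 < cos r := cos_pos_of_mem_Ioo ⟨by linarith, hrI.2⟩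
    have hIev : ∀ᶠ t in 𝓝 r, t ∈ Ioo ε (π / 2) := Ioo_mem_nhds hrI.1 hrI.2
    have hd1 : ∀ᶠ t in 𝓝 r, HasDerivAt (fun t => 1 + τ * φ t) (τ * deriv φ t) t :=
      hIev.mono fun t ht => ((h.differentiableAt ht).hasDerivAt.const_mul τ).const_add 1
    have hd2 : HasDerivAt (fun t => τ * deriv φ t) (τ * deriv (deriv φ) r) r := by
      have h1 : ContDiffAt ℝ ∞ (deriv φ) r := (h.contDiffAt hrI).derivWithin (by simp)
      exact (h1.differentiableAt (by simp)).hasDerivAt.const_mul τ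
    set D := √((τ * deriv φ r) ^ 2 + ‖x‖ ^ 2) with hDdef
    have hD : 0 < D := Real.sqrt_pos.2 (by positivity)
    have hD2 : D ^ 2 = (τ * deriv φ r) ^ 2 + ‖x‖ ^ 2 := Real.sq_sqrt (by positivity)
    have hcurv := curvature_polar (p := m + 1) (q := k + 1) (n := m + k + 1) (by ring) hMs
      (ρ := fun t => 1 + τ * φ t) (θ := fun t => t) (ρ1 := fun t => τ * deriv φ t)
      (θ1 := fun _ => 1) (ρ2 := τ * deriv (deriv φ) r) (θ2 := 0) (s := r) (D := D)
      hy hz hd1 (.of_forall fun t => hasDerivAt_id t) hd2 (hasDerivAt_const r 1)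
      (by rw [← hτx]; exact hxn) hsin hcos hD (by rw [hD2, ← hτx]; ring) ?_
    swap
    · filter_upwards [hIev] with t ht y z hy hz
      rcases hτ with rfl | rfl
      · exact Or.inl (mem_warpedGraph.2 ⟨y, z, t, hy, hz, ⟨ht.1.le, ht.2.le⟩, by
          rw [one_mul]; rfl⟩)
      · exact Or.inr (mem_warpedGraph.2 ⟨y, z, t, hy, hz, ⟨ht.1.le, ht.2.le⟩, by
          rw [Pi.neg_apply, neg_one_mul]; rfl⟩)
    obtain ⟨σ, hσ, hσ0, hH, hB⟩ := hcurv
    have hσ1 : σ = 1 := by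
      rcases hσ with h | h
      · exact h
      · rw [h] at hσ0; norm_num at hσ0
    simp only [← hτx] at hH hB
    have hpt : x = WithLp.toLp 2 ((‖x‖ * sin r) • y, (‖x‖ * cos r) • z) := hxyz
    rw [← hpt] at hH hB
    have hp1 : |τ * deriv φ r| ≤ η' * δ := by rw [abs_mul, hτ1, one_mul]; exact hφ' r hrI'
    have hp1' : |τ * deriv φ r| ≤ η' := hp1.trans (mul_le_of_le_one_right hη'.le hδ1)
    have hcot : cos r / sin r ≤ 1 / δ := by
      have h1 : cos r / sin r ≤ 1 / r := by
        rw [div_le_div_iff₀ hsin hr0, one_mul, mul_comm]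
        have := le_tan hr0.le hrI.2
        rwa [tan_eq_sin_div_cos, le_div_iff₀ hcos] at this
      exact h1.trans (one_div_le_one_div_of_le hδ hxδ)
    have htan : sin r / cos r ≤ 1 := by
      rw [div_le_one hcos, ← cos_pi_div_two_sub]
      exact cos_le_cos_of_nonneg_of_le_pi hr0.le (by linarith [pi_pos]) (by linarith)
    obtain ⟨e1, e2, e3, -⟩ := hest ‖x‖ (τ * deriv φ r) (τ * deriv (deriv φ) r)
      (τ * deriv φ r * (cos r / sin r)) (τ * deriv φ r * (sin r / cos r)) hρ hp1'
      (by rw [abs_mul, hτ1, one_mul]; exact hφ'' r hrI')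
      (by
        rw [abs_mul, abs_of_pos (by positivity : 0 < cos r / sin r)]
        calc _ ≤ η' * δ * (1 / δ) := by gcongr
          _ = η' := by field_simp)
      (by
        rw [abs_mul, abs_of_pos (by positivity : 0 < sin r / cos r)]
        exact (mul_le_mul hp1' htan (by positivity) hη'.le).trans (mul_one η').le)
    rw [← hDdef] at e1 e2 e3
    have f1 : (‖x‖ ^ 2 * 1 ^ 3 + 2 * (τ * deriv φ r) ^ 2 * 1 + ‖x‖ * (τ * deriv φ r * 0 -
        τ * deriv (deriv φ) r * 1)) / D ^ 3 =
        (‖x‖ ^ 2 + 2 * (τ * deriv φ r) ^ 2 - ‖x‖ * (τ * deriv (deriv φ) r)) / D ^ 3 := by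
      congr 1; ring
    have f2 : (1 - τ * deriv φ r * cos r / (‖x‖ * sin r)) / D =
        (1 - τ * deriv φ r * (cos r / sin r) / ‖x‖) / D := by
      congr 2; field_simp
    have f3 : (1 + τ * deriv φ r * sin r / (‖x‖ * cos r)) / D =
        (1 + τ * deriv φ r * (sin r / cos r) / ‖x‖) / D := by
      congr 2; field_simp
    rw [f1, f2, f3] at hH hB
    generalize (‖x‖ ^ 2 + 2 * (τ * deriv φ r) ^ 2 - ‖x‖ * (τ * deriv (deriv φ) r)) / D ^ 3 = A1 at *
    generalize (1 - τ * deriv φ r * (cos r / sin r) / ‖x‖) / D = A2 at *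
    generalize (1 + τ * deriv φ r * (sin r / cos r) / ‖x‖) / D = A3 at *
    have hm0 : (0 : ℝ) ≤ m := Nat.cast_nonneg m
    have hk0 : (0 : ℝ) ≤ k := Nat.cast_nonneg k
    constructor
    · have e : meanCurvature (doubleGraph (m + 1) (k + 1) ε φ) x - 1 =
          ((A1 - 1) + m * (A2 - 1) + k * (A3 - 1)) / (m + k + 1 : ℝ) := by
        rw [hH, hσ1]
        push_cast
        field_simp
        ring
      rw [e, abs_div, abs_of_nonneg (by positivity : (0 : ℝ) ≤ (m : ℝ) + k + 1),
        div_le_iff₀ (by positivity)]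
      calc _ ≤ |A1 - 1| + |(m : ℝ) * (A2 - 1)| + |(k : ℝ) * (A3 - 1)| :=
            (abs_add_le _ _).trans (add_le_add_left (abs_add_le _ _) _)
        _ = |A1 - 1| + m * |A2 - 1| + k * |A3 - 1| := by simp only [abs_mul, Nat.abs_cast]
        _ ≤ η + m * η + k * η := by gcongr
        _ = η * (m + k + 1) := by ring
    · refine hB.trans ?_
      have g : ∀ A : ℝ, |A - 1| ≤ η → |A| ≤ 1 + η := fun A hA => by
        rw [abs_le] at hA ⊢; constructor <;> linarith
      linarith [g _ e1, g _ e2, g _ e3]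
  -- Beyond the angle `2a + ε` the profile is constant and the hypersurface is a round sphere.
  · obtain ⟨b, hb⟩ := h.eq_const
    have hxb : |‖x‖ - 1| = b := by rw [habs]; exact hb _ ⟨hra.le, polarAngle_le x⟩
    obtain ⟨hH, hB⟩ := curvature_of_sphere (p := m + 1) (q := k + 1) (n := m + k + 1) (by ring)
      (Nat.succ_ne_zero _) hMs hxn rfl (by
        filter_upwards [continuousAt_id.eventually_ne hx,
          (continuousAt_polarAngle hx).eventually (lt_mem_nhds hra)] with w hw hwa hwx
        refine (mem_doubleGraph_iff (Nat.succ_ne_zero m) (Nat.succ_ne_zero k) hε hφ1).2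
          ⟨hw, by linarith, ?_⟩
        rw [hwx, hxb, hb _ ⟨hwa.le, polarAngle_le w⟩])
    obtain ⟨-, -, -, e4⟩ := hest ‖x‖ 0 0 0 0 hρ (by simpa using hη'.le) (by simpa using hη'.le)
      (by simpa using hη'.le) (by simpa using hη'.le)
    constructor
    · rw [hH]; exact e4
    · refine hB.trans ?_
      linarith [(abs_le.1 e4).2]

end Estimates

/-! ### Volume estimates -/

section Volume

/-- If `f` is `L`-Lipschitz with respect to the pullback under `g` of the metric, then the image of
`f` is an `L`-Lipschitz image of the image of `g`. -/
theorem hausdorffMeasure_image_le_image {X Y Z : Type*} [EMetricSpace Y] [EMetricSpace Z]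
    [MeasurableSpace Y] [BorelSpace Y] [MeasurableSpace Z] [BorelSpace Z] {f : X → Y} {g : X → Z}
    {s : Set X} {L : ℝ≥0} (h : ∀ x ∈ s, ∀ y ∈ s, edist (f x) (f y) ≤ L * edist (g x) (g y)) {d : ℝ}
    (hd : 0 ≤ d) : μH[d] (f '' s) ≤ (L : ℝ≥0∞) ^ d * μH[d] (g '' s) := by
  rcases s.eq_empty_or_nonempty with rfl | ⟨x₀, hx₀⟩
  · simp
  have : Nonempty X := ⟨x₀⟩
  have hinv : ∀ x ∈ s, Function.invFunOn g s (g x) ∈ s ∧ g (Function.invFunOn g s (g x)) = g x :=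
    fun x hx => Function.invFunOn_pos ⟨x, hx, rfl⟩
  have hf : ∀ x ∈ s, f (Function.invFunOn g s (g x)) = f x := by
    intro x hx
    obtain ⟨h1, h2⟩ := hinv x hx
    have h3 := h _ h1 x hx
    rw [h2, edist_self, mul_zero, nonpos_iff_eq_zero, edist_eq_zero] at h3
    exact h3
  have himg : f '' s = (f ∘ Function.invFunOn g s) '' (g '' s) := by
    rw [image_image]
    exact image_congr fun x hx => (hf x hx).symm
  rw [himg]
  refine LipschitzOnWith.hausdorffMeasure_image_le ?_ hd
  rintro _ ⟨x, hx, rfl⟩ _ ⟨y, hy, rfl⟩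
  simp only [Function.comp]
  rw [hf x hx, hf y hy]
  exact h x hx y hy

theorem norm_normalize_sub_le {E : Type*} [NormedAddCommGroup E] [NormedSpace ℝ E] {u v : E}
    (hu : 1 ≤ ‖u‖) (hv : 1 ≤ ‖v‖) : ‖‖u‖⁻¹ • u - ‖v‖⁻¹ • v‖ ≤ 2 * ‖u - v‖ := by
  have hu0 : 0 < ‖u‖ := by linarith
  have hv0 : 0 < ‖v‖ := by linarith
  have e : ‖u‖⁻¹ • u - ‖v‖⁻¹ • v = ‖u‖⁻¹ • (u - v) + (‖u‖⁻¹ - ‖v‖⁻¹) • v := by module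
  have h1 : ‖‖u‖⁻¹ • (u - v)‖ ≤ ‖u - v‖ := by
    rw [norm_smul, norm_inv, norm_norm]
    exact mul_le_of_le_one_left (norm_nonneg _) (inv_le_one_of_one_le₀ hu)
  have h2 : ‖(‖u‖⁻¹ - ‖v‖⁻¹) • v‖ ≤ ‖u - v‖ := by
    rw [norm_smul, Real.norm_eq_abs]
    have e2 : ‖u‖⁻¹ - ‖v‖⁻¹ = ‖u‖⁻¹ * ((‖v‖ - ‖u‖) * ‖v‖⁻¹) := by field_simp
    rw [e2, abs_mul, abs_mul, abs_of_pos (inv_pos.2 hu0), abs_of_pos (inv_pos.2 hv0)]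
    have h3 : |‖v‖ - ‖u‖| ≤ ‖u - v‖ := by
      rw [norm_sub_rev]; exact abs_norm_sub_norm_le v u
    calc ‖u‖⁻¹ * (|‖v‖ - ‖u‖| * ‖v‖⁻¹) * ‖v‖ = ‖u‖⁻¹ * |‖v‖ - ‖u‖| := by field_simp
      _ ≤ 1 * ‖u - v‖ := by
        gcongr
        exact inv_le_one_of_one_le₀ hu
      _ = _ := one_mul _
  rw [e]
  linarith [norm_add_le (‖u‖⁻¹ • (u - v)) ((‖u‖⁻¹ - ‖v‖⁻¹) • v)]

/-- The unit sphere is covered by finitely many Lipschitz images of a cube, namely the radial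
projections of the faces of a cube. -/
theorem exists_sphere_charts (d : ℕ) : ∃ (L : ℝ≥0) (f : Fin (d + 1) × Bool → (Fin d → ℝ) →
    EuclideanSpace ℝ (Fin (d + 1))), (∀ j w, ‖f j w‖ = 1) ∧
      (∀ j w w', ‖f j w - f j w'‖ ≤ L * ‖w - w'‖) ∧
      ∀ y, ‖y‖ = 1 → ∃ j w, ‖w‖ ≤ 1 ∧ f j w = y := by
  set e : Bool → ℝ := fun b => if b then 1 else -1 with he
  have he1 : ∀ b, |e b| = 1 := by intro b; cases b <;> simp [he]
  set v : Fin (d + 1) × Bool → (Fin d → ℝ) → EuclideanSpace ℝ (Fin (d + 1)) :=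
    fun j w => WithLp.toLp 2 (Fin.insertNth j.1 (e j.2) w : Fin (d + 1) → ℝ) with hv
  have hv1 : ∀ j w, 1 ≤ ‖v j w‖ := by
    intro j w
    have := PiLp.norm_apply_le (v j w) j.1
    have h2 : (v j w) j.1 = e j.2 := by simp [hv]
    rwa [h2, Real.norm_eq_abs, he1] at this
  have hlip := PiLp.lipschitzWith_toLp 2 (fun _ : Fin (d + 1) => ℝ)
  set K := ((Fintype.card (Fin (d + 1)) : ℝ≥0) ^ (1 / (2 : ℝ≥0∞)).toReal) with hK
  refine ⟨2 * K, fun j w => ‖v j w‖⁻¹ • v j w, fun j w => ?_, fun j w w' => ?_, fun y hy => ?_⟩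
  · rw [norm_smul, norm_inv, norm_norm, inv_mul_cancel₀ (by linarith [hv1 j w])]
  · refine (norm_normalize_sub_le (hv1 j w) (hv1 j w')).trans ?_
    have h1 := hlip.dist_le_mul (Fin.insertNth j.1 (e j.2) w : Fin (d + 1) → ℝ)
      (Fin.insertNth j.1 (e j.2) w')
    have h2 : dist (Fin.insertNth j.1 (e j.2) w : Fin (d + 1) → ℝ)
        (Fin.insertNth j.1 (e j.2) w') ≤ dist w w' := by
      rw [dist_pi_le_iff dist_nonneg]
      intro i
      refine Fin.succAboveCases j.1 ?_ (fun i => ?_) i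
      · simp
      · simp only [Fin.insertNth_apply_succAbove]
        exact dist_le_pi_dist w w' i
    rw [dist_eq_norm] at h1
    rw [← dist_eq_norm w w']
    calc 2 * ‖v j w - v j w'‖ ≤ 2 * (K * dist w w') := by
          gcongr
          exact h1.trans (by gcongr)
      _ = ((2 * K : ℝ≥0) : ℝ) * dist w w' := by push_cast; ring
  · obtain ⟨i, -, hi⟩ := Finset.exists_max_image Finset.univ (fun i => |y i|) ⟨0, Finset.mem_univ 0⟩
    have hyi : 0 < |y i| := by
      by_contra hcon
      have h0 : ∀ j, y j = 0 := fun j =>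
        abs_nonpos_iff.1 ((hi j (Finset.mem_univ j)).trans (not_lt.1 hcon))
      have : y = 0 := PiLp.ext h0
      rw [this, norm_zero] at hy
      exact zero_ne_one hy
    refine ⟨(i, decide (0 < y i)), fun j => |y i|⁻¹ * y (i.succAbove j), ?_, ?_⟩
    · rw [pi_norm_le_iff_of_nonneg zero_le_one]
      intro j
      rw [norm_mul, norm_inv, Real.norm_eq_abs, Real.norm_eq_abs, abs_abs, inv_mul_le_one₀ hyi]
      exact hi _ (Finset.mem_univ _)
    · have hvy : v (i, decide (0 < y i)) (fun j => |y i|⁻¹ * y (i.succAbove j)) = |y i|⁻¹ • y := by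
        refine PiLp.ext fun l => ?_
        refine Fin.succAboveCases i ?_ (fun l => ?_) l
        · simp only [hv, Fin.insertNth_apply_same, he, PiLp.smul_apply, smul_eq_mul,
            decide_eq_true_eq]
          split_ifs with h
          · rw [abs_of_pos h, inv_mul_cancel₀ h.ne']
          · have h' : y i < 0 := lt_of_le_of_ne (not_lt.1 h) (abs_pos.1 hyi)
            rw [abs_of_neg h', inv_neg, neg_mul, inv_mul_cancel₀ h'.ne]
        · simp [hv]
      simp only [hvy]
      rw [norm_smul, norm_inv, Real.norm_eq_abs, abs_abs, hy, mul_one, inv_inv, smul_smul,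
        mul_inv_cancel₀ hyi.ne', one_smul]

variable {m k : ℕ}

theorem volume_cube_sum {ι κ : Type*} [Fintype ι] [Fintype κ] {r s t : ℝ} :
    (volume (Set.pi univ (Sum.elim (fun _ => Icc (-r) r) (Sum.elim (fun _ => Icc (-s) s)
      (fun _ => Icc 0 t))) : Set (ι ⊕ κ ⊕ Unit → ℝ))) =
      ENNReal.ofReal (2 * r) ^ Fintype.card ι * (ENNReal.ofReal (2 * s) ^ Fintype.card κ *
        ENNReal.ofReal t) := by
  rw [volume_pi_pi, Fintype.prod_sum_type, Fintype.prod_sum_type]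
  simp only [Sum.elim_inl, Sum.elim_inr, Real.volume_Icc, Finset.prod_const, Finset.card_univ,
    Fintype.card_unit, pow_one, sub_neg_eq_add, sub_zero, two_mul]

theorem norm_smul_sub_smul_le {E : Type*} [NormedAddCommGroup E] [NormedSpace ℝ E] (a b : ℝ)
    {u v : E} (hv : ‖v‖ = 1) : ‖a • u - b • v‖ ≤ |a| * ‖u - v‖ + |a - b| := by
  have e : a • u - b • v = a • (u - v) + (a - b) • v := by module
  rw [e]
  refine (norm_add_le _ _).trans ?_
  rw [norm_smul, norm_smul, hv, mul_one, Real.norm_eq_abs, Real.norm_eq_abs]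

/-- The part of the glued spheres at angle at most `R` has volume at most `C R^(m+1)`: it is a
Lipschitz image of a box, with the arc length of the profile controlled by `r + φ(r)`. -/
theorem exists_volume_bound (m k : ℕ) : ∃ C : ℝ≥0, ∀ (ε : ℝ) (φ : ℝ → ℝ), 0 < ε →
    MonotoneOn φ (Icc ε (π / 2)) → (∀ r ∈ Icc ε (π / 2), 0 ≤ φ r ∧ φ r < 1 ∧ φ r ≤ r) →
    ∀ R, ε ≤ R → μH[((m + k + 1 : ℕ) : ℝ)]
      {x ∈ doubleGraph (m + 1) (k + 1) ε φ | polarAngle x ≤ R} ≤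
        C * ENNReal.ofReal (R ^ (m + 1)) := by
  obtain ⟨L, f, hf1, hfL, hfs⟩ := exists_sphere_charts m
  obtain ⟨L', g, hg1, hgL, hgs⟩ := exists_sphere_charts k
  set K : ℝ≥0 := 2 * L + 2 * L' + 4 with hK
  set N := Fintype.card ((Fin (m + 1) × Bool) × (Fin (k + 1) × Bool) × Bool) with hN
  refine ⟨N * (K ^ (m + k + 1) * (2 ^ m * (2 ^ k * 2))), fun ε φ hε hmono hφ R hR => ?_⟩
  have hR0 : 0 < R := hε.trans_le hR
  set S : Set ((Fin m → ℝ) × (Fin k → ℝ) × ℝ) :=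
    {x | ‖x.1‖ ≤ 1 ∧ ‖x.2.1‖ ≤ 1 ∧ x.2.2 ∈ Icc ε (π / 2) ∧ x.2.2 ≤ R} with hS
  set τ : Bool → ℝ := fun b => if b then 1 else -1 with hτ
  have hτ1 : ∀ b, |τ b| = 1 := by intro b; cases b <;> simp [hτ]
  set Ψ : ((Fin (m + 1) × Bool) × (Fin (k + 1) × Bool) × Bool) →
      (Fin m → ℝ) × (Fin k → ℝ) × ℝ → EuclideanSum (m + 1) (k + 1) :=
    fun j x => polarPoint (1 + τ j.2.2 * φ x.2.2) x.2.2 (f j.1 x.1) (g j.2.1 x.2.1) with hΨ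
  set Λ : (Fin m → ℝ) × (Fin k → ℝ) × ℝ → (Fin m ⊕ Fin k ⊕ Unit → ℝ) := fun x =>
    Sum.elim (R • x.1) (Sum.elim x.2.1 fun _ => x.2.2 + φ x.2.2) with hΛ
  have hcover : {x ∈ doubleGraph (m + 1) (k + 1) ε φ | polarAngle x ≤ R} ⊆ ⋃ j, Ψ j '' S := by
    have key : ∀ b : Bool, ∀ x ∈ warpedGraph (m + 1) (k + 1) ε (fun r => τ b * φ r),
        polarAngle x ≤ R → x ∈ ⋃ j, Ψ j '' S := by
      intro b x hx hxR
      obtain ⟨y, z, r, hy, hz, hr, rfl⟩ := mem_warpedGraph.1 hx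
      obtain ⟨i, w, hw, rfl⟩ := hfs y hy
      obtain ⟨j, v, hv, rfl⟩ := hgs z hz
      have hpos : 0 < 1 + τ b * φ r := by
        have h1 := neg_abs_le (τ b * φ r)
        rw [abs_mul, hτ1, one_mul, abs_of_nonneg (hφ r hr).1] at h1
        linarith [(hφ r hr).2.1]
      rw [polarAngle_polarPoint hy hz hpos ⟨hε.le.trans hr.1, hr.2⟩] at hxR
      exact mem_iUnion.2 ⟨(i, j, b), (w, v, r), ⟨hw, hv, hr, hxR⟩, rfl⟩
    rintro x ⟨hx | hx, hxR⟩
    · refine key true x ?_ hxR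
      simpa [hτ] using hx
    · refine key false x ?_ hxR
      have : (fun r => τ false * φ r) = -φ := by ext r; simp [hτ]
      rwa [this]
  have hLip : ∀ j, ∀ x ∈ S, ∀ y ∈ S, edist (Ψ j x) (Ψ j y) ≤ K * edist (Λ x) (Λ y) := by
    rintro ⟨i, j, b⟩ ⟨w, v, r⟩ ⟨-, -, hr, hrR⟩ ⟨w', v', r'⟩ ⟨-, -, hr', -⟩
    simp only at hr hr' hrR
    have hd1 : R * ‖w - w'‖ ≤ dist (Λ (w, v, r)) (Λ (w', v', r')) := by
      have : ‖R • (w - w')‖ ≤ dist (Λ (w, v, r)) (Λ (w', v', r')) := by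
        rw [pi_norm_le_iff_of_nonneg dist_nonneg]
        intro l
        have := dist_le_pi_dist (Λ (w, v, r)) (Λ (w', v', r')) (Sum.inl l)
        simp only [hΛ, Sum.elim_inl, dist_eq_norm] at this
        rwa [smul_sub]
      rwa [norm_smul, Real.norm_of_nonneg hR0.le] at this
    have hd2 : ‖v - v'‖ ≤ dist (Λ (w, v, r)) (Λ (w', v', r')) := by
      rw [pi_norm_le_iff_of_nonneg dist_nonneg]
      intro l
      have := dist_le_pi_dist (Λ (w, v, r)) (Λ (w', v', r')) (Sum.inr (Sum.inl l))
      simpa only [hΛ, Sum.elim_inl, Sum.elim_inr, dist_eq_norm, ← Pi.sub_apply] using this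
    have hd3 : |r - r'| + |φ r - φ r'| ≤ dist (Λ (w, v, r)) (Λ (w', v', r')) := by
      have := dist_le_pi_dist (Λ (w, v, r)) (Λ (w', v', r')) (Sum.inr (Sum.inr ()))
      simp only [hΛ, Sum.elim_inr, Real.dist_eq] at this
      refine le_trans (le_of_eq ?_) this
      rcases le_total r r' with h | h
      · have h2 := hmono hr hr' h
        rw [abs_of_nonpos (by linarith), abs_of_nonpos (by linarith), abs_of_nonpos (by linarith)]
        ring
      · have h2 := hmono hr' hr h
        rw [abs_of_nonneg (by linarith), abs_of_nonneg (by linarith), abs_of_nonneg (by linarith)]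
        ring
    set ds := dist (Λ (w, v, r)) (Λ (w', v', r')) with hds
    have hρ : ∀ {s}, s ∈ Icc ε (π / 2) → |1 + τ b * φ s| ≤ 2 := by
      intro s hs
      refine (abs_add_le _ _).trans ?_
      rw [abs_mul, hτ1, one_mul, abs_of_nonneg (hφ s hs).1, abs_one]
      linarith [(hφ s hs).2.1]
    have hΔρ : |(1 + τ b * φ r) - (1 + τ b * φ r')| = |φ r - φ r'| := by
      rw [show (1 + τ b * φ r) - (1 + τ b * φ r') = τ b * (φ r - φ r') by ring, abs_mul, hτ1,
        one_mul]
    have hprod : ∀ A B A' B' : ℝ, |A - A'| = |φ r - φ r'| → |A'| ≤ 2 → |B| ≤ 1 →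
        |B - B'| ≤ |r - r'| → |A * B - A' * B'| ≤ |φ r - φ r'| + 2 * |r - r'| := by
      intro A B A' B' h1 h2 h3 h4
      rw [show A * B - A' * B' = (A - A') * B + A' * (B - B') by ring]
      refine (abs_add_le _ _).trans ?_
      rw [abs_mul, abs_mul, h1]
      gcongr
      exact mul_le_of_le_one_right (abs_nonneg _) h3
    have hα := hprod _ (sin r) _ (sin r') hΔρ (hρ hr') (abs_sin_le_one r) (abs_sin_sub_sin_le r r')
    have hβ := hprod _ (cos r) _ (cos r') hΔρ (hρ hr') (abs_cos_le_one r) (abs_cos_sub_cos_le r r')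
    have hαR : |(1 + τ b * φ r) * sin r| ≤ 2 * R := by
      rw [abs_mul]
      refine mul_le_mul (hρ hr) ?_ (abs_nonneg _) zero_le_two
      have h0 : 0 ≤ r := hε.le.trans hr.1
      rw [abs_of_nonneg (sin_nonneg_of_nonneg_of_le_pi h0 (by linarith [hr.2, pi_pos]))]
      exact (sin_le h0).trans hrR
    have hβ2 : |(1 + τ b * φ r) * cos r| ≤ 2 := by
      rw [abs_mul]
      calc _ ≤ 2 * 1 := mul_le_mul (hρ hr) (abs_cos_le_one r) (abs_nonneg _) zero_le_two
        _ = 2 := mul_one 2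
    have hn1 := norm_smul_sub_smul_le ((1 + τ b * φ r) * sin r) ((1 + τ b * φ r') * sin r')
      (u := f i w) (hf1 i w')
    have hn2 := norm_smul_sub_smul_le ((1 + τ b * φ r) * cos r) ((1 + τ b * φ r') * cos r')
      (u := g j v) (hg1 j v')
    have hnorm : dist (Ψ (i, j, b) (w, v, r)) (Ψ (i, j, b) (w', v', r')) ≤ K * ds := by
      rw [dist_eq_norm, hΨ]
      simp only [polarPoint]
      rw [← WithLp.toLp_sub, Prod.mk_sub_mk]
      have hsum : ∀ (u : EuclideanSpace ℝ (Fin (m + 1))) (v : EuclideanSpace ℝ (Fin (k + 1))),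
          ‖(WithLp.toLp 2 (u, v) : EuclideanSum (m + 1) (k + 1))‖ ≤ ‖u‖ + ‖v‖ := by
        intro u v
        rw [WithLp.prod_norm_eq_of_L2]
        refine Real.sqrt_le_iff.2 ⟨by positivity, ?_⟩
        show ‖u‖ ^ 2 + ‖v‖ ^ 2 ≤ _
        nlinarith [mul_nonneg (norm_nonneg u) (norm_nonneg v)]
      refine (hsum _ _).trans ((add_le_add hn1 hn2).trans ?_)
      have h1 : |(1 + τ b * φ r) * sin r| * ‖f i w - f i w'‖ ≤ 2 * L * ds := by
        calc _ ≤ 2 * R * (L * ‖w - w'‖) :=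
              mul_le_mul hαR (hfL i w w') (norm_nonneg _) (by positivity)
          _ = 2 * L * (R * ‖w - w'‖) := by ring
          _ ≤ 2 * L * ds := by gcongr
      have h2 : |(1 + τ b * φ r) * cos r| * ‖g j v - g j v'‖ ≤ 2 * L' * ds := by
        calc _ ≤ 2 * (L' * ‖v - v'‖) := mul_le_mul hβ2 (hgL j v v') (norm_nonneg _) zero_le_two
          _ ≤ 2 * (L' * ds) := by gcongr
          _ = 2 * L' * ds := by ring
      have h3 : (K : ℝ) * ds = 2 * L * ds + 2 * L' * ds + 4 * ds := by
        rw [hK]; push_cast; ring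
      rw [h3]
      linarith [abs_nonneg (φ r - φ r')]
    rw [edist_dist, edist_dist, ← ENNReal.ofReal_coe_nnreal,
      ← ENNReal.ofReal_mul NNReal.zero_le_coe]
    exact ENNReal.ofReal_le_ofReal hnorm
  have hΛS : μH[((m + k + 1 : ℕ) : ℝ)] (Λ '' S) ≤
      ENNReal.ofReal (2 * R) ^ m * (ENNReal.ofReal (2 * 1) ^ k * ENNReal.ofReal (2 * R)) := by
    have hsub : Λ '' S ⊆ Set.pi univ (Sum.elim (fun _ => Icc (-R) R) (Sum.elim
        (fun _ => Icc (-1) 1) (fun _ => Icc 0 (2 * R)))) := by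
      rintro _ ⟨⟨w, v, r⟩, ⟨hw, hv, hr, hrR⟩, rfl⟩
      simp only at hw hv hr hrR
      rintro (l | l | l) -
      · simp only [hΛ, Sum.elim_inl, Pi.smul_apply, smul_eq_mul]
        rw [mem_Icc, ← abs_le, abs_mul, abs_of_pos hR0]
        exact mul_le_of_le_one_right hR0.le ((norm_le_pi_norm w l).trans hw)
      · simp only [hΛ, Sum.elim_inl, Sum.elim_inr]
        rw [mem_Icc, ← abs_le]
        exact (norm_le_pi_norm v l).trans hv
      · simp only [hΛ, Sum.elim_inr]
        obtain ⟨h1, h2, h3⟩ := hφ r hr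
        exact ⟨by linarith [hr.1], by linarith⟩
    have hcard : ((m + k + 1 : ℕ) : ℝ) = (Fintype.card (Fin m ⊕ Fin k ⊕ Unit) : ℝ) := by
      simp [add_assoc]
    refine (measure_mono hsub).trans ?_
    rw [hcard, hausdorffMeasure_pi_real, volume_cube_sum, Fintype.card_fin, Fintype.card_fin]
  refine (measure_mono hcover).trans ((measure_iUnion_le _).trans ?_)
  rw [tsum_fintype]
  refine (Finset.sum_le_sum fun j _ => (hausdorffMeasure_image_le_image (hLip j)
    (Nat.cast_nonneg _)).trans (mul_le_mul_right hΛS _)).trans ?_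
  rw [Finset.sum_const, Finset.card_univ, nsmul_eq_mul, ENNReal.rpow_natCast, mul_one]
  refine le_of_eq ?_
  rw [ENNReal.ofReal_mul zero_le_two, ENNReal.ofReal_pow hR0.le,
    show ENNReal.ofReal 2 = 2 by simp]
  push_cast
  rw [hN]
  ring

/-- The volume of the glued spheres is bounded below: their projection to a hyperplane contains a
fixed cube. -/
theorem exists_volume_lower_bound (m k : ℕ) : ∃ c : ℝ≥0∞, c ≠ 0 ∧ ∀ (a ε : ℝ) (φ : ℝ → ℝ),
    IsProfile m a ε φ → 0 < a → 0 < ε → 2 * a + ε < π / 4 →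
    (∀ r ∈ Icc ε (π / 2), 0 ≤ φ r ∧ φ r < 1) →
    c ≤ μH[((m + k + 1 : ℕ) : ℝ)] (doubleGraph (m + 1) (k + 1) ε φ) := by
  set s : ℝ := 1 / (2 * (m + k + 1)) with hs
  have hs0 : 0 < s := by positivity
  have hs1 : (m + k + 1) * s ^ 2 ≤ 1 / 4 := by
    rw [hs, div_pow, mul_pow, one_pow]
    rw [← mul_div_assoc, mul_one, div_le_div_iff₀ (by positivity) (by norm_num)]
    nlinarith [sq_nonneg ((m : ℝ) + k), (Nat.cast_nonneg m : (0 : ℝ) ≤ m),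
      (Nat.cast_nonneg k : (0 : ℝ) ≤ k)]
  set Q : Set (Fin m ⊕ Fin (k + 1) → ℝ) := Set.pi univ fun _ => Icc (-s) s with hQ
  refine ⟨volume Q, ?_, fun a ε φ h ha hε hπ hφ => ?_⟩
  · rw [hQ, volume_pi_pi]
    simp only [Real.volume_Icc]
    refine Finset.prod_ne_zero_iff.2 fun i _ => ?_
    rw [Ne, ENNReal.ofReal_eq_zero]
    linarith
  set Pr : EuclideanSum (m + 1) (k + 1) → (Fin m ⊕ Fin (k + 1) → ℝ) := fun x =>
    Sum.elim (fun i => x.fst i.succ) (fun j => x.snd j) with hPr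
  have hLip : LipschitzWith 1 Pr := by
    refine LipschitzWith.mk_one fun x y => ?_
    rw [dist_pi_le_iff dist_nonneg]
    rintro (i | j)
    · simp only [hPr, Sum.elim_inl]
      rw [dist_eq_norm, dist_eq_norm, ← PiLp.sub_apply, ← WithLp.sub_fst]
      exact (PiLp.norm_apply_le _ _).trans (WithLp.norm_fst_le (x := x - y))
    · simp only [hPr, Sum.elim_inr]
      rw [dist_eq_norm, dist_eq_norm, ← PiLp.sub_apply, ← WithLp.sub_snd]
      exact (PiLp.norm_apply_le _ _).trans (WithLp.norm_snd_le (x := x - y))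
  obtain ⟨b, hb⟩ := h.eq_const
  have hb0 : 0 ≤ b := by
    rw [← hb (π / 2) ⟨by linarith [pi_pos], le_rfl⟩]
    exact (hφ _ ⟨by linarith [pi_pos], le_rfl⟩).1
  have hsub : Q ⊆ Pr '' doubleGraph (m + 1) (k + 1) ε φ := by
    intro v hv
    set N1 := ∑ i : Fin m, v (Sum.inl i) ^ 2 with hN1
    set N2 := ∑ j : Fin (k + 1), v (Sum.inr j) ^ 2 with hN2
    have hvs : ∀ i, v i ^ 2 ≤ s ^ 2 := fun i =>
      sq_le_sq' (hv i (mem_univ i)).1 (hv i (mem_univ i)).2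
    have h1 : N1 ≤ m * s ^ 2 := by
      refine (Finset.sum_le_sum fun i _ => hvs (Sum.inl i)).trans (le_of_eq ?_)
      simp
    have h2 : N2 ≤ (k + 1) * s ^ 2 := by
      refine (Finset.sum_le_sum fun i _ => hvs (Sum.inr i)).trans (le_of_eq ?_)
      simp
    have h10 : 0 ≤ N1 := Finset.sum_nonneg fun i _ => sq_nonneg _
    have h20 : 0 ≤ N2 := Finset.sum_nonneg fun i _ => sq_nonneg _
    have h12 : N1 + N2 ≤ 1 / 4 := by nlinarith
    have hρ : 1 ≤ (1 + b) ^ 2 := by nlinarith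
    set x : EuclideanSum (m + 1) (k + 1) := WithLp.toLp 2
      (WithLp.toLp 2 (Fin.cons √((1 + b) ^ 2 - N1 - N2) fun i => v (Sum.inl i)),
        WithLp.toLp 2 fun j => v (Sum.inr j)) with hx
    have hx2 : ‖x.snd‖ ^ 2 = N2 := by
      rw [EuclideanSpace.norm_sq_eq]
      simp [hx, hN2]
    have hx1 : ‖x.fst‖ ^ 2 = (1 + b) ^ 2 - N2 := by
      rw [EuclideanSpace.norm_sq_eq, Fin.sum_univ_succ]
      simp only [hx, WithLp.toLp_fst, Fin.cons_zero, Fin.cons_succ, Real.norm_eq_abs, sq_abs]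
      rw [Real.sq_sqrt (by linarith), ← hN1]
      ring
    have hxn : ‖x‖ = 1 + b := by
      have : ‖x‖ ^ 2 = (1 + b) ^ 2 := by
        rw [WithLp.prod_norm_sq_eq_of_L2, hx1, hx2]; ring
      exact (pow_left_inj₀ (norm_nonneg _) (by linarith) two_ne_zero).1 this
    have hxa : 2 * a + ε ≤ polarAngle x := by
      have hcos : cos (polarAngle x) ≤ cos (π / 3) := by
        rw [cos_polarAngle, cos_pi_div_three, hxn, div_le_iff₀ (by linarith)]
        have : ‖x.snd‖ ≤ 1 / 2 := by
          refine (pow_le_pow_iff_left₀ (norm_nonneg _) (by norm_num) two_ne_zero).1 ?_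
          rw [hx2]; linarith
        linarith
      have := (strictAntiOn_cos.le_iff_ge ⟨polarAngle_nonneg x, by
        linarith [polarAngle_le x, pi_pos]⟩ ⟨by positivity, by linarith [pi_pos]⟩).1 hcos
      linarith [pi_pos]
    refine ⟨x, ?_, ?_⟩
    · rw [mem_doubleGraph_iff (Nat.succ_ne_zero m) (Nat.succ_ne_zero k) hε hφ]
      refine ⟨?_, by linarith, ?_⟩
      · rw [← norm_pos_iff, hxn]; linarith
      · rw [hxn, hb _ ⟨hxa, polarAngle_le x⟩, add_sub_cancel_left, abs_of_nonneg hb0]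
    · ext (i | j)
      · simp [hPr, hx]
      · simp [hPr, hx]
  have hcard : ((m + k + 1 : ℕ) : ℝ) = (Fintype.card (Fin m ⊕ Fin (k + 1)) : ℝ) := by
    simp [add_assoc]
  calc volume Q = μH[((m + k + 1 : ℕ) : ℝ)] Q := by rw [hcard, hausdorffMeasure_pi_real]
    _ ≤ μH[((m + k + 1 : ℕ) : ℝ)] (Pr '' doubleGraph (m + 1) (k + 1) ε φ) := measure_mono hsub
    _ ≤ ((1 : ℝ≥0) : ℝ≥0∞) ^ ((m + k + 1 : ℕ) : ℝ) *
        μH[((m + k + 1 : ℕ) : ℝ)] (doubleGraph (m + 1) (k + 1) ε φ) :=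
      hLip.hausdorffMeasure_image_le (Nat.cast_nonneg _) _
    _ = _ := by simp

end Volume

/-! ### The integral of the curvature of the neck -/

/-- If the set where `θ ≤ R` has measure at most `C R^(m+1)`, then `(ε^m/θ^(m+1))^(m+1)`, which is
of size `ε^(-(m+1))` near `θ = ε`, has an integral bounded independently of `ε`: the dyadic shell
`2^j ε ≤ θ ≤ 2^(j+1) ε` contributes at most a multiple of `2^(-j)`. -/
theorem lintegral_neck_le {X : Type*} [MeasurableSpace X] {μ : Measure X} {M : Set X} {θ : X → ℝ}
    {m : ℕ} (hm : m ≠ 0) {ε : ℝ} (hε : 0 < ε) {C : ℝ≥0} (hM : MeasurableSet M)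
    (hθ : Measurable θ) (hεθ : ∀ x ∈ M, ε ≤ θ x)
    (hC : ∀ R, ε ≤ R → μ {x ∈ M | θ x ≤ R} ≤ C * ENNReal.ofReal (R ^ (m + 1))) :
    ∫⁻ x in M, ENNReal.ofReal ((ε ^ m / θ x ^ (m + 1)) ^ (m + 1)) ∂μ ≤ C * 2 ^ (m + 1) * 2 := by
  set S : ℕ → Set X := fun j => M ∩ (θ ⁻¹' Icc (2 ^ j * ε) (2 ^ (j + 1) * ε)) with hS
  have hSm : ∀ j, MeasurableSet (S j) := fun j => hM.inter (hθ measurableSet_Icc)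
  have hcover : M ⊆ ⋃ j, S j := by
    intro x hx
    have h1 : 1 ≤ θ x / ε := (one_le_div hε).2 (hεθ x hx)
    obtain ⟨j, hj1, hj2⟩ := exists_nat_pow_near h1 one_lt_two
    exact mem_iUnion.2 ⟨j, hx, (le_div_iff₀ hε).1 hj1, ((div_lt_iff₀ hε).1 hj2).le⟩
  have hshell : ∀ j, ∫⁻ x in S j, ENNReal.ofReal ((ε ^ m / θ x ^ (m + 1)) ^ (m + 1)) ∂μ ≤
      C * 2 ^ (m + 1) * 2⁻¹ ^ j := by
    intro j
    set T : ℝ := 2 ^ j with hT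
    have hT0 : 0 < T := by positivity
    have hT1 : 1 ≤ T := one_le_pow₀ one_le_two
    have hle : ∀ x ∈ S j, ENNReal.ofReal ((ε ^ m / θ x ^ (m + 1)) ^ (m + 1)) ≤
        ENNReal.ofReal ((ε * T ^ (m + 1))⁻¹ ^ (m + 1)) := by
      rintro x ⟨hx, hx1, -⟩
      have hx0 : 0 < θ x := hε.trans_le (hεθ x hx)
      refine ENNReal.ofReal_le_ofReal (pow_le_pow_left₀ (by positivity) ?_ _)
      calc ε ^ m / θ x ^ (m + 1) ≤ ε ^ m / (T * ε) ^ (m + 1) := by gcongr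
        _ = (ε * T ^ (m + 1))⁻¹ := by
          rw [mul_pow]
          field_simp
          ring
    refine (setLIntegral_mono measurable_const hle).trans ?_
    rw [setLIntegral_const]
    have hμ : μ (S j) ≤ C * ENNReal.ofReal ((2 ^ (j + 1) * ε) ^ (m + 1)) := by
      refine (measure_mono ?_).trans (hC (2 ^ (j + 1) * ε) ?_)
      · rintro x ⟨hx, -, hx2⟩
        exact ⟨hx, hx2⟩
      · exact le_mul_of_one_le_left hε.le (one_le_pow₀ one_le_two)
    refine (mul_le_mul_right hμ _).trans ?_
    rw [mul_left_comm, ← ENNReal.ofReal_mul (by positivity), mul_assoc]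
    refine mul_le_mul_right ?_ _
    have e : (2 : ℝ≥0∞) ^ (m + 1) * 2⁻¹ ^ j = ENNReal.ofReal (2 ^ (m + 1) * 2⁻¹ ^ j) := by
      rw [ENNReal.ofReal_mul (by positivity), ENNReal.ofReal_pow (by positivity),
        ENNReal.ofReal_pow (by positivity), ENNReal.ofReal_inv_of_pos two_pos]
      simp
    rw [e]
    refine ENNReal.ofReal_le_ofReal ?_
    have e2 : (ε * T ^ (m + 1))⁻¹ ^ (m + 1) * (2 ^ (j + 1) * ε) ^ (m + 1) =
        2 ^ (m + 1) * (T⁻¹ ^ m) ^ (m + 1) := by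
      rw [pow_succ 2 j, ← hT, ← mul_pow, ← mul_pow]
      congr 1
      rw [inv_pow]
      field_simp
      ring
    rw [e2, inv_pow 2 j, ← hT, ← pow_mul]
    gcongr
    refine pow_le_of_le_one (by positivity) (inv_le_one_of_one_le₀ hT1) ?_
    positivity
  calc ∫⁻ x in M, ENNReal.ofReal ((ε ^ m / θ x ^ (m + 1)) ^ (m + 1)) ∂μ
      ≤ ∫⁻ x in ⋃ j, S j, ENNReal.ofReal ((ε ^ m / θ x ^ (m + 1)) ^ (m + 1)) ∂μ :=
        lintegral_mono_set hcover
    _ ≤ ∑' j, ∫⁻ x in S j, ENNReal.ofReal ((ε ^ m / θ x ^ (m + 1)) ^ (m + 1)) ∂μ :=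
        lintegral_iUnion_le _ _
    _ ≤ ∑' j : ℕ, (C : ℝ≥0∞) * 2 ^ (m + 1) * 2⁻¹ ^ j := ENNReal.tsum_le_tsum hshell
    _ = C * 2 ^ (m + 1) * 2 := by
        rw [ENNReal.tsum_mul_left, ENNReal.tsum_geometric, ENNReal.one_sub_inv_two, inv_inv]

theorem measurable_polarAngle {p q : ℕ} :
    Measurable (polarAngle : EuclideanSum p q → ℝ) := by
  refine continuous_arccos.measurable.comp (Measurable.div ?_ measurable_norm)
  exact (continuous_norm.comp (continuous_snd.comp (WithLp.prod_continuous_ofLp 2 _ _))).measurable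

/-! ### Existence of profiles -/

section Existence

variable {m : ℕ} {a ε : ℝ}

/-- The slope of the neck function. -/
noncomputable def neckSlope (m : ℕ) (ε r : ℝ) : ℝ := 1 / √((r / ε) ^ (2 * m) - 1)

/-- The slope of the neck function, cut off smoothly between `a + ε` and `2a + ε`. -/
noncomputable def profileSlope (m : ℕ) (a ε r : ℝ) : ℝ :=
  neckSlope m ε r * Real.smoothTransition ((2 * a + ε - r) / a)

/-- A profile: its slope decreases to `0` since that of the neck function and the cutoff both do. -/
noncomputable def standardProfile (m : ℕ) (a ε r : ℝ) : ℝ := ∫ s in ε..r, profileSlope m a ε s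

theorem neckSlope_pos (hm : m ≠ 0) (hε : 0 < ε) {r : ℝ} (hr : ε < r) : 0 < neckSlope m ε r :=
  one_div_pos.2 (Real.sqrt_pos.2 (pow_sub_one_pos hm ((one_lt_div hε).2 hr)))

theorem neckSlope_strictAntiOn (hm : m ≠ 0) (hε : 0 < ε) :
    StrictAntiOn (neckSlope m ε) (Ioi ε) := by
  intro r hr s hs hrs
  have h1 := pow_sub_one_pos hm ((one_lt_div hε).2 hr)
  refine one_div_lt_one_div_of_lt (Real.sqrt_pos.2 h1) (Real.sqrt_lt_sqrt h1.le ?_)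
  have : (r / ε) ^ (2 * m) < (s / ε) ^ (2 * m) :=
    pow_lt_pow_left₀ ((div_lt_div_iff_of_pos_right hε).2 hrs)
      (div_nonneg (hε.le.trans (le_of_lt hr)) hε.le) (by omega)
  linarith

/-- The derivative of the slope `g` is `-(m / r) g (1 + g²)`, which is small wherever `g` is. -/
theorem hasDerivAt_neckSlope (hm : m ≠ 0) (hε : 0 < ε) {r : ℝ} (hr : ε < r) :
    HasDerivAt (neckSlope m ε) (-(m / r * neckSlope m ε r * (1 + neckSlope m ε r ^ 2))) r := by
  have h1 := pow_sub_one_pos hm ((one_lt_div hε).2 hr)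
  have hr0 : 0 < r := hε.trans hr
  have h2 := ((((hasDerivAt_id r).div_const ε).pow (2 * m)).sub_const 1).sqrt h1.ne'
  have hs := Real.sqrt_pos.2 h1
  have h3 := (hasDerivAt_const r (1 : ℝ)).div h2 hs.ne'
  refine h3.congr_deriv ?_
  obtain ⟨l, hl⟩ := Nat.exists_eq_succ_of_ne_zero (show 2 * m ≠ 0 by omega)
  have hcast : (2 * m : ℝ) = l + 1 := by exact_mod_cast hl
  have hsq := Real.sq_sqrt h1.le
  simp only [neckSlope, Pi.pow_apply, id_eq] at *
  set q := √((r / ε) ^ (2 * m) - 1) with hq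
  have h5 : (r / ε) ^ (2 * m - 1) * (r / ε) = q ^ 2 + 1 := by
    rw [hsq, ← pow_succ, show 2 * m - 1 + 1 = 2 * m by omega]; ring
  have h6 : (r / ε) ^ (2 * m - 1) = (q ^ 2 + 1) * ε / r := by
    rw [← h5]; field_simp
  rw [h6]
  push_cast
  field_simp
  ring

theorem contDiffOn_profileSlope (hm : m ≠ 0) (hε : 0 < ε) :
    ContDiffOn ℝ ∞ (profileSlope m a ε) (Ioi ε) := by
  refine ContDiffOn.mul ?_ ?_
  · refine contDiffOn_const.div (ContDiffOn.sqrt (by fun_prop) fun r hr => ?_) fun r hr => ?_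
    · exact (pow_sub_one_pos hm ((one_lt_div hε).2 hr)).ne'
    · exact (Real.sqrt_pos.2 (pow_sub_one_pos hm ((one_lt_div hε).2 hr))).ne'
  · exact (Real.smoothTransition.contDiff.comp
      ((contDiff_const.sub contDiff_id).div_const a)).contDiffOn

theorem intervalIntegrable_profileSlope (hm : m ≠ 0) (hε : 0 < ε) {r : ℝ} (hr : ε ≤ r) :
    IntervalIntegrable (profileSlope m a ε) volume ε r := by
  refine IntervalIntegrable.mul_continuousOn ?_ ?_
  · have h := (intervalIntegrable_neck hm ((one_le_div hε).2 hr)).comp_mul_left (c := ε⁻¹)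
    rw [one_div, inv_inv, div_inv_eq_mul, div_mul_cancel₀ _ hε.ne'] at h
    exact h.congr fun s _ => by simp only [neckSlope, inv_mul_eq_div]
  · exact (Real.smoothTransition.continuous.comp (by fun_prop)).continuousOn

theorem hasDerivAt_standardProfile (hm : m ≠ 0) (hε : 0 < ε) {r : ℝ} (hr : ε < r) :
    HasDerivAt (standardProfile m a ε) (profileSlope m a ε r) r := by
  have hc := (contDiffOn_profileSlope (a := a) hm hε).continuousOn
  exact intervalIntegral.integral_hasDerivAt_right (intervalIntegrable_profileSlope hm hε hr.le)
    (hc.stronglyMeasurableAtFilter isOpen_Ioi r hr)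
    (hc.continuousAt (Ioi_mem_nhds hr))

theorem contDiffOn_standardProfile (hm : m ≠ 0) (hε : 0 < ε) :
    ContDiffOn ℝ ∞ (standardProfile m a ε) (Ioi ε) := by
  rw [contDiffOn_infty_iff_deriv_of_isOpen isOpen_Ioi]
  refine ⟨fun r hr => (hasDerivAt_standardProfile hm hε hr).differentiableAt.differentiableWithinAt,
    (contDiffOn_profileSlope (a := a) hm hε).congr fun r hr => ?_⟩
  exact (hasDerivAt_standardProfile hm hε hr).deriv

theorem isProfile_standardProfile (hm : m ≠ 0) (ha : 0 < a) (hε : 0 < ε) :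
    IsProfile m a ε (standardProfile m a ε) where
  eq_neck r hr := by
    have h1 : standardProfile m a ε r = ∫ s in ε..r, neckSlope m ε s := by
      refine intervalIntegral.integral_congr fun s hs => ?_
      rw [uIcc_of_le hr.1] at hs
      simp only [profileSlope]
      rw [Real.smoothTransition.one_of_one_le, mul_one]
      rw [one_le_div ha]
      linarith [hs.2, hr.2]
    rw [h1, neckFunction]
    have h2 := intervalIntegral.integral_comp_div (a := ε) (b := r)
      (fun t => 1 / √(t ^ (2 * m) - 1)) hε.ne'
    rw [div_self hε.ne', smul_eq_mul] at h2
    exact h2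
  eq_const := by
    refine ⟨standardProfile m a ε (2 * a + ε), fun r hr => ?_⟩
    have h1 := intervalIntegral.integral_interval_sub_left
      (intervalIntegrable_profileSlope (a := a) hm hε (r := r) (by linarith [hr.1]))
      (intervalIntegrable_profileSlope (a := a) hm hε (r := 2 * a + ε) (by linarith))
    have h2 : ∫ s in (2 * a + ε)..r, profileSlope m a ε s = 0 := by
      rw [intervalIntegral.integral_congr (g := fun _ => 0), intervalIntegral.integral_zero]
      intro s hs
      rw [uIcc_of_le hr.1] at hs
      simp only [profileSlope]
      rw [Real.smoothTransition.zero_of_nonpos, mul_zero]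
      exact div_nonpos_of_nonpos_of_nonneg (by linarith [hs.1]) ha.le
    rw [h2] at h1
    exact sub_eq_zero.1 h1
  smooth := (contDiffOn_standardProfile hm hε).mono Ioc_subset_Ioi_self
  concave := by
    refine StrictAntiOn.strictConcaveOn_of_deriv (convex_Ioc _ _)
      ((contDiffOn_standardProfile hm hε).continuousOn.mono Ioc_subset_Ioi_self) ?_
    rw [interior_Ioc]
    intro r hr s hs hrs
    rw [(hasDerivAt_standardProfile hm hε hr.1).deriv,
      (hasDerivAt_standardProfile hm hε hs.1).deriv]
    refine mul_lt_mul (neckSlope_strictAntiOn hm hε hr.1 hs.1 hrs)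
      (Real.smoothTransition.monotone ?_) ?_ (neckSlope_pos hm hε hr.1).le
    · gcongr
    · exact Real.smoothTransition.pos_of_pos (div_pos (by linarith [hs.2]) ha)

theorem exists_abs_deriv_smoothTransition_le :
    ∃ L, 0 ≤ L ∧ ∀ x, |deriv Real.smoothTransition x| ≤ L := by
  have hc : Continuous (deriv Real.smoothTransition) :=
    (Real.smoothTransition.contDiff (n := 1)).continuous_deriv le_rfl
  obtain ⟨L, hL⟩ := (isCompact_Icc (a := (0 : ℝ)) (b := 1)).exists_bound_of_continuousOn
    hc.continuousOn
  have hL0 : 0 ≤ L := (norm_nonneg _).trans (hL 0 (by simp))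
  refine ⟨L, hL0, fun x => ?_⟩
  by_cases hx : x ∈ Icc (0 : ℝ) 1
  · exact hL x hx
  · have : deriv Real.smoothTransition x = 0 := by
      rw [mem_Icc, not_and_or, not_le, not_le] at hx
      rcases hx with hx | hx
      · have : Real.smoothTransition =ᶠ[𝓝 x] fun _ => 0 := by
          filter_upwards [Iio_mem_nhds hx] with y hy
          exact Real.smoothTransition.zero_of_nonpos (le_of_lt hy)
        rw [this.deriv_eq, deriv_const]
      · have : Real.smoothTransition =ᶠ[𝓝 x] fun _ => 1 := by
          filter_upwards [Ioi_mem_nhds hx] with y hy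
          exact Real.smoothTransition.one_of_one_le (le_of_lt hy)
        rw [this.deriv_eq, deriv_const]
    rw [this, abs_zero]
    exact hL0

theorem neckSlope_le (hm : m ≠ 0) (hε : 0 < ε) {δ r : ℝ} (hδ : 2 * ε ≤ δ) (hr : δ ≤ r) :
    neckSlope m ε r ≤ 2 * ε / δ := by
  have h1 : 2 ≤ δ / ε := (le_div_iff₀ hε).2 hδ
  have hδ0 : 0 < δ := by linarith
  have h2 : δ / ε ≤ r / ε := by gcongr
  have h3 : (r / ε) ^ 2 ≤ (r / ε) ^ (2 * m) := pow_le_pow_right₀ (by linarith) (by omega)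
  have h4 : (δ / ε / 2) ^ 2 ≤ (r / ε) ^ (2 * m) - 1 := by nlinarith
  have h5 : δ / ε / 2 ≤ √((r / ε) ^ (2 * m) - 1) := Real.le_sqrt_of_sq_le h4
  calc neckSlope m ε r ≤ 1 / (δ / ε / 2) := one_div_le_one_div_of_le (by linarith) h5
    _ = 2 * ε / δ := by field_simp

/-- The second derivative of the standard profile at `r ≥ δ` is of order `ε`, because both the slope
of the neck function and its derivative are. -/
theorem exists_isProfileFamily (hm : m ≠ 0) (ha : 0 < a) :
    ∃ φ : ℝ → ℝ → ℝ, IsProfileFamily m a φ := by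
  refine ⟨standardProfile m a, ?_, fun K hK hKc => ?_⟩
  · filter_upwards [self_mem_nhdsWithin] with ε hε
    exact isProfile_standardProfile hm ha hε
  obtain ⟨L, hL0, hL⟩ := exists_abs_deriv_smoothTransition_le
  rcases K.eq_empty_or_nonempty with rfl | hne
  · exact tendstoUniformlyOn_empty
  obtain ⟨δ, hδK, hδ⟩ := hKc.exists_isLeast hne
  have hδ0 : 0 < δ := (hK hδK).1
  set B : ℝ := m / δ * 2 + L / a with hB
  have hB0 : 0 ≤ B := by positivity
  rw [Metric.tendstoUniformlyOn_iff]
  intro η hη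
  have hlim : Tendsto (fun ε : ℝ => 2 * ε / δ * B) (𝓝[>] 0) (𝓝 0) := by
    have : Continuous fun ε : ℝ => 2 * ε / δ * B := by fun_prop
    simpa using (this.tendsto 0).mono_left nhdsWithin_le_nhds
  filter_upwards [self_mem_nhdsWithin, hlim (Iio_mem_nhds hη),
    nhdsWithin_le_nhds (Iio_mem_nhds (half_pos hδ0))] with ε hε hεη hεδ r hr
  simp only [mem_Ioi, mem_preimage, mem_Iio] at hε hεη hεδ
  have hδr : δ ≤ r := hδ hr
  have hεr : ε < r := by linarith
  have hd : iteratedDerivWithin 2 (standardProfile m a ε) (Ioc ε (π / 2)) r =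
      deriv (profileSlope m a ε) r := by
    rw [iteratedDerivWithin_eq_iteratedDeriv (uniqueDiffOn_Ioc _ _)
      (((contDiffOn_standardProfile hm hε).contDiffAt (Ioi_mem_nhds hεr)).of_le
        ENat.LEInfty.out) ⟨hεr, (hK hr).2⟩, iteratedDeriv_succ, iteratedDeriv_one]
    refine EventuallyEq.deriv_eq ?_
    filter_upwards [Ioi_mem_nhds hεr] with s hs
    exact (hasDerivAt_standardProfile hm hε hs).deriv
  have hχ : HasDerivAt (fun s => Real.smoothTransition ((2 * a + ε - s) / a))
      (deriv Real.smoothTransition ((2 * a + ε - r) / a) * (-1 / a)) r := by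
    refine HasDerivAt.comp r (h₂ := Real.smoothTransition)
      ((Real.smoothTransition.contDiff (n := 1)).differentiable one_ne_zero _).hasDerivAt ?_
    exact ((hasDerivAt_id r).const_sub (2 * a + ε)).div_const a
  have hd2 : deriv (profileSlope m a ε) r = _ := ((hasDerivAt_neckSlope hm hε hεr).mul hχ).deriv
  rw [hd, hd2, Pi.zero_apply, dist_zero_left, Real.norm_eq_abs]
  refine lt_of_le_of_lt ?_ hεη
  set g := neckSlope m ε r with hg
  have hg0 : 0 < g := neckSlope_pos hm hε hεr
  have hg1 : g ≤ 2 * ε / δ := neckSlope_le hm hε (by linarith) hδr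
  have hg2 : g ≤ 1 := hg1.trans ((div_le_one hδ0).2 (by linarith))
  have hg3 : 1 + g ^ 2 ≤ 2 := by nlinarith
  set χ := Real.smoothTransition ((2 * a + ε - r) / a)
  have hχ0 : 0 ≤ χ := Real.smoothTransition.nonneg _
  have hχ1 : χ ≤ 1 := Real.smoothTransition.le_one _
  have t1 : |-(m / r * g * (1 + g ^ 2)) * χ| ≤ g * (m / δ * 2) := by
    rw [neg_mul, abs_neg, abs_of_nonneg (by have := hε.trans hεr; positivity)]
    calc m / r * g * (1 + g ^ 2) * χ ≤ m / δ * g * 2 * 1 := by gcongr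
      _ = g * (m / δ * 2) := by ring
  have t2 : |g * (deriv Real.smoothTransition ((2 * a + ε - r) / a) * (-1 / a))| ≤ g * (L / a) := by
    rw [abs_mul, abs_mul, abs_of_pos hg0, abs_div, abs_neg, abs_one, abs_of_pos ha]
    rw [mul_one_div]
    gcongr
    exact hL _
  calc _ ≤ g * (m / δ * 2) + g * (L / a) := (abs_add_le _ _).trans (add_le_add t1 t2)
    _ = g * B := by rw [hB]; ring
    _ ≤ 2 * ε / δ * B := by gcongr

end Existence

/-! ### Families of profiles -/

section Family

variable {m k : ℕ} {a : ℝ}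

theorem IsProfile.le_self {ε : ℝ} {φ : ℝ → ℝ} (h : IsProfile m a ε φ) (hm : m ≠ 0)
    (hε : 0 < ε) (hφ : ∀ r ∈ Icc ε (π / 2), φ r ≤ a) {r : ℝ} (hr : r ∈ Icc ε (π / 2)) :
    φ r ≤ r := by
  rcases le_total r (a + ε) with hra | hra
  · rw [h.eq_neck r ⟨hr.1, hra⟩, neckFunction_eq]
    calc ε * neckHeight m (r / ε) ≤ ε * (r / ε) := by
          gcongr
          exact neckHeight_le_self hm ((one_le_div hε).2 hr.1)
      _ = r := by field_simp
  · linarith [hφ r hr]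

namespace IsProfileFamily

variable {φ : ℝ → ℝ → ℝ}

theorem eventually_isProfile (h : IsProfileFamily m a φ) (ha' : 2 * a < π / 4) {δ : ℝ}
    (hδ : 0 < δ) : ∀ᶠ ε in 𝓝[>] (0 : ℝ),
      IsProfile m a ε (φ ε) ∧ 0 < ε ∧ 2 * a + ε < π / 4 ∧ ε < δ := by
  filter_upwards [h.profile, self_mem_nhdsWithin,
    nhdsWithin_le_nhds (Iio_mem_nhds (sub_pos.2 ha')),
    nhdsWithin_le_nhds (Iio_mem_nhds hδ)] with ε h1 h2 h3 h4
  simp only [mem_Iio] at h3 h4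
  exact ⟨h1, h2, by linarith, h4⟩

theorem eventually_le (h : IsProfileFamily m a φ) (hm : m ≠ 0) (ha : 0 < a)
    (ha' : 2 * a < π / 4) {η : ℝ} (hη : 0 < η) :
    ∀ᶠ ε in 𝓝[>] (0 : ℝ), ∀ r ∈ Icc ε (π / 2), 0 ≤ φ ε r ∧ φ ε r ≤ η := by
  have hlim : Tendsto (fun ε : ℝ => 3 * √(2 * ε * (a + ε))) (𝓝[>] 0) (𝓝 0) := by
    have : Continuous fun ε : ℝ => 3 * √(2 * ε * (a + ε)) := by fun_prop
    simpa using (this.tendsto 0).mono_left nhdsWithin_le_nhds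
  filter_upwards [h.eventually_isProfile ha' one_pos, hlim (Iio_mem_nhds hη)]
    with ε ⟨h1, h2, h3, _⟩ h4 r hr
  have hπ : 2 * a + ε < π / 2 := by linarith [pi_pos]
  simp only [mem_preimage, mem_Iio] at h4
  exact ⟨h1.nonneg hm ha h2 hπ hr, (h1.le_sup hm ha h2 hπ hr).trans h4.le⟩

theorem eventually_abs_deriv_le (h : IsProfileFamily m a φ) (hm : m ≠ 0) (ha : 0 < a)
    (ha' : 2 * a < π / 4) {η δ : ℝ} (hη : 0 < η) (hδ : 0 < δ) :
    ∀ᶠ ε in 𝓝[>] (0 : ℝ), ∀ r ∈ Ico δ (π / 2), |deriv (φ ε) r| ≤ η := by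
  filter_upwards [h.eventually_isProfile ha' (half_pos hδ),
    h.eventually_le hm ha ha' (show 0 < η * (δ / 2) by positivity)] with ε ⟨h1, h2, h3, h4⟩ h5 r hr
  have hπ : 2 * a + ε < π / 2 := by linarith [pi_pos]
  rw [abs_of_nonneg (h1.deriv_nonneg ha hπ ⟨by linarith [hr.1], hr.2⟩)]
  calc deriv (φ ε) r ≤ 2 / δ * φ ε r := h1.deriv_le hm ha h2 hπ h4 hr
    _ ≤ 2 / δ * (η * (δ / 2)) := by
        gcongr
        exact (h5 r ⟨by linarith [hr.1], hr.2.le⟩).2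
    _ = η := by field_simp

theorem eventually_abs_deriv_deriv_le (h : IsProfileFamily m a φ) {η δ : ℝ} (hη : 0 < η)
    (hδ : 0 < δ) :
    ∀ᶠ ε in 𝓝[>] (0 : ℝ), ∀ r ∈ Ico δ (π / 2), |deriv (deriv (φ ε)) r| ≤ η := by
  have h1 := Metric.tendstoUniformlyOn_iff.1
    (h.deriv2 (Icc δ (π / 2)) (fun r hr => ⟨hδ.trans_le hr.1, hr.2⟩) isCompact_Icc) η hη
  filter_upwards [h.profile, h1, nhdsWithin_le_nhds (Iio_mem_nhds hδ)] with ε h2 h3 h4 r hr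
  have hr2 : r ∈ Ioo ε (π / 2) := ⟨lt_of_lt_of_le h4 hr.1, hr.2⟩
  have h5 := h3 r ⟨hr.1, hr.2.le⟩
  rw [iteratedDerivWithin_eq_iteratedDeriv (uniqueDiffOn_Ioc _ _)
    ((h2.contDiffAt hr2).of_le ENat.LEInfty.out) ⟨hr2.1, hr2.2.le⟩, iteratedDeriv_succ,
    iteratedDeriv_one, Pi.zero_apply, dist_zero_left, Real.norm_eq_abs] at h5
  exact h5.le

/-- Curvature estimates for small `ε`: away from the neck the hypersurface is `C^2`-close to the
unit sphere, and near the neck it is a rotated catenoid. -/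
theorem eventually_curvature (h : IsProfileFamily m a φ) (hm : m ≠ 0) (ha : 0 < a)
    (ha' : 2 * a < π / 4) {η δ : ℝ} (hη : 0 < η) (hδ : 0 < δ) (hδ1 : δ ≤ 1) (hδa : δ ≤ a) :
    ∀ᶠ ε in 𝓝[>] (0 : ℝ), ∀ x ∈ doubleGraph (m + 1) (k + 1) ε (φ ε),
      (δ ≤ polarAngle x → |meanCurvature (doubleGraph (m + 1) (k + 1) ε (φ ε)) x - 1| ≤ η ∧
        secondFundamentalNorm (doubleGraph (m + 1) (k + 1) ε (φ ε)) x ≤ 3 * (1 + η)) ∧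
      (polarAngle x ≤ δ → |meanCurvature (doubleGraph (m + 1) (k + 1) ε (φ ε)) x| ≤ 9 ∧
        secondFundamentalNorm (doubleGraph (m + 1) (k + 1) ε (φ ε)) x ≤
          10 + (12 * m + 4) * (ε ^ m / polarAngle x ^ (m + 1))) := by
  obtain ⟨η', hη', hη2, hout⟩ := exists_outer_estimate hm hη
  filter_upwards [h.eventually_isProfile ha' hδ, h.eventually_le hm ha ha' hη',
    h.eventually_abs_deriv_le hm ha ha' (mul_pos hη' hδ) hδ,
    h.eventually_abs_deriv_deriv_le hη' hδ] with ε ⟨h1, h2, h3, h4⟩ h5 h6 h7 x hx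
  refine ⟨fun hxδ => ?_, fun hxδ => ?_⟩
  · exact hout k a ε δ (φ ε) h1 ha h2 h3 h4 hδ1 (fun r hr => (h5 r hr).2) h6 h7 x hx hxδ
  · exact neck_estimate hm h1 ha h2 h3 (fun r hr => (h5 r hr).2.trans hη2) hx (by linarith)

/-- For small `ε` the hypersurface is compact and smooth, close to the unit sphere, and its volume
is bounded above and below, with little volume near the neck. -/
theorem exists_eventually_geometry (h : IsProfileFamily m a φ) (hm : m ≠ 0) (ha : 0 < a)
    (ha' : 2 * a < π / 4) : ∃ (C : ℝ≥0) (c : ℝ≥0∞), c ≠ 0 ∧ ∀ᶠ ε in 𝓝[>] (0 : ℝ),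
      0 < ε ∧ IsCompact (doubleGraph (m + 1) (k + 1) ε (φ ε)) ∧
      IsSmoothHypersurface (doubleGraph (m + 1) (k + 1) ε (φ ε)) ∧
      (∀ x ∈ doubleGraph (m + 1) (k + 1) ε (φ ε), ε ≤ polarAngle x) ∧
      c ≤ μH[((m + k + 1 : ℕ) : ℝ)] (doubleGraph (m + 1) (k + 1) ε (φ ε)) ∧
      ∀ R, ε ≤ R → μH[((m + k + 1 : ℕ) : ℝ)]
        {x ∈ doubleGraph (m + 1) (k + 1) ε (φ ε) | polarAngle x ≤ R} ≤
          C * ENNReal.ofReal (R ^ (m + 1)) := by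
  obtain ⟨C, hC⟩ := exists_volume_bound m k
  obtain ⟨c, hc0, hc⟩ := exists_volume_lower_bound m k
  refine ⟨C, c, hc0, ?_⟩
  filter_upwards [h.eventually_isProfile ha' one_pos,
    h.eventually_le hm ha ha' (lt_min ha one_half_pos)] with ε ⟨h1, h2, h3, _⟩ h4
  have hπ : 2 * a + ε < π / 2 := by linarith [pi_pos]
  have hφ1 : ∀ r ∈ Icc ε (π / 2), 0 ≤ φ ε r ∧ φ ε r < 1 := fun r hr =>
    ⟨(h4 r hr).1, by linarith [(h4 r hr).2, min_le_right a (1 / 2)]⟩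
  have hφa : ∀ r ∈ Icc ε (π / 2), φ ε r ≤ a := fun r hr => (h4 r hr).2.trans (min_le_left _ _)
  refine ⟨h2, isCompact_doubleGraph (h1.continuousOn hm ha h2),
    isSmoothHypersurface_doubleGraph (Nat.succ_ne_zero m) (Nat.succ_ne_zero k) h1 hm ha h2 hπ
      fun r hr => (hφ1 r hr).2, fun x hx => ?_, hc a ε (φ ε) h1 ha h2 h3 hφ1,
    hC ε (φ ε) h2 (h1.monotoneOn hm ha h2 hπ) fun r hr =>
      ⟨(hφ1 r hr).1, (hφ1 r hr).2, h1.le_self hm h2 hφa hr⟩⟩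
  exact ((mem_doubleGraph_iff (Nat.succ_ne_zero m) (Nat.succ_ne_zero k) h2 hφ1).1 hx).2.1

theorem eventually_abs_norm_sub_one_le (h : IsProfileFamily m a φ) (hm : m ≠ 0) (ha : 0 < a)
    (ha' : 2 * a < π / 4) {η : ℝ} (hη : 0 < η) :
    ∀ᶠ ε in 𝓝[>] (0 : ℝ), ∀ x ∈ doubleGraph (m + 1) (k + 1) ε (φ ε), |‖x‖ - 1| ≤ η := by
  filter_upwards [h.eventually_isProfile ha' one_pos,
    h.eventually_le hm ha ha' (lt_min hη one_half_pos)] with ε ⟨h1, h2, h3, _⟩ h4 x hx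
  have hφ1 : ∀ r ∈ Icc ε (π / 2), 0 ≤ φ ε r ∧ φ ε r < 1 := fun r hr =>
    ⟨(h4 r hr).1, by linarith [(h4 r hr).2, min_le_right η (1 / 2)]⟩
  obtain ⟨-, hr, habs⟩ :=
    (mem_doubleGraph_iff (Nat.succ_ne_zero m) (Nat.succ_ne_zero k) h2 hφ1).1 hx
  rw [habs]
  exact (h4 _ ⟨hr, polarAngle_le x⟩).2.trans (min_le_left _ _)

end IsProfileFamily

end Family

/-! ### Normalized norms -/

section Norms

variable {E : Type*} [NormedAddCommGroup E] [MeasurableSpace E] [BorelSpace E] {n : ℕ} {M : Set E}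
  {f : E → ℝ}

theorem hypersurfaceNorm_top_le (hM : MeasurableSet M) {b : ℝ} (hf : ∀ x ∈ M, |f x| ≤ b) :
    hypersurfaceNorm n M ∞ f ≤ ENNReal.ofReal b := by
  rw [hypersurfaceNorm, eLpNorm_exponent_top]
  exact eLpNormEssSup_le_of_ae_bound
    (Measure.ae_smul_measure (ae_restrict_of_forall_mem hM hf) _)

/-- A function that is at most `s` on a part `A` and at most `t` on a part `B` has normalized
`1`-norm at most `s + t Vol(B) / Vol(M)`. -/
theorem hypersurfaceNorm_one_le {A B : Set E} {s t : ℝ} {c : ℝ≥0∞} (hMAB : M ⊆ A ∪ B)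
    (hA : A ⊆ M) (hc : c ≤ μH[(n : ℝ)] M) (hfA : ∀ x ∈ A, |f x| ≤ s) (hfB : ∀ x ∈ B, |f x| ≤ t) :
    hypersurfaceNorm n M 1 f ≤
      ENNReal.ofReal s + c⁻¹ * (ENNReal.ofReal t * μH[(n : ℝ)] B) := by
  have key : ∀ (S : Set E) (b : ℝ), (∀ x ∈ S, |f x| ≤ b) →
      ∫⁻ x in S, ‖f x‖ₑ ∂μH[(n : ℝ)] ≤ ENNReal.ofReal b * μH[(n : ℝ)] S := by
    intro S b hS
    rw [← setLIntegral_const]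
    refine setLIntegral_mono measurable_const fun x hx => ?_
    rw [Real.enorm_eq_ofReal_abs]
    exact ENNReal.ofReal_le_ofReal (hS x hx)
  rw [hypersurfaceNorm, eLpNorm_one_eq_lintegral_enorm, lintegral_smul_measure, smul_eq_mul]
  set V := μH[(n : ℝ)] M
  calc V⁻¹ * ∫⁻ x in M, ‖f x‖ₑ ∂μH[(n : ℝ)]
      ≤ V⁻¹ * (ENNReal.ofReal s * V + ENNReal.ofReal t * μH[(n : ℝ)] B) := by
        gcongr
        refine (lintegral_mono_set hMAB).trans ((lintegral_union_le _ _ _).trans ?_)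
        refine add_le_add ((key A s hfA).trans ?_) (key B t hfB)
        exact mul_le_mul_right (measure_mono hA) _
    _ = ENNReal.ofReal s * (V / V) + V⁻¹ * (ENNReal.ofReal t * μH[(n : ℝ)] B) := by
        rw [mul_add, mul_left_comm, ← ENNReal.div_eq_inv_mul]
    _ ≤ ENNReal.ofReal s * 1 + c⁻¹ * (ENNReal.ofReal t * μH[(n : ℝ)] B) := by
        gcongr
        exact ENNReal.div_self_le_one
    _ = _ := by rw [mul_one]

/-- A bound for the normalized `p`-norm of a function dominated by `1 + g`, from a bound for the
integral of `g^p` and a lower bound for the volume. -/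
theorem hypersurfaceNorm_natCast_le {p : ℕ} (hp : p ≠ 0) {K : ℝ} (hK : 0 ≤ K) {g : E → ℝ}
    {c D : ℝ≥0∞} (hg : Measurable g) (hg0 : ∀ x ∈ M, 0 ≤ g x)
    (hc : c ≤ μH[(n : ℝ)] M) (hf : ∀ x ∈ M, |f x| ≤ K * (1 + g x))
    (hD : ∫⁻ x in M, ENNReal.ofReal (g x ^ p) ∂μH[(n : ℝ)] ≤ D) :
    hypersurfaceNorm n M p f ≤
      (ENNReal.ofReal (K ^ p * 2 ^ (p - 1)) * (1 + c⁻¹ * D)) ^ (1 / (p : ℝ)) := by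
  rw [hypersurfaceNorm, eLpNorm_eq_lintegral_rpow_enorm_toReal (by exact_mod_cast hp)
    (ENNReal.natCast_ne_top p), ENNReal.toReal_natCast]
  refine ENNReal.rpow_le_rpow ?_ (by positivity)
  rw [lintegral_smul_measure, smul_eq_mul]
  set V := μH[(n : ℝ)] M
  have hpt : ∀ x ∈ M, ‖f x‖ₑ ^ (p : ℝ) ≤
      ENNReal.ofReal (K ^ p * 2 ^ (p - 1)) * (1 + ENNReal.ofReal (g x ^ p)) := by
    intro x hx
    have hgx := hg0 x hx
    rw [ENNReal.rpow_natCast, Real.enorm_eq_ofReal_abs, ← ENNReal.ofReal_pow (abs_nonneg _),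
      ← ENNReal.ofReal_one, ← ENNReal.ofReal_add zero_le_one (by positivity),
      ← ENNReal.ofReal_mul (by positivity)]
    refine ENNReal.ofReal_le_ofReal ?_
    calc |f x| ^ p ≤ (K * (1 + g x)) ^ p := by
          gcongr
          exact hf x hx
      _ = K ^ p * (1 + g x) ^ p := mul_pow _ _ _
      _ ≤ K ^ p * (2 ^ (p - 1) * (1 ^ p + g x ^ p)) := by
          gcongr
          exact add_pow_le zero_le_one hgx p
      _ = K ^ p * 2 ^ (p - 1) * (1 + g x ^ p) := by rw [one_pow]; ring
  calc V⁻¹ * ∫⁻ x in M, ‖f x‖ₑ ^ (p : ℝ) ∂μH[(n : ℝ)]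
      ≤ V⁻¹ * ∫⁻ x in M, ENNReal.ofReal (K ^ p * 2 ^ (p - 1)) *
          (1 + ENNReal.ofReal (g x ^ p)) ∂μH[(n : ℝ)] := by
        gcongr V⁻¹ * ?_
        exact setLIntegral_mono (by fun_prop) hpt
    _ = ENNReal.ofReal (K ^ p * 2 ^ (p - 1)) *
        (V / V + V⁻¹ * ∫⁻ x in M, ENNReal.ofReal (g x ^ p) ∂μH[(n : ℝ)]) := by
        rw [lintegral_const_mul _ (by fun_prop), lintegral_add_left measurable_const,
          setLIntegral_const, one_mul, mul_left_comm, mul_add, ← ENNReal.div_eq_inv_mul]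
    _ ≤ ENNReal.ofReal (K ^ p * 2 ^ (p - 1)) * (1 + c⁻¹ * D) := by
        gcongr
        exact ENNReal.div_self_le_one

end Norms

/-! ### Norms of the curvature of the glued spheres -/

section Main

variable {m k : ℕ} {a : ℝ} {φ : ℝ → ℝ → ℝ}

namespace IsProfileFamily

theorem exists_meanCurvature_top_le (h : IsProfileFamily m a φ) (hm : m ≠ 0) (ha : 0 < a)
    (ha' : 2 * a < π / 4) : ∃ C : ℝ≥0, ∀ᶠ ε in 𝓝[>] (0 : ℝ),
      hypersurfaceNorm (m + k + 1) (doubleGraph (m + 1) (k + 1) ε (φ ε)) ∞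
        (meanCurvature (doubleGraph (m + 1) (k + 1) ε (φ ε))) ≤ C := by
  obtain ⟨C, c, -, hgeo⟩ := h.exists_eventually_geometry (k := k) hm ha ha'
  refine ⟨Real.toNNReal 9, ?_⟩
  filter_upwards [hgeo, h.eventually_curvature (k := k) hm ha ha' one_pos (lt_min ha one_pos)
    (min_le_right _ _) (min_le_left _ _)] with ε ⟨_, hM, _⟩ hcurv
  refine hypersurfaceNorm_top_le hM.measurableSet fun x hx => ?_
  rcases le_total (min a 1) (polarAngle x) with hxδ | hxδ
  · have := ((hcurv x hx).1 hxδ).1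
    rw [abs_le] at this ⊢
    constructor <;> linarith
  · exact ((hcurv x hx).2 hxδ).1

theorem exists_secondFundamentalNorm_le (h : IsProfileFamily m a φ) (hm : m ≠ 0) (ha : 0 < a)
    (ha' : 2 * a < π / 4) : ∃ C : ℝ≥0, ∀ᶠ ε in 𝓝[>] (0 : ℝ),
      hypersurfaceNorm (m + k + 1) (doubleGraph (m + 1) (k + 1) ε (φ ε)) ((m + 1 : ℕ) : ℝ≥0∞)
        (secondFundamentalNorm (doubleGraph (m + 1) (k + 1) ε (φ ε))) ≤ C := by
  obtain ⟨C, c, hc0, hgeo⟩ := h.exists_eventually_geometry (k := k) hm ha ha'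
  set D : ℝ≥0∞ := (ENNReal.ofReal ((12 * m + 10) ^ (m + 1) * 2 ^ (m + 1 - 1)) *
    (1 + c⁻¹ * (C * 2 ^ (m + 1) * 2))) ^ (1 / ((m + 1 : ℕ) : ℝ)) with hD
  have hDtop : D ≠ ⊤ := by
    have : c⁻¹ ≠ ⊤ := ENNReal.inv_ne_top.2 hc0
    refine ENNReal.rpow_ne_top_of_nonneg (by positivity) ?_
    finiteness
  refine ⟨D.toNNReal, ?_⟩
  rw [ENNReal.coe_toNNReal hDtop]
  filter_upwards [hgeo, h.eventually_curvature (k := k) hm ha ha' one_pos (lt_min ha one_pos)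
    (min_le_right _ _) (min_le_left _ _)] with ε ⟨hε, hM, _, hεθ, hcV, hV⟩ hcurv
  have hg0 : ∀ x ∈ doubleGraph (m + 1) (k + 1) ε (φ ε), 0 ≤ ε ^ m / polarAngle x ^ (m + 1) :=
    fun x hx => div_nonneg (by positivity) (pow_nonneg (polarAngle_nonneg x) _)
  refine hypersurfaceNorm_natCast_le (g := fun x => ε ^ m / polarAngle x ^ (m + 1))
    (Nat.succ_ne_zero m) (by positivity)
    (measurable_const.div (measurable_polarAngle.pow_const _)) hg0 hcV (fun x hx => ?_)
    (lintegral_neck_le hm hε hM.measurableSet measurable_polarAngle hεθ hV)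
  rw [abs_of_nonneg (by unfold secondFundamentalNorm; positivity)]
  have hg := hg0 x hx
  have hm0 : (0 : ℝ) ≤ m := Nat.cast_nonneg m
  rcases le_total (min a 1) (polarAngle x) with hxδ | hxδ
  · refine ((hcurv x hx).1 hxδ).2.trans ?_
    nlinarith [mul_nonneg hm0 hg]
  · refine ((hcurv x hx).2 hxδ).2.trans ?_
    nlinarith [mul_nonneg hm0 hg]

theorem tendsto_meanCurvature_sub_one (h : IsProfileFamily m a φ) (hm : m ≠ 0) (ha : 0 < a)
    (ha' : 2 * a < π / 4) :
    Tendsto (fun ε => hypersurfaceNorm (m + k + 1) (doubleGraph (m + 1) (k + 1) ε (φ ε)) 1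
      (fun x => meanCurvature (doubleGraph (m + 1) (k + 1) ε (φ ε)) x - 1)) (𝓝[>] 0) (𝓝 0) := by
  obtain ⟨C, c, hc0, hgeo⟩ := h.exists_eventually_geometry (k := k) hm ha ha'
  rw [ENNReal.tendsto_nhds_zero]
  intro e he
  -- `F t` bounds the norm when the neck region is cut off at angle `t`.
  set F : ℝ → ℝ≥0∞ := fun t => ENNReal.ofReal t +
    c⁻¹ * (ENNReal.ofReal 10 * (C * ENNReal.ofReal (t ^ (m + 1)))) with hF
  have hFlim : Tendsto F (𝓝[>] 0) (𝓝 0) := by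
    have hc1 : c⁻¹ ≠ ⊤ := ENNReal.inv_ne_top.2 hc0
    have hcont : Continuous F := by
      refine ENNReal.continuous_ofReal.add ((ENNReal.continuous_const_mul hc1).comp
        ((ENNReal.continuous_const_mul ENNReal.ofReal_ne_top).comp
        ((ENNReal.continuous_const_mul ENNReal.coe_ne_top).comp
        (ENNReal.continuous_ofReal.comp (continuous_pow (m + 1))))))
    have := (hcont.tendsto 0).mono_left (nhdsWithin_le_nhds (s := Ioi 0))
    simpa [hF] using this
  obtain ⟨t, ⟨ht, hta⟩, ht0⟩ := (((ENNReal.tendsto_nhds_zero.1 hFlim e he).and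
    (nhdsWithin_le_nhds (Iio_mem_nhds (lt_min ha one_pos)))).and self_mem_nhdsWithin).exists
  have ht0 : 0 < t := ht0
  have hta : t < min a 1 := hta
  filter_upwards [hgeo, nhdsWithin_le_nhds (Iio_mem_nhds ht0),
    h.eventually_curvature (k := k) hm ha ha' ht0 ht0 (hta.le.trans (min_le_right _ _))
      (hta.le.trans (min_le_left _ _))] with ε ⟨_, _, _, _, hcV, hV⟩ hεt hcurv
  refine le_trans (hypersurfaceNorm_one_le
    (A := {x ∈ doubleGraph (m + 1) (k + 1) ε (φ ε) | t ≤ polarAngle x})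
    (B := {x ∈ doubleGraph (m + 1) (k + 1) ε (φ ε) | polarAngle x ≤ t}) (s := t) (t := 10)
    (fun x hx => (le_total t (polarAngle x)).imp (fun h => ⟨hx, h⟩) fun h => ⟨hx, h⟩)
    (sep_subset _ _) hcV (fun x hx => ((hcurv x hx.1).1 hx.2).1) fun x hx => ?_) (le_trans ?_ ht)
  · have := ((hcurv x hx.1).2 hx.2).1
    rw [abs_le] at this ⊢
    constructor <;> linarith
  · simp only [hF]
    gcongr
    exact hV t (le_of_lt hεt)

theorem tendsto_norm_sub_one (h : IsProfileFamily m a φ) (hm : m ≠ 0) (ha : 0 < a)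
    (ha' : 2 * a < π / 4) :
    Tendsto (fun ε => hypersurfaceNorm (m + k + 1) (doubleGraph (m + 1) (k + 1) ε (φ ε)) ∞
      (fun x => ‖x‖ - 1)) (𝓝[>] 0) (𝓝 0) := by
  obtain ⟨C, c, -, hgeo⟩ := h.exists_eventually_geometry (k := k) hm ha ha'
  rw [ENNReal.tendsto_nhds_zero]
  intro e he
  obtain ⟨b, hb0, hbe⟩ := ENNReal.lt_iff_exists_nnreal_btwn.1 he
  filter_upwards [hgeo, h.eventually_abs_norm_sub_one_le (k := k) hm ha ha'
    (η := b) (by exact_mod_cast hb0)] with ε ⟨_, hM, _⟩ hle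
  refine (hypersurfaceNorm_top_le hM.measurableSet hle).trans ?_
  rw [ENNReal.ofReal_coe_nnreal]
  exact hbe.le

end IsProfileFamily

end Main

theorem theorem6p2 (n k : ℕ) (hk : k + 2 ≤ n) (a : ℝ) (ha : 0 < a) (ha' : a < π / 10) :
    (∃ φ : ℝ → ℝ → ℝ, IsProfileFamily (n - k - 1) a φ) ∧
    ∀ φ : ℝ → ℝ → ℝ, IsProfileFamily (n - k - 1) a φ →
      (∀ᶠ ε in 𝓝[>] (0 : ℝ), IsCompact (gluedSpheres n k ε (φ ε)) ∧
        IsSmoothHypersurface (gluedSpheres n k ε (φ ε))) ∧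
      (∃ C : ℝ≥0, ∀ᶠ ε in 𝓝[>] (0 : ℝ),
        hypersurfaceNorm n (gluedSpheres n k ε (φ ε)) ∞
          (meanCurvature (gluedSpheres n k ε (φ ε))) ≤ C) ∧
      (∃ C : ℝ≥0, ∀ᶠ ε in 𝓝[>] (0 : ℝ),
        hypersurfaceNorm n (gluedSpheres n k ε (φ ε)) ((n - k : ℕ) : ℝ≥0∞)
          (secondFundamentalNorm (gluedSpheres n k ε (φ ε))) ≤ C) ∧
      Tendsto (fun ε => hypersurfaceNorm n (gluedSpheres n k ε (φ ε)) 1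
          (fun x => meanCurvature (gluedSpheres n k ε (φ ε)) x - 1)) (𝓝[>] 0) (𝓝 0) ∧
      Tendsto (fun ε => hypersurfaceNorm n (gluedSpheres n k ε (φ ε)) ∞
          (fun x => ‖x‖ - 1)) (𝓝[>] 0) (𝓝 0) := by
  have ha4 : 2 * a < π / 4 := by linarith [pi_pos]
  refine ⟨exists_isProfileFamily (by omega) ha, fun φ hφ => ?_⟩
  obtain ⟨m, rfl, hm⟩ : ∃ m, n = m + k + 1 ∧ m ≠ 0 := ⟨n - k - 1, by omega, by omega⟩
  rw [show m + k + 1 - k - 1 = m by omega] at hφ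
  -- The ambient space depends on `n - k`, which is replaced by `m + 1` in one step.
  have key : ∀ p, p = m + 1 →
      (∀ᶠ ε in 𝓝[>] (0 : ℝ), IsCompact (doubleGraph p (k + 1) ε (φ ε)) ∧
        IsSmoothHypersurface (doubleGraph p (k + 1) ε (φ ε))) ∧
      (∃ C : ℝ≥0, ∀ᶠ ε in 𝓝[>] (0 : ℝ),
        hypersurfaceNorm (m + k + 1) (doubleGraph p (k + 1) ε (φ ε)) ∞
          (meanCurvature (doubleGraph p (k + 1) ε (φ ε))) ≤ C) ∧
      (∃ C : ℝ≥0, ∀ᶠ ε in 𝓝[>] (0 : ℝ),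
        hypersurfaceNorm (m + k + 1) (doubleGraph p (k + 1) ε (φ ε)) (p : ℝ≥0∞)
          (secondFundamentalNorm (doubleGraph p (k + 1) ε (φ ε))) ≤ C) ∧
      Tendsto (fun ε => hypersurfaceNorm (m + k + 1) (doubleGraph p (k + 1) ε (φ ε)) 1
          (fun x => meanCurvature (doubleGraph p (k + 1) ε (φ ε)) x - 1)) (𝓝[>] 0) (𝓝 0) ∧
      Tendsto (fun ε => hypersurfaceNorm (m + k + 1) (doubleGraph p (k + 1) ε (φ ε)) ∞
          (fun x => ‖x‖ - 1)) (𝓝[>] 0) (𝓝 0) := by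
    rintro p rfl
    obtain ⟨C, c, -, hgeo⟩ := hφ.exists_eventually_geometry (k := k) hm ha ha4
    exact ⟨hgeo.mono fun ε h => ⟨h.2.1, h.2.2.1⟩, hφ.exists_meanCurvature_top_le hm ha ha4,
      hφ.exists_secondFundamentalNorm_le hm ha ha4, hφ.tendsto_meanCurvature_sub_one hm ha ha4,
      hφ.tendsto_norm_sub_one hm ha ha4⟩
  exact key (m + k + 1 - k) (by omega)
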